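/- **Definitions.** A timed word over a finite alphabet $\Sigma$ is a finite sequence $w=(a_1,t_1)\dots(a_n,t_n)$ with $a_i\in\Sigma$ and $0\le t_1\le\dots\le t_n$ real; $\mathrm{dur}(w)=t_n$ (and $0$ for the empty word). For $v=(b_1,s_1)\dots(b_m,s_m)$ put $\overrightarrow d(w,v)=\max_i\min_j\{|t_i-s_j| : a_i=b_j\}$ (with $\min\emptyset=\infty$, $\max\emptyset=0$) and $d(w,v)=\max(\overrightarrow d(w,v),\overrightarrow d(v,w))$. For a set $L$ of timed words let $L_T=\{w\in L:\mathrm{dur}(w)\le T\}$. A subset $M\subseteq L$ is $\varepsilon$-separated if $d(x,y)>\varepsilon$ for all $x\ne y$ in $M$; a set $N$ of timed words is an $\varepsilon$-net of $L$ if every $y\in L$ has some $s\in N$ with $d(y,s)\le\varepsilon$. Let $\mathcal C_\varepsilon(L)$ be the base-2 logarithm of the largest cardinality of an $\varepsilon$-separated subset of $L$, $\mathcal H_\varepsilon(L)$ that of the smallest cardinality of an $\varepsilon$-net of $L$, and $\Upsilon(L)$ the largest cardinality of a $0$-separated subset of $L$. The capacitive and entropic bandwidths are $\mathcal{BC}_\varepsilon(L)=\limsup_{T\to\infty}\mathcal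 C_\varepsilon(L_T)/T$ and $\mathcal{BH}_\varepsilon(L)=\limsup_{T\to\infty}\mathcal H_\varepsilon(L_T)/T$. A simply-timed graph $\mathcal G=(Q,\Sigma,\Delta)$ consists of finite sets $Q$, $\Sigma$ and a finite set $\Delta\subset Q\times\mathbb Q_{\ge0}\times\Sigma\times Q$. Its language $L(\mathcal G)$ is the set of timed words $(a_1,t_1)\dots(a_n,t_n)$ for which there are states $q^0,\dots,q^n$ with $(q^{i-1},t_i-t_{i-1},a_i,q^i)\in\Delta$ for $1\le i\le n$, where $t_0=0$. Its growth rate is $\beta(\mathcal G)=\lim_{T\to\infty}\frac1T\log_2\Upsilon(L(\mathcal G)_T)$, when this limit exists and is finite. The $0$-elimination $\nu(\mathcal G)$ has states $Q$, alphabet $2^\Sigma\setminus\{\emptyset\}$, and a transition $(p,d,B,q)$ whenever $d>0$ and there are $k\ge0$ and $(p,d,a_0,q_0),(q_0,0,a_1,q_1),\dots,(q_{k-1},0,a_k,q_k)\in\Delta$ with $q_k=q$ and $B=\{a_0,\dots,a_k\}$. The determinization of a graph has as states the non-empty sets of states, with a transition $(S,d,a,S')$ whenever $S'\neq\emptyset$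 is the set of all destinations of transitions with delay $d$ and label $a$ from states of $S$. The adjacency matrix $M(z)$ of a graph has entries $m_{pq}(z)=\sum_{(p,d,a,q)\in\Delta}z^d$ (principal branch), and its characteristic quasi-polynomial is $\psi(z)=\det(I-M(z))$. **Theorem.** Let $\mathcal G$ be a simply-timed graph with non-empty language. Then: 1. The growth rate $\beta(\mathcal G)$ exists (and is finite), and there is $\varepsilon_0>0$ such that for all $0<\varepsilon<\varepsilon_0$ $$\mathcal{BC}_\varepsilon(L(\mathcal G))=\mathcal{BH}_\varepsilon(L(\mathcal G))=\beta(\mathcal G).$$ 2. Let $\psi$ be the characteristic quasi-polynomial of the determinization of $\nu(\mathcal G)$. Either $\psi$ has a complex root, and then it has a real root $z_0>0$ of smallest modulus among all complex roots and $\beta(\mathcal G)=-\log_2 z_0$; or $\psi$ has no complex root, and then $\beta(\mathcal G)=0$. 3. $\beta(\mathcal G)=\log_2\alpha$ for some real algebraic number $\alpha>0$, and $\alpha$ is computable from $\mathcal G$: there is a single computable function that, given any finite description of a simply-timed graph $\mathcal G$ with non-empty language (numbers of states and letters, list of transitions), outputs a non-zero integer polynomial and a closed interval with rational endpoints in which $\alpha$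 is the only real root of this polynomial. -/

import Mathlib

open scoped NNReal ENNReal Topology

noncomputable section

/-- Timed words over `A`: finite sequences of (letter, date) with non-decreasing dates. -/
def TimedWord (A : Type*) : Type _ :=
  {w : List (A × ℝ≥0) // (w.map Prod.snd).Pairwise (· ≤ ·)}

namespace TimedWord

variable {A : Type*}

/-- The duration of a timed word: its last date (`0` for the empty word). -/
def dur (w : TimedWord A) : ℝ≥0 := (w.1.map Prod.snd).getLastD 0

/-- The directed distance `max_i min_j {|t_i - s_j| : a_i = b_j}`, with `min ∅ = ∞`
(and `max ∅ = 0`). -/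
def ddist (w v : TimedWord A) : ℝ≥0∞ :=
  ⨆ x ∈ w.1, ⨅ y ∈ v.1, ⨅ _ : x.1 = y.1, edist x.2 y.2

/-- The pseudo-distance on timed words. -/
def dist (w v : TimedWord A) : ℝ≥0∞ := max (ddist w v) (ddist v w)

/-- The time-restricted language `L_T`. -/
def restrict (L : Set (TimedWord A)) (T : ℝ) : Set (TimedWord A) :=
  {w ∈ L | (w.dur : ℝ) ≤ T}

/-- `M` is an `ε`-separated subset of `L`. -/
def IsSeparatedIn (ε : ℝ≥0) (L M : Set (TimedWord A)) : Prop :=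
  M ⊆ L ∧ ∀ x ∈ M, ∀ y ∈ M, x ≠ y → (ε : ℝ≥0∞) < dist x y

/-- `N` is an `ε`-net of `L`; the points of `N` need not belong to `L`. -/
def IsNetOf (ε : ℝ≥0) (L N : Set (TimedWord A)) : Prop :=
  ∀ y ∈ L, ∃ s ∈ N, dist y s ≤ (ε : ℝ≥0∞)

/-- The largest cardinality of an `ε`-separated subset of `L`. -/
def maxSeparated (ε : ℝ≥0) (L : Set (TimedWord A)) : ℕ∞ :=
  ⨆ M ∈ {M | IsSeparatedIn ε L M}, M.encard

/-- The smallest cardinality of an `ε`-net of `L`. -/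
def minNet (ε : ℝ≥0) (L : Set (TimedWord A)) : ℕ∞ :=
  ⨅ N ∈ {N | IsNetOf ε L N}, N.encard

/-- Logarithm in base 2 of a possibly infinite cardinality (`log 0 = -∞`, `log ∞ = ∞`). -/
def log2 (n : ℕ∞) : EReal := ENNReal.log (n : ℝ≥0∞) / ((Real.log 2 : ℝ) : EReal)

/-- The `ε`-capacity. -/
def capacity (ε : ℝ≥0) (L : Set (TimedWord A)) : EReal := log2 (maxSeparated ε L)

/-- The `ε`-entropy. -/
def entropy (ε : ℝ≥0) (L : Set (TimedWord A)) : EReal := log2 (minNet ε L)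

/-- The `ε`-capacitive bandwidth. -/
def capacitiveBandwidth (ε : ℝ≥0) (L : Set (TimedWord A)) : EReal :=
  Filter.limsup (fun T : ℝ => capacity ε (restrict L T) / (T : EReal)) Filter.atTop

/-- The `ε`-entropic bandwidth. -/
def entropicBandwidth (ε : ℝ≥0) (L : Set (TimedWord A)) : EReal :=
  Filter.limsup (fun T : ℝ => entropy ε (restrict L T) / (T : EReal)) Filter.atTop

/-- The size of a set of timed words: the largest cardinality of a `0`-separated subset. -/
def size (L : Set (TimedWord A)) : ℕ∞ := maxSeparated 0 L

end TimedWord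

/-- A simply-timed graph with states `Q` and alphabet `A` (both finite where it matters):
a finite set of transitions (origin, delay, label, destination). -/
structure STG (Q A : Type*) where
  trans : Finset (Q × ℚ≥0 × A × Q)

namespace STG

variable {Q A : Type*}

/-- `G.RunOn q s w`: starting in state `q` at date `s`, there is a run on the sequence `w` of
dated letters. -/
def RunOn (G : STG Q A) : Q → ℝ≥0 → List (A × ℝ≥0) → Prop
  | _, _, [] => True
  | q, s, (a, t) :: w =>
      ∃ (d : ℚ≥0) (q' : Q), (q, d, a, q') ∈ G.trans ∧ t = s + (d : ℝ≥0) ∧ G.RunOn q' t w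

/-- The timed language of `G`: every state is initial and final, and time starts at `0`. -/
def language (G : STG Q A) : Set (TimedWord A) := {w | ∃ q, G.RunOn q 0 w.1}

/-- `β` is the growth rate of `G`: the limit of `log Υ(L_T) / T` exists and is the real `β`. -/
def HasGrowthRate (G : STG Q A) (β : ℝ) : Prop :=
  Filter.Tendsto
    (fun T : ℝ => TimedWord.log2 (TimedWord.size (TimedWord.restrict G.language T)) / (T : EReal))
    Filter.atTop (𝓝 (β : EReal))

/-- A path of instantaneous transitions reading the given letters. -/
def ZeroPath (G : STG Q A) : Q → List A → Q → Prop
  | p, [], q => p = q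
  | p, a :: l, q => ∃ p', (p, 0, a, p') ∈ G.trans ∧ G.ZeroPath p' l q

/-- The delays occurring in `G`. -/
def delays (G : STG Q A) : Finset ℚ≥0 := G.trans.image fun t => t.2.1

open Classical in
/-- 0-elimination: each transition of positive delay is combined with a subsequent (possibly
empty) path of instantaneous transitions, and labelled by the set of letters read. -/
def zeroElim [Fintype Q] [Fintype A] (G : STG Q A) : STG Q {B : Finset A // B.Nonempty} where
  trans := (Finset.univ ×ˢ G.delays ×ˢ Finset.univ ×ˢ Finset.univ).filter fun t =>
    0 < t.2.1 ∧ ∃ (a : A) (q₀ : Q) (l : List A),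
      (t.1, t.2.1, a, q₀) ∈ G.trans ∧ G.ZeroPath q₀ l t.2.2.2 ∧
        ∀ x, x ∈ t.2.2.1.1 ↔ x ∈ a :: l

/-- Determinization by the subset construction: states are the non-empty sets of states, and
reading `(d, a)` leads from `S` to the set of all `(d, a)`-successors of `S`, if non-empty. -/
def determinize [Fintype Q] [Fintype A] (G : STG Q A) : STG {S : Finset Q // S.Nonempty} A where
  trans := open Classical in
    (Finset.univ ×ˢ G.delays ×ˢ Finset.univ ×ˢ Finset.univ).filter fun t =>
      ∀ q, q ∈ t.2.2.2.1 ↔ ∃ p ∈ t.1.1, (p, t.2.1, t.2.2.1, q) ∈ G.trans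

open Classical in
/-- The adjacency matrix `M_G(z)`, with entries `∑ z ^ d` over the transitions from `i` to `j`
(principal branch of the power). -/
def adjMatrix (G : STG Q A) (z : ℂ) : Matrix Q Q ℂ := fun i j =>
  ∑ t ∈ G.trans with t.1 = i ∧ t.2.2.2 = j, z ^ ((t.2.1 : ℚ≥0) : ℂ)

open Classical in
/-- The characteristic quasi-polynomial `det (I - M_G(z))`. -/
def charQuasiPoly [Fintype Q] (G : STG Q A) (z : ℂ) : ℂ := (1 - G.adjMatrix z).det

end STG

/-- The non-negative rational number `p / (q + 1)` coded by a pair `(p, q)`. -/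
def ratOfCode (c : ℕ × ℕ) : ℚ≥0 := (c.1 : ℚ≥0) / ((c.2 : ℚ≥0) + 1)

/-- Finite descriptions of simply-timed graphs: number of states, number of letters, and the list
of transitions, states and letters being numbered from `0`. -/
abbrev STGCode : Type := ℕ × ℕ × List (ℕ × (ℕ × ℕ) × ℕ × ℕ)

/-- `c` describes `G`, for some numbering of the states and of the letters. -/
def STGCode.Describes {Q A : Type*} (c : STGCode) (G : STG Q A) : Prop :=
  ∃ (eQ : Q ≃ Fin c.1) (eA : A ≃ Fin c.2.1),
    (∀ t ∈ G.trans, ∃ x ∈ c.2.2,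
      x.1 = eQ t.1 ∧ ratOfCode x.2.1 = t.2.1 ∧ x.2.2.1 = eA t.2.2.1 ∧ x.2.2.2 = eQ t.2.2.2) ∧
    (∀ x ∈ c.2.2, ∃ t ∈ G.trans,
      x.1 = eQ t.1 ∧ ratOfCode x.2.1 = t.2.1 ∧ x.2.2.1 = eA t.2.2.1 ∧ x.2.2.2 = eQ t.2.2.2)

/-- Exact finite descriptions of non-negative real algebraic numbers: the coefficients of an
integer polynomial, constant term first, each given as a difference of two natural numbers, and
the two rational endpoints of an isolating interval. -/
abbrev AlgCode : Type := List (ℕ × ℕ) × (ℕ × ℕ) × (ℕ × ℕ)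

/-- The integer polynomial with the given list of coefficients. -/
def polyOfCode : List (ℕ × ℕ) → Polynomial ℤ
  | [] => 0
  | c :: l => Polynomial.C ((c.1 : ℤ) - (c.2 : ℤ)) + Polynomial.X * polyOfCode l

/-- `α` is the number described by `c`: the polynomial is non-zero, and `α` is its only real root
in the given closed interval. -/
def AlgCode.Describes (c : AlgCode) (α : ℝ) : Prop :=
  polyOfCode c.1 ≠ 0 ∧
    {x : ℝ | (ratOfCode c.2.1 : ℝ) ≤ x ∧ x ≤ (ratOfCode c.2.2 : ℝ) ∧
      Polynomial.aeval x (polyOfCode c.1) = 0} = {α}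

end

/-!
All dates of words in the language lie on a grid of step `1 / D`, where `D` is a common denominator
of the delays. For precisions below half that step, both the largest separated set and the smallest
net of `L_T` therefore have as many elements as there are event sets (sets of pairs of a letter and
a date) of words of duration at most `T`. Cutting runs shows that the number `U n` of event sets up
to tick `n` satisfies `U (n + m) ≤ C * U n * U m`; hence, by Fekete's lemma, `U` has a growth rate
`γ`, with `γ ^ n ≤ C * U n`, and `β = log₂ (γ ^ D)`.

Up to the letters at date `0`, the event sets are the words of the 0-elimination, and its
determinization reads each word along at most one path from each of its states. The generating
functions of these words solve the linear system `f = 1 + M f`, so `U` satisfies a linear recurrence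
whose order is bounded in terms of the graph, and `γ` is algebraic. As all coefficients are
non-negative and `γ ^ n ≤ C * U n`, the generating function of `U` diverges at `γ⁻¹`: either
`det (1 - M)` vanishes there and nowhere closer to `0`, or it vanishes nowhere at all.

To compute `α = γ ^ D`, enumerate candidate polynomials and intervals together with finite
certificates that the interval contains `α` and no other root: an upper bound for `α` is certified
by one inequality `C * U (D * k) ≤ y ^ k`, a lower bound `x` by a partial sum of the generating
function at `x⁻¹` that reaches the value which the recurrence would give the whole series if it
converged. Whether a candidate is certified is decidable, and some candidate always is.
-/

namespace TimedWord

variable {A : Type*}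

/-- The set of dated letters of a timed word, which forgets the order of simultaneous letters and
their multiplicity: it determines the word up to distance `0`. -/
def events (w : TimedWord A) : Set (A × ℝ≥0) := {x | x ∈ w.1}

theorem exists_edist_lt_of_ddist_lt {w v : TimedWord A} {r : ℝ≥0∞} (h : ddist w v < r)
    {x : A × ℝ≥0} (hx : x ∈ events w) : ∃ y ∈ events v, x.1 = y.1 ∧ edist x.2 y.2 < r := by
  have hinf : (⨅ y ∈ v.1, ⨅ _ : x.1 = y.1, edist x.2 y.2) < r :=
    (le_iSup₂ (f := fun (x : A × ℝ≥0) (_ : x ∈ w.1) =>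
      ⨅ y ∈ v.1, ⨅ _ : x.1 = y.1, edist x.2 y.2) x hx).trans_lt h
  simp only [iInf_lt_iff, exists_prop] at hinf
  exact hinf

theorem ddist_eq_zero_of_subset {w v : TimedWord A} (h : events w ⊆ events v) :
    ddist w v = 0 := by
  refine le_antisymm (iSup₂_le fun x hx => ?_) zero_le
  exact (iInf₂_le x (h hx)).trans ((iInf_le _ rfl).trans (edist_self _).le)

theorem dist_eq_zero_of_events_eq {w v : TimedWord A} (h : events w = events v) :
    dist w v = 0 := by
  simp [dist, ddist_eq_zero_of_subset h.le, ddist_eq_zero_of_subset h.ge]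

theorem IsSeparatedIn.injOn_events {ε : ℝ≥0} {L M : Set (TimedWord A)}
    (hM : IsSeparatedIn ε L M) : Set.InjOn events M := by
  intro x hx y hy hxy
  by_contra hne
  simpa [dist_eq_zero_of_events_eq hxy] using hM.2 x hx y hy hne

theorem maxSeparated_eq_encard_events {L : Set (TimedWord A)} {ε : ℝ≥0}
    (h : ∀ x ∈ L, ∀ y ∈ L, dist x y ≤ ε → events x = events y) :
    maxSeparated ε L = (events '' L).encard := by
  apply le_antisymm
  · refine iSup₂_le fun M hM => ?_
    rw [← hM.injOn_events.encard_image]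
    exact Set.encard_le_encard (Set.image_mono hM.1)
  · obtain ⟨M, hML, hM⟩ := (Set.surjOn_image events L).exists_bijOn_subset
    rw [← hM.image_eq, hM.injOn.encard_image]
    refine le_iSup₂ (f := fun (M : Set (TimedWord A)) (_ : M ∈ {M | IsSeparatedIn ε L M}) =>
      M.encard) M ⟨hML, fun x hx y hy hne => ?_⟩
    exact not_le.mp fun hle => hne (hM.injOn hx hy (h x (hML hx) y (hML hy) hle))

theorem minNet_le_encard_events (ε : ℝ≥0) (L : Set (TimedWord A)) :
    minNet ε L ≤ (events '' L).encard := by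
  obtain ⟨M, -, hM⟩ := (Set.surjOn_image events L).exists_bijOn_subset
  rw [← hM.image_eq, hM.injOn.encard_image]
  refine iInf₂_le (f := fun (N : Set (TimedWord A)) (_ : N ∈ {N | IsNetOf ε L N}) =>
    N.encard) M fun y hy => ?_
  obtain ⟨s, hs, hsy⟩ := hM.surjOn (Set.mem_image_of_mem events hy)
  exact ⟨s, hs, by simp [dist_eq_zero_of_events_eq hsy.symm]⟩

theorem minNet_eq_encard_events {L : Set (TimedWord A)} {ε : ℝ≥0}
    (h : ∀ x ∈ L, ∀ y ∈ L, ∀ s, dist x s ≤ ε → dist y s ≤ ε → events x = events y) :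
    minNet ε L = (events '' L).encard := by
  refine le_antisymm (minNet_le_encard_events ε L) (le_iInf₂ fun N hN => ?_)
  have hnear (e : events '' L) : ∃ s ∈ N, ∃ y ∈ L, events y = e ∧ dist y s ≤ ε := by
    obtain ⟨_, y, hy, rfl⟩ := e
    obtain ⟨s, hs, hd⟩ := hN y hy
    exact ⟨s, hs, y, hy, rfl, hd⟩
  choose s hsN y hyL hye hys using hnear
  have hinj : Function.Injective fun e => (⟨s e, hsN e⟩ : N) := by
    intro e e' hee
    have hs : s e = s e' := congrArg Subtype.val hee
    rw [Subtype.ext_iff, ← hye e, ← hye e']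
    exact h _ (hyL e) _ (hyL e') _ (hys e) (hs ▸ hys e')
  exact (Function.Embedding.mk _ hinj).encard_le

/-- All dates of the words of `L` belong to `S`. -/
def DatedIn (S : Set ℝ≥0) (L : Set (TimedWord A)) : Prop :=
  ∀ w ∈ L, ∀ x ∈ events w, x.2 ∈ S

namespace DatedIn

variable {S : Set ℝ≥0} {L : Set (TimedWord A)} {r ε : ℝ≥0}

theorem events_subset_of_dist_lt (hL : DatedIn S L)
    (hS : S.Pairwise fun t u => 2 * (r : ℝ≥0∞) ≤ edist t u) {x y s : TimedWord A}
    (hx : x ∈ L) (hy : y ∈ L) (hxs : dist x s < r) (hys : dist y s < r) :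
    events x ⊆ events y := by
  intro e he
  obtain ⟨u, hu, heu, hdeu⟩ := exists_edist_lt_of_ddist_lt ((le_max_left _ _).trans_lt hxs) he
  obtain ⟨v, hv, huv, hduv⟩ := exists_edist_lt_of_ddist_lt ((le_max_right _ _).trans_lt hys) hu
  have hdate : e.2 = v.2 := by
    refine hS.eq (hL x hx e he) (hL y hy v hv) (not_le.mpr ?_)
    rw [two_mul]
    exact (edist_triangle _ u.2 _).trans_lt (ENNReal.add_lt_add hdeu hduv)
  exact Prod.ext (heu.trans huv) hdate ▸ hv

theorem events_eq_of_dist_lt (hL : DatedIn S L)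
    (hS : S.Pairwise fun t u => 2 * (r : ℝ≥0∞) ≤ edist t u) {x y s : TimedWord A}
    (hx : x ∈ L) (hy : y ∈ L) (hxs : dist x s < r) (hys : dist y s < r) :
    events x = events y :=
  (hL.events_subset_of_dist_lt hS hx hy hxs hys).antisymm
    (hL.events_subset_of_dist_lt hS hy hx hys hxs)

theorem maxSeparated_eq (hL : DatedIn S L)
    (hS : S.Pairwise fun t u => 2 * (r : ℝ≥0∞) ≤ edist t u) (hε : ε < r) :
    maxSeparated ε L = (events '' L).encard := by
  refine maxSeparated_eq_encard_events fun x hx y hy h => ?_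
  refine hL.events_eq_of_dist_lt hS (s := y) hx hy (h.trans_lt (by exact_mod_cast hε)) ?_
  rw [dist_eq_zero_of_events_eq rfl]
  exact_mod_cast pos_of_gt hε

theorem minNet_eq (hL : DatedIn S L)
    (hS : S.Pairwise fun t u => 2 * (r : ℝ≥0∞) ≤ edist t u) (hε : ε < r) :
    minNet ε L = (events '' L).encard := by
  have hε' : (ε : ℝ≥0∞) < r := by exact_mod_cast hε
  exact minNet_eq_encard_events fun x hx y hy s hxs hys =>
    hL.events_eq_of_dist_lt hS hx hy (hxs.trans_lt hε') (hys.trans_lt hε')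

end DatedIn

end TimedWord

theorem pairwise_range_div_le_edist (D : ℕ) :
    (Set.range fun j : ℕ => (j : ℝ≥0) / D).Pairwise
      fun t u => 2 * ((1 / (2 * D) : ℝ≥0) : ℝ≥0∞) ≤ edist t u := by
  rintro _ ⟨i, rfl⟩ _ ⟨j, rfl⟩ hne
  have hij : i ≠ j := fun h => hne (by rw [h])
  have hdist : (1 : ℝ) ≤ |(i : ℝ) - j| := by
    exact_mod_cast Int.one_le_abs (sub_ne_zero.mpr (Nat.cast_injective.ne hij))
  have hle : 2 * (1 / (2 * D) : ℝ≥0) ≤ nndist ((i : ℝ≥0) / D) ((j : ℝ≥0) / D) := by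
    rw [← NNReal.coe_le_coe, coe_nndist, NNReal.dist_eq]
    push_cast
    rw [← sub_div, abs_div, Nat.abs_cast, ← mul_div_assoc, mul_div_mul_left _ _ two_ne_zero]
    gcongr
  rw [edist_nndist]
  exact_mod_cast hle

section EventRun

variable {Q A : Type*}

/-- Delay the events of `E` by `k` ticks. -/
def shiftBy (k : ℕ) (E : Set (A × ℕ)) : Set (A × ℕ) :=
  Set.image (fun x => (x.1, x.2 + k)) E

/-- `EventRun Δ q n E`: some run from `q` in the graph with integer delays `Δ` has duration `n`
and set of dated letters `E`. -/
inductive EventRun (Δ : Set (Q × ℕ × A × Q)) : Q → ℕ → Set (A × ℕ) → Prop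
  | nil (q : Q) : EventRun Δ q 0 ∅
  | cons {q : Q} {k : ℕ} {a : A} {q' : Q} {n : ℕ} {E : Set (A × ℕ)} :
      (q, k, a, q') ∈ Δ → EventRun Δ q' n E →
        EventRun Δ q (n + k) (shiftBy k (insert (a, 0) E))

/-- The sets of dated letters of the runs of duration exactly `n`. -/
def exactEventSets (Δ : Set (Q × ℕ × A × Q)) (n : ℕ) : Set (Set (A × ℕ)) :=
  {E | ∃ q, EventRun Δ q n E}

/-- The sets of dated letters of the runs of duration at most `n`: the integer version of the
words of `L_T`, up to distance `0`. -/
def eventSets (Δ : Set (Q × ℕ × A × Q)) (n : ℕ) : Set (Set (A × ℕ)) :=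
  {E | ∃ m ≤ n, E ∈ exactEventSets Δ m}

variable {Δ : Set (Q × ℕ × A × Q)}

theorem shiftBy_shiftBy (j k : ℕ) (E : Set (A × ℕ)) :
    shiftBy k (shiftBy j E) = shiftBy (j + k) E := by
  simp [shiftBy, Set.image_image, add_assoc]

theorem shiftBy_union (k : ℕ) (E F : Set (A × ℕ)) :
    shiftBy k (E ∪ F) = shiftBy k E ∪ shiftBy k F := Set.image_union _ _ _

theorem EventRun.le_of_mem {q : Q} {n : ℕ} {E : Set (A × ℕ)} (h : EventRun Δ q n E) :
    ∀ x ∈ E, x.2 ≤ n := by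
  induction h with
  | nil => simp
  | cons _ _ ih =>
    rintro _ ⟨y, rfl | hy, rfl⟩
    · simp
    · simpa using ih y hy

theorem EventRun.isGreatest {q : Q} {n : ℕ} {E : Set (A × ℕ)} (h : EventRun Δ q n E) :
    (E = ∅ ∧ n = 0) ∨ IsGreatest (Prod.snd '' E) n := by
  induction h with
  | nil => exact Or.inl ⟨rfl, rfl⟩
  | @cons _ k a q' n E ht hE ih =>
    have hlast : ∃ y ∈ insert (a, 0) E, y.2 = n := by
      rcases ih with ⟨rfl, rfl⟩ | h
      · exact ⟨(a, 0), by simp, rfl⟩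
      · obtain ⟨y, hy, hyn⟩ := h.1
        exact ⟨y, Set.mem_insert_of_mem _ hy, hyn⟩
    refine Or.inr ⟨?_, Set.forall_mem_image.mpr (EventRun.cons ht hE).le_of_mem⟩
    obtain ⟨y, hy, rfl⟩ := hlast
    exact ⟨_, ⟨y, hy, rfl⟩, rfl⟩

/-- The last tick of an event set; the duration of a run can be read off its event set. -/
noncomputable def lastTick (E : Set (A × ℕ)) : ℕ := sSup (Prod.snd '' E)

theorem EventRun.lastTick_eq {q : Q} {n : ℕ} {E : Set (A × ℕ)} (h : EventRun Δ q n E) :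
    lastTick E = n := by
  rcases h.isGreatest with ⟨rfl, rfl⟩ | h
  · simp [lastTick]
  · exact h.csSup_eq

theorem EventRun.exists_split {q : Q} {d : ℕ} {E : Set (A × ℕ)} (h : EventRun Δ q d E) :
    ∀ n < d, ∃ d₁ E₁ k a q₁ q₂ d₂ E₂, EventRun Δ q d₁ E₁ ∧ d₁ ≤ n ∧ (q₁, k, a, q₂) ∈ Δ ∧
      EventRun Δ q₂ d₂ E₂ ∧ d₁ + k + d₂ = d ∧ n < d₁ + k ∧
      E = E₁ ∪ shiftBy (d₁ + k) (insert (a, 0) E₂) := by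
  induction h with
  | nil => exact fun n hn => absurd hn n.not_lt_zero
  | @cons q k a q' d E ht hE ih =>
    intro n hn
    by_cases hk : n < k
    · exact ⟨0, ∅, k, a, q, q', d, E, .nil q, by simp, ht, hE, by omega, by omega, by simp⟩
    · obtain ⟨d₁, E₁, k₁, a₁, q₁, q₂, d₂, E₂, h₁, hd₁, ht₁, h₂, hd, hlt, rfl⟩ :=
        ih (n - k) (by omega)
      refine ⟨d₁ + k, _, k₁, a₁, q₁, q₂, d₂, E₂, .cons ht h₁, by omega, ht₁, h₂, by omega,
        by omega, ?_⟩
      rw [← Set.insert_union, shiftBy_union, shiftBy_shiftBy, add_right_comm]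

theorem exactEventSets_subset_eventSets {m n : ℕ} (h : m ≤ n) :
    exactEventSets Δ m ⊆ eventSets Δ n := fun _ hE => ⟨m, h, hE⟩

theorem finite_eventSets [Finite A] (n : ℕ) : (eventSets Δ n).Finite := by
  refine ((Set.finite_univ (α := A)).prod (Set.finite_Iic n)).finite_subsets.subset ?_
  rintro E ⟨m, hm, q, hE⟩ x hx
  exact ⟨trivial, (hE.le_of_mem x hx).trans hm⟩

theorem one_le_ncard_eventSets [Finite A] [Nonempty Q] (n : ℕ) : 1 ≤ (eventSets Δ n).ncard := by
  rw [Nat.succ_le_iff, Set.ncard_pos (finite_eventSets n)]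
  exact ⟨∅, 0, n.zero_le, Classical.arbitrary Q, .nil _⟩

theorem eventSets_zero : eventSets Δ 0 = exactEventSets Δ 0 := by
  simp [eventSets]

theorem eventSets_succ (n : ℕ) :
    eventSets Δ (n + 1) = eventSets Δ n ∪ exactEventSets Δ (n + 1) := by
  ext E
  simp [eventSets, Nat.le_succ_iff, or_and_right, exists_or]

theorem disjoint_eventSets_exactEventSets (n : ℕ) :
    Disjoint (eventSets Δ n) (exactEventSets Δ (n + 1)) := by
  refine Set.disjoint_left.mpr ?_
  rintro E ⟨m, hm, q, hE⟩ ⟨q', hE'⟩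
  have := hE.lastTick_eq.symm.trans hE'.lastTick_eq
  omega

theorem ncard_eventSets_eq_sum [Finite A] (n : ℕ) :
    (eventSets Δ n).ncard = ∑ m ∈ Finset.range (n + 1), (exactEventSets Δ m).ncard := by
  induction n with
  | zero => simp [eventSets_zero]
  | succ n ih =>
    rw [eventSets_succ, Set.ncard_union_eq (disjoint_eventSets_exactEventSets n)
      (finite_eventSets n)
      ((finite_eventSets (n + 1)).subset (exactEventSets_subset_eventSets le_rfl)),
      ih, Finset.sum_range_succ _ (n + 1)]

theorem eventSets_add_subset (n m : ℕ) :
    eventSets Δ (n + m) ⊆ eventSets Δ n ∪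
      (fun p : Set (A × ℕ) × (Q × ℕ × A × Q) × Set (A × ℕ) =>
          p.1 ∪ shiftBy (lastTick p.1 + p.2.1.2.1) (insert (p.2.1.2.2.1, 0) p.2.2)) ''
        (eventSets Δ n ×ˢ Δ ×ˢ eventSets Δ m) := by
  rintro E ⟨d, hd, q, hE⟩
  rcases le_or_gt d n with hdn | hdn
  · exact Or.inl ⟨d, hdn, q, hE⟩
  · obtain ⟨d₁, E₁, k, a, q₁, q₂, d₂, E₂, h₁, hd₁, ht, h₂, hsum, hlt, rfl⟩ :=
      hE.exists_split n hdn
    refine Or.inr ⟨(E₁, (q₁, k, a, q₂), E₂),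
      ⟨⟨d₁, hd₁, q, h₁⟩, ht, ⟨d₂, by omega, q₂, h₂⟩⟩, ?_⟩
    simp only [h₁.lastTick_eq]

theorem ncard_eventSets_add_le [Finite A] [Nonempty Q] (hΔ : Δ.Finite) (n m : ℕ) :
    (eventSets Δ (n + m)).ncard ≤
      (1 + Δ.ncard) * ((eventSets Δ n).ncard * (eventSets Δ m).ncard) := by
  have hfin : (eventSets Δ n ×ˢ Δ ×ˢ eventSets Δ m).Finite :=
    (finite_eventSets n).prod (hΔ.prod (finite_eventSets m))
  calc (eventSets Δ (n + m)).ncard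
      ≤ (eventSets Δ n).ncard + (eventSets Δ n ×ˢ Δ ×ˢ eventSets Δ m).ncard :=
        (Set.ncard_le_ncard (eventSets_add_subset n m)
          ((finite_eventSets n).union (hfin.image _))).trans <|
          (Set.ncard_union_le _ _).trans (by gcongr; exact Set.ncard_image_le hfin)
    _ ≤ (eventSets Δ n).ncard * (eventSets Δ m).ncard
          + (eventSets Δ n).ncard * (Δ.ncard * (eventSets Δ m).ncard) := by
        rw [Set.ncard_prod, Set.ncard_prod]
        gcongr
        exact Nat.le_mul_of_pos_right _ (one_le_ncard_eventSets m)
    _ = _ := by ring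

end EventRun

/-- The number of ticks of length `1 / D` in the delay `d`. The rounding is harmless: `D` is always
a common denominator of the delays, see `STG.IsDenom`. -/
def tickCount (D : ℕ) (d : ℚ≥0) : ℕ := ⌊d * D⌋₊

namespace STG

variable {Q A : Type*} {G : STG Q A} {D : ℕ}

/-- The transitions of `G`, with delays counted in multiples of `1 / D`. -/
def ticks (G : STG Q A) (D : ℕ) : Set (Q × ℕ × A × Q) :=
  (fun t => (t.1, tickCount D t.2.1, t.2.2)) '' (G.trans : Set (Q × ℚ≥0 × A × Q))

/-- All delays of `G` are multiples of `1 / D`. -/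
structure IsDenom (G : STG Q A) (D : ℕ) : Prop where
  pos : 0 < D
  natCast_tickCount : ∀ t ∈ G.trans, (tickCount D t.2.1 : ℚ≥0) = t.2.1 * D

theorem mem_ticks {q q' : Q} {k : ℕ} {a : A} :
    (q, k, a, q') ∈ G.ticks D ↔ ∃ d, (q, d, a, q') ∈ G.trans ∧ tickCount D d = k := by
  simp [ticks]

theorem finite_ticks (G : STG Q A) (D : ℕ) : (G.ticks D).Finite :=
  G.trans.finite_toSet.image _

theorem natCast_tickCount_of_den_dvd {d : ℚ≥0} (h : d.den ∣ D) :
    (tickCount D d : ℚ≥0) = d * D := by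
  obtain ⟨m, rfl⟩ := h
  have hnum : d * ((d.den * m : ℕ) : ℚ≥0) = ((d.num * m : ℕ) : ℚ≥0) := by
    push_cast
    rw [← mul_assoc, NNRat.mul_den_eq_num]
  rw [tickCount, hnum, Nat.floor_natCast]

theorem exists_isDenom (G : STG Q A) : ∃ D, G.IsDenom D :=
  ⟨∏ t ∈ G.trans, t.2.1.den, Finset.prod_pos fun t _ => t.2.1.den_pos, fun _ ht =>
    natCast_tickCount_of_den_dvd
      (Finset.dvd_prod_of_mem (fun t : Q × ℚ≥0 × A × Q => t.2.1.den) ht)⟩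

theorem IsDenom.nnreal_delay_eq (hG : G.IsDenom D) {t : Q × ℚ≥0 × A × Q} (ht : t ∈ G.trans) :
    (t.2.1 : ℝ≥0) = (tickCount D t.2.1 : ℕ) / D := by
  rw [eq_div_iff (by exact_mod_cast hG.pos.ne')]
  exact_mod_cast congrArg (NNRat.cast : ℚ≥0 → ℝ≥0) (hG.natCast_tickCount t ht).symm

/-- The dated letter `x.2` ticks of length `1 / D` after date `s`. -/
noncomputable def tickDate (D : ℕ) (s : ℝ≥0) (x : A × ℕ) : A × ℝ≥0 := (x.1, s + x.2 / D)

theorem tickDate_injective (hD : 0 < D) (s : ℝ≥0) :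
    Function.Injective (tickDate (A := A) D s) := by
  have hD' : (D : ℝ≥0) ≠ 0 := by exact_mod_cast hD.ne'
  rintro ⟨a, i⟩ ⟨b, j⟩ h
  simpa [tickDate, div_left_inj' hD'] using h

theorem tickDate_image_shiftBy_insert (s : ℝ≥0) (k : ℕ) (a : A) (E : Set (A × ℕ)) :
    tickDate D s '' shiftBy k (insert (a, 0) E)
      = insert (a, s + (k : ℝ≥0) / D) (tickDate D (s + (k : ℝ≥0) / D) '' E) := by
  have hcomp : ∀ x : A × ℕ, tickDate D s (x.1, x.2 + k) = tickDate D (s + (k : ℝ≥0) / D) x :=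
    fun x => Prod.ext rfl (by simp only [tickDate]; push_cast; ring)
  rw [shiftBy, Set.image_image, Set.image_congr fun x _ => hcomp x, Set.image_insert_eq]
  simp [tickDate]

theorem RunOn.exists_eventRun (hG : G.IsDenom D) :
    ∀ {q : Q} {s : ℝ≥0} {w : List (A × ℝ≥0)}, G.RunOn q s w →
      ∃ n E, EventRun (G.ticks D) q n E ∧ {x | x ∈ w} = tickDate D s '' E ∧
        (w.map Prod.snd).getLastD s = s + n / D
  | q, s, [], _ => ⟨0, ∅, .nil q, by simp, by simp; rfl⟩
  | q, s, (a, t) :: w, h => by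
    obtain ⟨d, q', hd, rfl, hr⟩ := h
    obtain ⟨n, E, hE, hw, hl⟩ := hr.exists_eventRun hG
    have hdk : (d : ℝ≥0) = _ := hG.nnreal_delay_eq hd
    refine ⟨n + tickCount D d, _, .cons (a := a) (mem_ticks.mpr ⟨d, hd, rfl⟩) hE, ?_, ?_⟩
    · rw [tickDate_image_shiftBy_insert, ← hdk, ← hw]
      ext x
      simp
    · rw [List.map_cons, List.getLastD_cons, hl, hdk]
      push_cast
      ring

theorem RunOn.pairwise : ∀ {q : Q} {s : ℝ≥0} {w : List (A × ℝ≥0)},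
    G.RunOn q s w → (∀ x ∈ w, s ≤ x.2) ∧ (w.map Prod.snd).Pairwise (· ≤ ·)
  | _, _, [], _ => by simp
  | q, s, (a, t) :: w, h => by
    obtain ⟨d, q', -, rfl, hr⟩ := h
    obtain ⟨hlower, hsorted⟩ := hr.pairwise
    have hs : s ≤ s + (d : ℝ≥0) := le_self_add
    refine ⟨List.forall_mem_cons.mpr ⟨hs, fun x hx => hs.trans (hlower x hx)⟩, ?_⟩
    rw [List.map_cons, List.pairwise_cons]
    exact ⟨List.forall_mem_map.mpr hlower, hsorted⟩

theorem exists_runOn_of_eventRun (hG : G.IsDenom D) {q : Q} {n : ℕ}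
    {E : Set (A × ℕ)} (h : EventRun (G.ticks D) q n E) : ∀ s : ℝ≥0,
      ∃ w : List (A × ℝ≥0), G.RunOn q s w ∧ {x | x ∈ w} = tickDate D s '' E ∧
        (w.map Prod.snd).getLastD s = s + n / D := by
  induction h with
  | nil q => exact fun s => ⟨[], trivial, by simp, by simp; rfl⟩
  | @cons q k a q' n E ht _ ih =>
    intro s
    obtain ⟨d, hd, rfl⟩ := mem_ticks.mp ht
    have hdk : (d : ℝ≥0) = _ := hG.nnreal_delay_eq hd
    obtain ⟨w, hw, he, hl⟩ := ih (s + (d : ℝ≥0))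
    refine ⟨(a, s + (d : ℝ≥0)) :: w, ⟨d, q', hd, rfl, hw⟩, ?_, ?_⟩
    · rw [tickDate_image_shiftBy_insert, ← hdk, ← he]
      ext x
      simp
    · rw [List.map_cons, List.getLastD_cons, hl, hdk]
      push_cast
      ring

theorem datedIn_restrict_language (hG : G.IsDenom D) (T : ℝ) :
    TimedWord.DatedIn (Set.range fun j : ℕ => (j : ℝ≥0) / D)
      (TimedWord.restrict G.language T) := by
  rintro w ⟨⟨q, hq⟩, -⟩ x hx
  obtain ⟨n, E, -, he, -⟩ := hq.exists_eventRun hG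
  obtain ⟨y, -, rfl⟩ : x ∈ tickDate D 0 '' E := he ▸ hx
  exact ⟨y.2, by simp [tickDate]⟩

theorem events_image_restrict_language (hG : G.IsDenom D) {T : ℝ} (hT : 0 ≤ T) :
    TimedWord.events '' TimedWord.restrict G.language T =
      (fun E => tickDate D 0 '' E) '' eventSets (G.ticks D) ⌊T * D⌋₊ := by
  have hD : (0 : ℝ) < D := by exact_mod_cast hG.pos
  have hle : ∀ n : ℕ, ((0 + n / D : ℝ≥0) : ℝ) ≤ T ↔ n ≤ ⌊T * D⌋₊ := by
    intro n
    rw [Nat.le_floor_iff (by positivity), zero_add]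
    push_cast
    rw [div_le_iff₀ hD]
  ext e
  constructor
  · rintro ⟨w, ⟨⟨q, hq⟩, hw⟩, rfl⟩
    obtain ⟨n, E, hE, he, hl⟩ := hq.exists_eventRun hG
    refine ⟨E, ⟨n, ?_, q, hE⟩, he.symm⟩
    rw [← hle, ← hl]
    exact hw
  · rintro ⟨E, ⟨n, hn, q, hE⟩, rfl⟩
    obtain ⟨w, hw, he, hl⟩ := exists_runOn_of_eventRun hG hE 0
    refine ⟨⟨w, hw.pairwise.2⟩, ⟨⟨q, hw⟩, ?_⟩, he⟩
    rw [← hle, ← hl] at hn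
    exact hn

theorem encard_events_restrict_language (hG : G.IsDenom D) {T : ℝ} (hT : 0 ≤ T) :
    (TimedWord.events '' TimedWord.restrict G.language T).encard =
      (eventSets (G.ticks D) ⌊T * D⌋₊).encard := by
  rw [events_image_restrict_language hG hT]
  exact ((tickDate_injective hG.pos 0).image_injective).encard_image _

end STG

section Growth

/-- `γ` is the exponential growth rate of the sequence `U ≥ 1`, in the strong sense satisfied by
almost submultiplicative sequences: on top of `log (U n) / n → log γ`, the lower bound
`γ ^ n ≤ C * U n` holds without subexponential correction. -/
structure IsGrowthRate (C : ℝ) (U : ℕ → ℝ) (γ : ℝ) : Prop where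
  one_le : 1 ≤ γ
  one_le_apply : ∀ n, 1 ≤ U n
  tendsto : Filter.Tendsto (fun n : ℕ => Real.log (U n) / n) Filter.atTop (𝓝 (Real.log γ))
  pow_le : ∀ n, γ ^ n ≤ C * U n

theorem subadditive_log_mul {U : ℕ → ℝ} {C : ℝ} (hC : 0 < C) (hU : ∀ n, 0 < U n)
    (hsub : ∀ n m, U (n + m) ≤ C * (U n * U m)) :
    Subadditive fun n => Real.log (C * U n) := by
  intro m n
  have hm := hU m
  have hn := hU n
  have hmn := hU (m + n)
  rw [← Real.log_mul (by positivity) (by positivity)]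
  refine Real.log_le_log (by positivity) ?_
  calc C * U (m + n) ≤ C * (C * (U m * U n)) := by gcongr; exact hsub m n
    _ = C * U m * (C * U n) := by ring

theorem tendsto_log_div_of_tendsto_log_mul_div {U : ℕ → ℝ} {C l : ℝ} (hC : 0 < C)
    (hU : ∀ n, 0 < U n)
    (h : Filter.Tendsto (fun n : ℕ => Real.log (C * U n) / n) Filter.atTop (𝓝 l)) :
    Filter.Tendsto (fun n : ℕ => Real.log (U n) / n) Filter.atTop (𝓝 l) := by
  have hsub := h.sub (tendsto_const_div_atTop_nhds_zero_nat (Real.log C))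
  rw [sub_zero] at hsub
  refine hsub.congr fun n => ?_
  rw [Real.log_mul hC.ne' (hU n).ne']
  ring

theorem exists_isGrowthRate {U : ℕ → ℝ} {C : ℝ} (hC : 1 ≤ C) (hU : ∀ n, 1 ≤ U n)
    (hsub : ∀ n m, U (n + m) ≤ C * (U n * U m)) : ∃ γ, IsGrowthRate C U γ := by
  have hCU : ∀ n, 1 ≤ C * U n := fun n => one_le_mul_of_one_le_of_one_le hC (hU n)
  have hC0 : 0 < C := one_pos.trans_le hC
  have hU0 : ∀ n, 0 < U n := fun n => one_pos.trans_le (hU n)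
  have hu := subadditive_log_mul hC0 hU0 hsub
  have hnonneg : ∀ n : ℕ, 0 ≤ Real.log (C * U n) / n := fun n =>
    div_nonneg (Real.log_nonneg (hCU n)) n.cast_nonneg
  have hbdd : BddBelow (Set.range fun n : ℕ => Real.log (C * U n) / n) :=
    ⟨0, Set.forall_mem_range.mpr hnonneg⟩
  have hlim := hu.tendsto_lim hbdd
  refine ⟨Real.exp hu.lim, Real.one_le_exp (ge_of_tendsto' hlim hnonneg), hU, ?_, fun n => ?_⟩
  · rw [Real.log_exp]
    exact tendsto_log_div_of_tendsto_log_mul_div hC0 hU0 hlim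
  · rcases n.eq_zero_or_pos with rfl | hn
    · simpa using hCU 0
    have hle := hu.lim_le_div hbdd hn.ne'
    rw [le_div_iff₀ (by positivity)] at hle
    rw [← Real.exp_nat_mul, mul_comm]
    exact (Real.exp_le_exp.mpr hle).trans_eq (Real.exp_log (one_pos.trans_le (hCU n)))

namespace IsGrowthRate

variable {C C' γ γ' : ℝ} {U : ℕ → ℝ}

theorem pos (h : IsGrowthRate C U γ) : 0 < γ := one_pos.trans_le h.one_le

theorem apply_pos (h : IsGrowthRate C U γ) (n : ℕ) : 0 < U n := one_pos.trans_le (h.one_le_apply n)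

theorem unique (h : IsGrowthRate C U γ) (h' : IsGrowthRate C' U γ') : γ = γ' :=
  Real.log_injOn_pos h.pos h'.pos (tendsto_nhds_unique h.tendsto h'.tendsto)

theorem summable (h : IsGrowthRate C U γ) {x : ℝ} (hx0 : 0 ≤ x) (hx : x * γ < 1) :
    Summable fun n => U n * x ^ n := by
  rcases hx0.eq_or_lt with rfl | hx0
  · refine summable_of_ne_finset_zero (s := {0}) fun n hn => ?_
    rw [zero_pow (by simpa using hn), mul_zero]
  obtain ⟨r, hγr, hr1⟩ := exists_between hx
  have hr0 : 0 < r := (mul_pos hx0 h.pos).trans hγr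
  have hlog : Real.log γ < Real.log (r / x) :=
    Real.log_lt_log h.pos (by rwa [lt_div_iff₀ hx0, mul_comm])
  refine Summable.of_norm_bounded_eventually_nat (summable_geometric_of_lt_one hr0.le hr1) ?_
  filter_upwards [h.tendsto.eventually_lt_const hlog, Filter.eventually_gt_atTop 0] with n hn hn0
  have hU := h.apply_pos n
  rw [div_lt_iff₀ (by positivity), mul_comm, ← Real.log_pow,
    Real.log_lt_log_iff hU (by positivity), div_pow, lt_div_iff₀ (by positivity)] at hn
  rw [Real.norm_of_nonneg (by positivity)]
  exact hn.le

theorem mono (h : IsGrowthRate C U γ) (hC : C ≤ C') : IsGrowthRate C' U γ where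
  one_le := h.one_le
  one_le_apply := h.one_le_apply
  tendsto := h.tendsto
  pow_le n := (h.pow_le n).trans (by have := h.apply_pos n; gcongr)

theorem comp_mul (h : IsGrowthRate C U γ) {D : ℕ} (hD : 0 < D) :
    IsGrowthRate C (fun n => U (D * n)) (γ ^ D) where
  one_le := one_le_pow₀ h.one_le
  one_le_apply n := h.one_le_apply _
  pow_le n := by
    rw [← pow_mul]
    exact h.pow_le _
  tendsto := by
    rw [Real.log_pow]
    have hmul : Filter.Tendsto (fun n : ℕ => D * n) Filter.atTop Filter.atTop :=
      Filter.tendsto_id.const_mul_atTop' hD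
    refine ((h.tendsto.comp hmul).const_mul (D : ℝ)).congr fun n => ?_
    have hD' : (D : ℝ) ≠ 0 := by positivity
    rw [Function.comp_apply, Nat.cast_mul, ← mul_div_assoc, mul_div_mul_left _ _ hD']

theorem tendsto_logb_floor (h : IsGrowthRate C U γ) {D : ℝ} (hD : 0 < D) :
    Filter.Tendsto (fun T : ℝ => Real.logb 2 (U ⌊T * D⌋₊) / T) Filter.atTop
      (𝓝 (D * Real.logb 2 γ)) := by
  have hmul : Filter.Tendsto (fun T : ℝ => D * T) Filter.atTop Filter.atTop :=
    Filter.tendsto_id.const_mul_atTop hD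
  have hprod := (((h.tendsto.comp (tendsto_nat_floor_atTop.comp hmul)).mul
    (tendsto_nat_floor_mul_div_atTop hD.le)).div_const (Real.log 2))
  rw [mul_comm (Real.log γ), mul_div_assoc] at hprod
  refine hprod.congr' ?_
  filter_upwards [hmul.eventually_ge_atTop 1] with T hT
  have hfloor : (⌊D * T⌋₊ : ℝ) ≠ 0 := by
    exact_mod_cast (Nat.floor_pos.mpr hT).ne'
  rw [Function.comp_apply, Function.comp_apply, mul_comm T, Real.logb,
    div_mul_div_cancel₀ hfloor, div_right_comm]

end IsGrowthRate

theorem exists_isGrowthRate_eventSets {Q A : Type*} [Finite A] [Nonempty Q]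
    {Δ : Set (Q × ℕ × A × Q)} (hΔ : Δ.Finite) :
    ∃ γ, IsGrowthRate (1 + Δ.ncard) (fun n => ((eventSets Δ n).ncard : ℝ)) γ :=
  exists_isGrowthRate (by simp) (fun n => by exact_mod_cast one_le_ncard_eventSets n)
    fun n m => by exact_mod_cast ncard_eventSets_add_le hΔ n m

end Growth

theorem TimedWord.log2_natCast {n : ℕ} (hn : 1 ≤ n) :
    TimedWord.log2 n = ((Real.logb 2 n : ℝ) : EReal) := by
  have h : ((n : ℕ∞) : ℝ≥0∞) = ENNReal.ofReal n := by simp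
  rw [TimedWord.log2, h, ENNReal.log_ofReal_of_pos (by exact_mod_cast hn), Real.logb,
    EReal.coe_div]

namespace STG

variable {Q A : Type*} {G : STG Q A} {D : ℕ} {C γ : ℝ}

theorem ncard_eventSets_ticks_mul {D' : ℕ} (hG : G.IsDenom D) (hG' : G.IsDenom D') (n : ℕ) :
    (eventSets (G.ticks D) (D * n)).ncard = (eventSets (G.ticks D') (D' * n)).ncard := by
  have h := (encard_events_restrict_language hG (T := n) n.cast_nonneg).symm.trans
    (encard_events_restrict_language hG' (T := n) n.cast_nonneg)
  have hfloor : ∀ k : ℕ, ⌊(n : ℝ) * k⌋₊ = k * n := fun k => by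
    rw [mul_comm, ← Nat.cast_mul, Nat.floor_natCast]
  rw [hfloor, hfloor] at h
  exact congrArg ENat.toNat h

theorem IsDenom.maxSeparated_eq (hG : G.IsDenom D) {ε : ℝ≥0} (hε : ε < 1 / (2 * D)) (T : ℝ) :
    TimedWord.maxSeparated ε (TimedWord.restrict G.language T) =
      (TimedWord.events '' TimedWord.restrict G.language T).encard :=
  (datedIn_restrict_language hG T).maxSeparated_eq (pairwise_range_div_le_edist D) hε

variable [Finite A]

theorem tendsto_log2_encard_events (hG : G.IsDenom D)
    (hγ : IsGrowthRate C (fun n => ((eventSets (G.ticks D) n).ncard : ℝ)) γ) :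
    Filter.Tendsto (fun T : ℝ => TimedWord.log2
      (TimedWord.events '' TimedWord.restrict G.language T).encard / (T : EReal)) Filter.atTop
      (𝓝 ((Real.logb 2 (γ ^ D) : ℝ) : EReal)) := by
  rw [Real.logb_pow]
  refine (EReal.tendsto_coe.mpr (hγ.tendsto_logb_floor (Nat.cast_pos.mpr hG.pos))).congr' ?_
  filter_upwards [Filter.eventually_ge_atTop 0] with T hT
  rw [encard_events_restrict_language hG hT, ← (finite_eventSets _).cast_ncard_eq,
    TimedWord.log2_natCast (by exact_mod_cast hγ.one_le_apply _), EReal.coe_div]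

theorem IsDenom.hasGrowthRate (hG : G.IsDenom D)
    (hγ : IsGrowthRate C (fun n => ((eventSets (G.ticks D) n).ncard : ℝ)) γ) :
    G.HasGrowthRate (Real.logb 2 (γ ^ D)) := by
  have hD := hG.pos
  refine (tendsto_log2_encard_events hG hγ).congr fun T => ?_
  rw [TimedWord.size, hG.maxSeparated_eq (by positivity)]

theorem IsDenom.capacitiveBandwidth_eq (hG : G.IsDenom D)
    (hγ : IsGrowthRate C (fun n => ((eventSets (G.ticks D) n).ncard : ℝ)) γ)
    {ε : ℝ≥0} (hε : ε < 1 / (2 * D)) :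
    TimedWord.capacitiveBandwidth ε G.language = (Real.logb 2 (γ ^ D) : ℝ) := by
  refine Filter.Tendsto.limsup_eq ((tendsto_log2_encard_events hG hγ).congr fun T => ?_)
  rw [TimedWord.capacity, hG.maxSeparated_eq hε]

theorem IsDenom.entropicBandwidth_eq (hG : G.IsDenom D)
    (hγ : IsGrowthRate C (fun n => ((eventSets (G.ticks D) n).ncard : ℝ)) γ)
    {ε : ℝ≥0} (hε : ε < 1 / (2 * D)) :
    TimedWord.entropicBandwidth ε G.language = (Real.logb 2 (γ ^ D) : ℝ) := by
  refine Filter.Tendsto.limsup_eq ((tendsto_log2_encard_events hG hγ).congr fun T => ?_)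
  rw [TimedWord.entropy,
    (datedIn_restrict_language hG T).minNet_eq (pairwise_range_div_le_edist D) hε]

end STG

theorem ncard_biUnion_finset {ι α : Type*} {s : Finset ι} {t : ι → Set α}
    (hfin : ∀ i ∈ s, (t i).Finite) (hdisj : (s : Set ι).PairwiseDisjoint t) :
    (⋃ i ∈ s, t i).ncard = ∑ i ∈ s, (t i).ncard := by
  classical
  induction s using Finset.induction_on with
  | empty => simp
  | insert i s hi ih =>
    have hfin' : ∀ j ∈ s, (t j).Finite := fun j hj => hfin j (Finset.mem_insert_of_mem hj)
    have hi' : Disjoint (t i) (⋃ j ∈ s, t j) := Set.disjoint_iUnion₂_right.mpr fun j hj =>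
      hdisj (by simp) (by simp [hj]) (by rintro rfl; exact hi hj)
    rw [Finset.set_biUnion_insert, Set.ncard_union_eq hi' (hfin i (Finset.mem_insert_self i s))
      (s.finite_toSet.biUnion hfin'), ih hfin' (hdisj.subset (by simp)), Finset.sum_insert hi]

/-- The duration in ticks of a sequence of delays and letters. -/
def wordTicks {B : Type*} (D : ℕ) (l : List (ℚ≥0 × B)) : ℕ :=
  (l.map fun x => tickCount D x.1).sum

theorem wordTicks_cons {B : Type*} (D : ℕ) (x : ℚ≥0 × B) (l : List (ℚ≥0 × B)) :
    wordTicks D (x :: l) = tickCount D x.1 + wordTicks D l := by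
  simp [wordTicks]

namespace STG

section Determinize

variable {Q A : Type*} {H : STG Q A} {D : ℕ}

/-- There is a run from the given state on the given sequence of delays and letters. -/
def Accepts (H : STG Q A) : Q → List (ℚ≥0 × A) → Prop
  | _, [] => True
  | q, (d, a) :: l => ∃ r, (q, d, a, r) ∈ H.trans ∧ H.Accepts r l

/-- The sequences of duration `n` ticks accepted from some state of `S`. -/
def wordsFrom (H : STG Q A) (D : ℕ) (S : Finset Q) (n : ℕ) : Set (List (ℚ≥0 × A)) :=
  {l | (∃ q ∈ S, H.Accepts q l) ∧ wordTicks D l = n}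

/-- The number of sequences of duration `n` ticks accepted from some state of `S`. -/
noncomputable def wordCount (H : STG Q A) (D : ℕ) (S : Finset Q) (n : ℕ) : ℕ :=
  (H.wordsFrom D S n).ncard

/-- Every transition lasts at least one tick. -/
def PosTicks (H : STG Q A) (D : ℕ) : Prop := ∀ t ∈ H.trans, 0 < tickCount D t.2.1

theorem wordsFrom_mono {S S' : Finset Q} (h : S ⊆ S') (n : ℕ) :
    H.wordsFrom D S n ⊆ H.wordsFrom D S' n :=
  fun _ ⟨⟨q, hq, hl⟩, hn⟩ => ⟨⟨q, h hq, hl⟩, hn⟩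

theorem mem_determinize_trans [Fintype Q] [Fintype A] {S S' : {S : Finset Q // S.Nonempty}}
    {d : ℚ≥0} {a : A} : (S, d, a, S') ∈ H.determinize.trans ↔
      ∀ q, q ∈ S'.1 ↔ ∃ p ∈ S.1, (p, d, a, q) ∈ H.trans := by
  simp only [determinize, Finset.mem_filter, Finset.mem_product, Finset.mem_univ, true_and,
    and_true, and_iff_right_iff_imp]
  intro h
  obtain ⟨q, hq⟩ := S'.2
  obtain ⟨p, -, hp⟩ := (h q).mp hq
  exact Finset.mem_image.mpr ⟨_, hp, rfl⟩

theorem injOn_label_determinize_trans [Fintype Q] [Fintype A] (S : {S : Finset Q // S.Nonempty}) :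
    Set.InjOn (fun t => (t.2.1, t.2.2.1)) {t | t ∈ H.determinize.trans ∧ t.1 = S} := by
  rintro ⟨_, d, a, S₁⟩ ⟨ht₁, rfl⟩ ⟨S', d', a', S₂⟩ ⟨ht₂, hS'⟩ hlabel
  obtain ⟨rfl, rfl⟩ : d = d' ∧ a = a' := Prod.mk.inj hlabel
  obtain rfl : S' = _ := hS'
  have hS : S₁ = S₂ := Subtype.ext <| Finset.ext fun q => by
    rw [mem_determinize_trans.mp ht₁, mem_determinize_trans.mp ht₂]
  rw [hS]

theorem exists_accepts_cons_iff [Fintype Q] [Fintype A] {S : {S : Finset Q // S.Nonempty}}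
    {d : ℚ≥0} {a : A} {l : List (ℚ≥0 × A)} : (∃ q ∈ S.1, H.Accepts q ((d, a) :: l)) ↔
      ∃ S', (S, d, a, S') ∈ H.determinize.trans ∧ ∃ q ∈ S'.1, H.Accepts q l := by
  classical
  constructor
  · rintro ⟨p, hp, q, hq, hl⟩
    have hmem : ∀ r, r ∈ Finset.univ.filter (fun r => ∃ p ∈ S.1, (p, d, a, r) ∈ H.trans) ↔
        ∃ p ∈ S.1, (p, d, a, r) ∈ H.trans := by simp
    have hqS := (hmem q).mpr ⟨p, hp, hq⟩
    exact ⟨⟨_, q, hqS⟩, mem_determinize_trans.mpr hmem, q, hqS, hl⟩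
  · rintro ⟨S', hS', q, hq, hl⟩
    obtain ⟨p, hp, ht⟩ := (mem_determinize_trans.mp hS' q).mp hq
    exact ⟨p, hp, q, ht, hl⟩

theorem PosTicks.determinize [Fintype Q] [Fintype A] (hH : H.PosTicks D) :
    H.determinize.PosTicks D := by
  rintro ⟨S, d, a, S'⟩ ht
  obtain ⟨q, hq⟩ := S'.2
  obtain ⟨p, -, hp⟩ := (mem_determinize_trans.mp ht q).mp hq
  exact hH _ hp

open Classical in
theorem wordsFrom_eq_union [Fintype Q] [Fintype A] (S : {S : Finset Q // S.Nonempty}) (n : ℕ) :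
    H.wordsFrom D S n = (if n = 0 then {[]} else ∅) ∪
      ⋃ t ∈ {t ∈ H.determinize.trans | t.1 = S ∧ tickCount D t.2.1 ≤ n},
        List.cons (t.2.1, t.2.2.1) '' H.wordsFrom D t.2.2.2 (n - tickCount D t.2.1) := by
  ext l
  rcases l with _ | ⟨⟨d, a⟩, l⟩
  · obtain ⟨q, hq⟩ := S.2
    have hacc : ∃ q ∈ S.1, H.Accepts q [] := ⟨q, hq, trivial⟩
    split_ifs with hn <;> simp [wordsFrom, wordTicks, hacc, hn, eq_comm (a := 0)]
  · have hnil : (d, a) :: l ∉ (if n = 0 then {[]} else ∅ : Set (List (ℚ≥0 × A))) := by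
      split_ifs <;> simp
    rw [Set.mem_union, or_iff_right hnil, wordsFrom, Set.mem_ofPred_eq, exists_accepts_cons_iff,
      wordTicks_cons]
    simp only [Set.mem_iUnion₂, Finset.mem_filter]
    constructor
    · rintro ⟨⟨S', hS', hl⟩, rfl⟩
      exact ⟨_, ⟨hS', rfl, by simp⟩, l, ⟨hl, by simp⟩, rfl⟩
    · rintro ⟨⟨_, d', a', S'⟩, ⟨ht, rfl, hle⟩, l', ⟨hl, hw⟩, h⟩
      obtain ⟨⟨rfl, rfl⟩, rfl⟩ : (d' = d ∧ a' = a) ∧ l' = l := by simpa using h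
      refine ⟨⟨S', ht, hl⟩, ?_⟩
      dsimp only at hle hw ⊢
      omega

theorem finite_wordsFrom [Finite Q] [Finite A] (hH : H.PosTicks D) (n : ℕ) :
    ∀ S : Finset Q, (H.wordsFrom D S n).Finite := by
  classical
  cases nonempty_fintype Q
  cases nonempty_fintype A
  induction n using Nat.strong_induction_on with
  | _ n ih =>
    intro S
    rcases S.eq_empty_or_nonempty with rfl | hS
    · simp [wordsFrom]
    have hrest : ∀ t ∈ H.determinize.trans.filter fun t => t.1 = ⟨S, hS⟩ ∧ tickCount D t.2.1 ≤ n,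
        (List.cons (t.2.1, t.2.2.1) ''
          H.wordsFrom D t.2.2.2 (n - tickCount D t.2.1)).Finite := by
      intro t ht
      have hpos := hH.determinize t (Finset.mem_filter.mp ht).1
      have hle := (Finset.mem_filter.mp ht).2.2
      exact (ih _ (by omega) _).image _
    rw [wordsFrom_eq_union ⟨S, hS⟩ n]
    refine Set.Finite.union ?_ ((Finset.finite_toSet _).biUnion hrest)
    split_ifs <;> simp

open Classical in
/-- Determinism makes the decomposition of a word according to its first letter unique. -/
theorem wordCount_eq [Fintype Q] [Fintype A] (hH : H.PosTicks D)
    (S : {S : Finset Q // S.Nonempty}) (n : ℕ) :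
    H.wordCount D S n = (if n = 0 then 1 else 0) +
      ∑ t ∈ H.determinize.trans with t.1 = S, if tickCount D t.2.1 ≤ n then
        H.wordCount D t.2.2.2 (n - tickCount D t.2.1) else 0 := by
  have hfin : ∀ t ∈ H.determinize.trans.filter fun t => t.1 = S ∧ tickCount D t.2.1 ≤ n,
      (List.cons (t.2.1, t.2.2.1) ''
        H.wordsFrom D t.2.2.2 (n - tickCount D t.2.1)).Finite :=
    fun t _ => (finite_wordsFrom hH _ _).image _
  have hdisj : (SetLike.coe <| H.determinize.trans.filter fun t =>
      t.1 = S ∧ tickCount D t.2.1 ≤ n).PairwiseDisjoint fun t =>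
        List.cons (t.2.1, t.2.2.1) '' H.wordsFrom D t.2.2.2 (n - tickCount D t.2.1) := by
    intro t ht t' ht' hne
    simp only [Finset.mem_coe, Finset.mem_filter] at ht ht'
    rw [Function.onFun, Set.disjoint_left]
    rintro _ ⟨l, -, rfl⟩ ⟨l', -, h⟩
    exact hne (injOn_label_determinize_trans S ⟨ht.1, ht.2.1⟩ ⟨ht'.1, ht'.2.1⟩
      (List.cons.inj h).1.symm)
  rw [wordCount, wordsFrom_eq_union, Set.ncard_union_eq ?_ ?_ ?_,
    ncard_biUnion_finset hfin hdisj, ← Finset.filter_filter, Finset.sum_filter]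
  · congr 1
    · split_ifs <;> simp
    · refine Finset.sum_congr rfl fun t _ => ?_
      rw [Set.ncard_image_of_injective _ List.cons_injective, wordCount]
  · rw [Set.disjoint_iUnion₂_right]
    intro t _
    split_ifs <;> simp
  · split_ifs <;> simp
  · exact (Finset.finite_toSet _).biUnion hfin

end Determinize

end STG

namespace STG

section ZeroElim

variable {Q A : Type*} {D : ℕ}

/-- The non-empty sets of letters: the alphabet of the 0-elimination. -/
abbrev LetterSet (A : Type*) : Type _ := {B : Finset A // B.Nonempty}

/-- The events of a set of letters read at tick `0`. -/
def lettersAt (B : Finset A) : Set (A × ℕ) := {x | x.1 ∈ B ∧ x.2 = 0}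

/-- The events of a sequence of delays and sets of letters. -/
def wordEvents (D : ℕ) : List (ℚ≥0 × LetterSet A) → Set (A × ℕ)
  | [] => ∅
  | (d, B) :: l => shiftBy (tickCount D d) (lettersAt B.1 ∪ wordEvents D l)

/-- Every delay of the word is a positive whole number of ticks. -/
def OnPosGrid {B : Type*} (D : ℕ) (l : List (ℚ≥0 × B)) : Prop :=
  ∀ x ∈ l, 0 < tickCount D x.1 ∧ (tickCount D x.1 : ℚ≥0) = x.1 * D

theorem lettersAt_empty : lettersAt (∅ : Finset A) = ∅ := by simp [lettersAt]

theorem lettersAt_insert [DecidableEq A] (a : A) (B : Finset A) :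
    lettersAt (insert a B) = insert (a, 0) (lettersAt B) := by
  ext ⟨x, n⟩
  simp only [lettersAt, Finset.mem_insert, Set.mem_ofPred_eq, Set.mem_insert_iff, Prod.mk.injEq]
  tauto

theorem shiftBy_zero (E : Set (A × ℕ)) : shiftBy 0 E = E := by
  simp [shiftBy]

theorem shiftBy_injective (k : ℕ) : Function.Injective (shiftBy (A := A) k) := by
  refine Function.Injective.image_injective fun x y h => ?_
  simp only [Prod.mk.injEq, Nat.add_right_cancel_iff] at h
  exact Prod.ext h.1 h.2

theorem tickCount_zero (D : ℕ) : tickCount D 0 = 0 := by simp [tickCount]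

theorem Accepts.onPosGrid {G : STG Q A} (hG : G.IsDenom D) (hpos : G.PosTicks D) :
    ∀ {l : List (ℚ≥0 × A)} {q : Q}, G.Accepts q l → OnPosGrid D l
  | [], _, _ => by simp [OnPosGrid]
  | (d, a) :: l, q, ⟨q', ht, hl⟩ =>
    List.forall_mem_cons.mpr ⟨⟨hpos _ ht, hG.natCast_tickCount _ ht⟩, hl.onPosGrid hG hpos⟩

theorem pos_of_mem_wordEvents {l : List (ℚ≥0 × LetterSet A)} (hl : OnPosGrid D l) :
    ∀ x ∈ wordEvents D l, 0 < x.2 := by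
  rcases l with _ | ⟨⟨d, B⟩, l⟩
  · simp [wordEvents]
  · rintro _ ⟨y, -, rfl⟩
    exact Nat.add_pos_right _ (hl (d, B) List.mem_cons_self).1

theorem union_wordEvents_inj {l l' : List (ℚ≥0 × LetterSet A)} {B B' : Finset A}
    (hl : OnPosGrid D l) (hl' : OnPosGrid D l')
    (h : lettersAt B ∪ wordEvents D l = lettersAt B' ∪ wordEvents D l') :
    B = B' ∧ wordEvents D l = wordEvents D l' := by
  have hmem : ∀ a n, ((a ∈ B ∧ n = 0) ∨ (a, n) ∈ wordEvents D l ↔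
      (a ∈ B' ∧ n = 0) ∨ (a, n) ∈ wordEvents D l') := fun a n => Set.ext_iff.mp h (a, n)
  have hzero : ∀ {l : List (ℚ≥0 × LetterSet A)}, OnPosGrid D l →
      ∀ a, (a, 0) ∉ wordEvents D l :=
    fun hl a ha => (pos_of_mem_wordEvents hl _ ha).ne' rfl
  refine ⟨Finset.ext fun a => ?_, Set.ext fun ⟨a, n⟩ => ?_⟩
  · simpa only [hzero hl, hzero hl', and_true, or_false] using hmem a 0
  · rcases eq_or_ne n 0 with rfl | hn
    · simp only [hzero hl, hzero hl']
    · simpa only [hn, and_false, false_or] using hmem a n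

theorem tickCount_mem_image_wordEvents_cons (d : ℚ≥0) (B : LetterSet A)
    (l : List (ℚ≥0 × LetterSet A)) :
    tickCount D d ∈ Prod.snd '' wordEvents D ((d, B) :: l) := by
  obtain ⟨b, hb⟩ := B.2
  exact ⟨(b, 0 + tickCount D d), ⟨(b, 0), Or.inl ⟨hb, rfl⟩, rfl⟩, zero_add _⟩

theorem isLeast_wordEvents_cons (d : ℚ≥0) (B : LetterSet A) (l : List (ℚ≥0 × LetterSet A)) :
    IsLeast (Prod.snd '' wordEvents D ((d, B) :: l)) (tickCount D d) := by
  refine ⟨tickCount_mem_image_wordEvents_cons d B l, ?_⟩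
  rintro _ ⟨_, ⟨y, -, rfl⟩, rfl⟩
  exact Nat.le_add_left _ _

theorem wordEvents_injOn :
    Set.InjOn (wordEvents D) {l : List (ℚ≥0 × LetterSet A) | OnPosGrid D l} := by
  have hcons : ∀ (x : ℚ≥0 × LetterSet A) l, wordEvents D (x :: l) ≠ ∅ := fun ⟨d, B⟩ l h => by
    simpa [h] using tickCount_mem_image_wordEvents_cons (D := D) d B l
  intro l hl
  induction l with
  | nil => rintro (_ | ⟨x, l'⟩) - h; exacts [rfl, absurd h.symm (hcons x l')]
  | cons x l ih =>
    rintro (_ | ⟨⟨d', B'⟩, l'⟩) hl' h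
    · exact absurd h (hcons x l)
    obtain ⟨d, B⟩ := x
    obtain ⟨⟨hpos, hd⟩, htail⟩ := List.forall_mem_cons.mp hl
    obtain ⟨⟨-, hd'⟩, htail'⟩ := List.forall_mem_cons.mp hl'
    have hticks : tickCount D d = tickCount D d' :=
      (isLeast_wordEvents_cons d B l).unique (h ▸ isLeast_wordEvents_cons d' B' l')
    have hD : (D : ℚ≥0) ≠ 0 := by
      rintro hD
      simp [tickCount, hD] at hpos
    obtain rfl : d = d' := mul_right_cancel₀ hD (by rw [← hd, ← hd', hticks])
    obtain ⟨hB, hevents⟩ := union_wordEvents_inj htail htail' (shiftBy_injective _ h)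
    rw [Subtype.ext hB, ih htail htail' hevents]

theorem ZeroPath.eventRun {G : STG Q A} {n : ℕ} {E : Set (A × ℕ)} {q₀ : Q}
    (hE : EventRun (G.ticks D) q₀ n E) : ∀ {l₀ : List A} {q : Q}, G.ZeroPath q l₀ q₀ →
      ∀ {B : Finset A}, (∀ x, x ∈ B ↔ x ∈ l₀) → EventRun (G.ticks D) q n (lettersAt B ∪ E)
  | [], q, hpath, B, hB => by
    obtain rfl : q = q₀ := hpath
    obtain rfl : B = ∅ := by ext x; simp [hB]
    rwa [lettersAt_empty, Set.empty_union]
  | a :: l₀, q, ⟨q', ht, hpath⟩, B, hB => by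
    classical
    obtain rfl : insert a l₀.toFinset = B := by ext x; simp [hB]
    have hrun := EventRun.cons (mem_ticks.mpr ⟨0, ht, tickCount_zero D⟩)
      (ZeroPath.eventRun hE hpath (B := l₀.toFinset) (by simp))
    rwa [shiftBy_zero, ← Set.insert_union, ← lettersAt_insert] at hrun

/-- The states reached by instantaneous transitions reading exactly the letters of `B`. -/
noncomputable def zeroReach [Fintype Q] (G : STG Q A) (B : Finset A) : Finset Q :=
  open Classical in {q₀ | ∃ q l₀, G.ZeroPath q l₀ q₀ ∧ ∀ x, x ∈ B ↔ x ∈ l₀}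

theorem mem_zeroReach [Fintype Q] {G : STG Q A} {B : Finset A} {q₀ : Q} :
    q₀ ∈ G.zeroReach B ↔ ∃ q l₀, G.ZeroPath q l₀ q₀ ∧ ∀ x, x ∈ B ↔ x ∈ l₀ := by
  simp [zeroReach]

theorem zeroReach_empty [Fintype Q] (G : STG Q A) : G.zeroReach ∅ = Finset.univ :=
  Finset.eq_univ_of_forall fun q => mem_zeroReach.mpr ⟨q, [], rfl, by simp⟩

variable [Fintype Q] [Fintype A] {G : STG Q A}

theorem mem_zeroElim_trans {p q : Q} {d : ℚ≥0} {B : LetterSet A} :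
    (p, d, B, q) ∈ G.zeroElim.trans ↔ 0 < d ∧ ∃ (a : A) (q₀ : Q) (l : List A),
      (p, d, a, q₀) ∈ G.trans ∧ G.ZeroPath q₀ l q ∧ ∀ x, x ∈ B.1 ↔ x ∈ a :: l := by
  simp only [zeroElim, Finset.mem_filter, Finset.mem_product, Finset.mem_univ, true_and,
    and_true, and_iff_right_iff_imp]
  rintro ⟨-, a, q₀, l, h, -⟩
  exact Finset.mem_image.mpr ⟨_, h, rfl⟩

theorem IsDenom.zeroElim (hG : G.IsDenom D) : G.zeroElim.IsDenom D where
  pos := hG.pos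
  natCast_tickCount := by
    rintro ⟨p, d, B, q⟩ ht
    obtain ⟨-, a, q₀, l, h, -⟩ := mem_zeroElim_trans.mp ht
    exact hG.natCast_tickCount _ h

theorem IsDenom.posTicks_zeroElim (hG : G.IsDenom D) : G.zeroElim.PosTicks D := by
  rintro ⟨p, d, B, q⟩ ht
  have hd : 0 < d := (mem_zeroElim_trans.mp ht).1
  have hD : (0 : ℚ≥0) < D := Nat.cast_pos.mpr hG.pos
  have hticks : (tickCount D d : ℚ≥0) = d * D := hG.zeroElim.natCast_tickCount _ ht
  exact Nat.cast_pos.mp (hticks ▸ mul_pos hd hD)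

theorem exists_word_of_eventRun {q : Q} {n : ℕ} {E : Set (A × ℕ)}
    (h : EventRun (G.ticks D) q n E) :
    ∃ (B : Finset A) (l₀ : List A) (q₀ : Q) (l : List (ℚ≥0 × LetterSet A)),
      G.ZeroPath q l₀ q₀ ∧ (∀ x, x ∈ B ↔ x ∈ l₀) ∧ G.zeroElim.Accepts q₀ l ∧
        E = lettersAt B ∪ wordEvents D l ∧ wordTicks D l = n := by
  classical
  induction h with
  | nil q => exact ⟨∅, [], q, [], rfl, by simp, trivial, by simp [lettersAt, wordEvents], rfl⟩
  | @cons q k a q' n E ht hE ih =>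
    obtain ⟨B, l₀, q₀, l, hpath, hB, hl, rfl, rfl⟩ := ih
    obtain ⟨d, hd, rfl⟩ := mem_ticks.mp ht
    rcases eq_or_ne d 0 with rfl | hd0
    · refine ⟨insert a B, a :: l₀, q₀, l, ⟨q', hd, hpath⟩, by simp [hB], hl, ?_, ?_⟩
      · rw [tickCount_zero, shiftBy_zero, lettersAt_insert, Set.insert_union]
      · rw [tickCount_zero, add_zero]
    · refine ⟨∅, [], q, (d, ⟨insert a B, by simp⟩) :: l, rfl, by simp, ⟨q₀,
        mem_zeroElim_trans.mpr ⟨pos_iff_ne_zero.mpr hd0, a, q', l₀, hd, hpath, by simp [hB]⟩, hl⟩,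
        ?_, ?_⟩
      · rw [wordEvents, lettersAt_insert, Set.insert_union, lettersAt_empty, Set.empty_union]
      · rw [wordTicks_cons, add_comm]

theorem Accepts.eventRun :
    ∀ {l : List (ℚ≥0 × LetterSet A)} {q : Q}, G.zeroElim.Accepts q l →
      EventRun (G.ticks D) q (wordTicks D l) (wordEvents D l)
  | [], q, _ => .nil q
  | (d, B) :: l, q, ⟨q', ht, hl⟩ => by
    classical
    obtain ⟨-, a, q₀, l₀, hd, hpath, hB⟩ := mem_zeroElim_trans.mp ht
    have hletters : insert a l₀.toFinset = B.1 := by ext x; simp [hB]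
    have hrun := EventRun.cons (mem_ticks.mpr ⟨d, hd, rfl⟩)
      (hpath.eventRun (B := l₀.toFinset) (Accepts.eventRun hl) (by simp))
    rw [← Set.insert_union, ← lettersAt_insert, hletters] at hrun
    rwa [wordTicks_cons, add_comm]

theorem exactEventSets_ticks_eq (n : ℕ) :
    exactEventSets (G.ticks D) n = ⋃ B ∈ (Finset.univ : Finset (Finset A)),
      (fun l => lettersAt B ∪ wordEvents D l) '' G.zeroElim.wordsFrom D (G.zeroReach B) n := by
  ext E
  simp only [Finset.mem_univ, Set.iUnion_true, Set.mem_iUnion]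
  constructor
  · rintro ⟨q, hE⟩
    obtain ⟨B, l₀, q₀, l, hpath, hB, hl, rfl, rfl⟩ := exists_word_of_eventRun hE
    exact ⟨B, l, ⟨⟨q₀, mem_zeroReach.mpr ⟨q, l₀, hpath, hB⟩, hl⟩, rfl⟩, rfl⟩
  · rintro ⟨B, l, ⟨⟨q₀, hq₀, hl⟩, rfl⟩, rfl⟩
    obtain ⟨q, l₀, hpath, hB⟩ := mem_zeroReach.mp hq₀
    exact ⟨q, hpath.eventRun hl.eventRun hB⟩

theorem ncard_exactEventSets_ticks (hG : G.IsDenom D) (n : ℕ) :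
    (exactEventSets (G.ticks D) n).ncard =
      ∑ B : Finset A, G.zeroElim.wordCount D (G.zeroReach B) n := by
  have hgrid : ∀ {S : Finset Q} {l}, l ∈ G.zeroElim.wordsFrom D S n → OnPosGrid D l :=
    fun ⟨⟨_, _, hl⟩, _⟩ => hl.onPosGrid hG.zeroElim hG.posTicks_zeroElim
  have hfin : ∀ B ∈ (Finset.univ : Finset (Finset A)), Set.Finite
      ((fun l => lettersAt B ∪ wordEvents D l) '' G.zeroElim.wordsFrom D (G.zeroReach B) n) :=
    fun B _ => (finite_wordsFrom hG.posTicks_zeroElim n _).image _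
  have hdisj : (SetLike.coe (Finset.univ : Finset (Finset A))).PairwiseDisjoint fun B =>
      (fun l => lettersAt B ∪ wordEvents D l) '' G.zeroElim.wordsFrom D (G.zeroReach B) n := by
    intro B _ B' _ hne
    rw [Function.onFun, Set.disjoint_left]
    rintro _ ⟨l, hl, rfl⟩ ⟨l', hl', h⟩
    exact hne (union_wordEvents_inj (hgrid hl) (hgrid hl') h.symm).1
  rw [exactEventSets_ticks_eq, ncard_biUnion_finset hfin hdisj]
  refine Finset.sum_congr rfl fun B _ => Set.InjOn.ncard_image fun l hl l' hl' h => ?_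
  exact wordEvents_injOn (hgrid hl) (hgrid hl') (union_wordEvents_inj (hgrid hl) (hgrid hl') h).2

theorem wordCount_univ_le_ncard_exactEventSets (hG : G.IsDenom D) (n : ℕ) :
    G.zeroElim.wordCount D Finset.univ n ≤ (exactEventSets (G.ticks D) n).ncard := by
  rw [ncard_exactEventSets_ticks hG, ← zeroReach_empty G]
  exact Finset.single_le_sum (f := fun B => G.zeroElim.wordCount D (G.zeroReach B) n)
    (fun _ _ => Nat.zero_le _) (Finset.mem_univ ∅)

theorem ncard_exactEventSets_le_mul_wordCount (hG : G.IsDenom D) (n : ℕ) :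
    (exactEventSets (G.ticks D) n).ncard ≤
      Fintype.card (Finset A) * G.zeroElim.wordCount D Finset.univ n := by
  rw [ncard_exactEventSets_ticks hG]
  refine (Finset.sum_le_card_nsmul _ _ (G.zeroElim.wordCount D Finset.univ n) fun B _ =>
    Set.ncard_le_ncard (wordsFrom_mono (Finset.subset_univ _) n)
      (finite_wordsFrom hG.posTicks_zeroElim n _)).trans_eq ?_
  simp

end ZeroElim

end STG

theorem det_one_sub_ne_zero {n 𝕜 : Type*} [Fintype n] [DecidableEq n] [NormedField 𝕜]
    [NormedAlgebra ℝ 𝕜] {M : Matrix n n 𝕜} {P : Matrix n n ℝ} {f : n → ℝ}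
    (hM : ∀ i j, ‖M i j‖ ≤ P i j) (hf : ∀ i, 0 < f i) (hPf : ∀ i, P.mulVec f i < f i) :
    (1 - M).det ≠ 0 := by
  have hscaled : ((1 - M) * Matrix.diagonal fun j => algebraMap ℝ 𝕜 (f j)).det ≠ 0 := by
    refine det_ne_zero_of_sum_row_lt_diag fun i => ?_
    have hnorm : ∀ j, ‖algebraMap ℝ 𝕜 (f j)‖ = f j := fun j => by
      rw [norm_algebraMap', Real.norm_of_nonneg (hf j).le]
    have hoff : ∀ j ∈ Finset.univ.erase i, ‖(1 - M) i j * algebraMap ℝ 𝕜 (f j)‖ ≤ P i j * f j := by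
      intro j hj
      rw [Matrix.sub_apply, Matrix.one_apply_ne' (Finset.ne_of_mem_erase hj), zero_sub, norm_mul,
        norm_neg, hnorm]
      exact mul_le_mul_of_nonneg_right (hM i j) (hf j).le
    have hdiag : (1 - P i i) * f i ≤ ‖(1 - M) i i * algebraMap ℝ 𝕜 (f i)‖ := by
      rw [Matrix.sub_apply, Matrix.one_apply_eq, norm_mul, hnorm]
      refine mul_le_mul_of_nonneg_right ?_ (hf i).le
      calc 1 - P i i ≤ ‖(1 : 𝕜)‖ - ‖M i i‖ := by rw [norm_one]; linarith [hM i i]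
        _ ≤ ‖1 - M i i‖ := norm_sub_norm_le _ _
    have hrow : P i i * f i + ∑ j ∈ Finset.univ.erase i, P i j * f j < f i := by
      rw [Finset.add_sum_erase _ (fun j => P i j * f j) (Finset.mem_univ i)]
      exact hPf i
    simp only [Matrix.mul_diagonal]
    linarith [Finset.sum_le_sum hoff]
  rw [Matrix.det_mul] at hscaled
  exact left_ne_zero_of_mul hscaled

theorem det_one_sub_smul_eq_adjugate_mulVec {n R : Type*} [Fintype n] [DecidableEq n] [CommRing R]
    {P : Matrix n n R} {b f : n → R} (hf : f = b + P.mulVec f) :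
    (1 - P).det • f = (1 - P).adjugate.mulVec b := by
  have hb : (1 - P).mulVec f = b := by
    rw [Matrix.sub_mulVec, Matrix.one_mulVec, sub_eq_iff_eq_add]
    exact hf
  rw [← hb, Matrix.mulVec_mulVec, Matrix.adjugate_mul, Matrix.smul_mulVec, Matrix.one_mulVec]

theorem hasSum_shift_mul_pow {𝕜 : Type*} [Field 𝕜] [TopologicalSpace 𝕜] [IsTopologicalRing 𝕜]
    {g : ℕ → 𝕜} {x a : 𝕜} (k : ℕ) (h : HasSum (fun n => g n * x ^ n) a) :
    HasSum (fun n => (if k ≤ n then g (n - k) else 0) * x ^ n) (x ^ k * a) := by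
  rw [← hasSum_nat_add_iff' k, Finset.sum_eq_zero, sub_zero]
  · refine (h.mul_left (x ^ k)).congr_fun fun n => ?_
    simp only [le_add_iff_nonneg_left, zero_le, if_true, Nat.add_sub_cancel, pow_add]
    ring
  · intro i hi
    rw [if_neg (Finset.mem_range.mp hi).not_ge, zero_mul]

theorem summable_mul_pow_of_hasSum_le {c : ℕ → ℝ} {R B : ℝ} (hc : ∀ n, 0 ≤ c n) (hR : 0 < R)
    (h : ∀ x ∈ Set.Ioo 0 R, ∃ s ≤ B, HasSum (fun n => c n * x ^ n) s) :
    Summable fun n => c n * R ^ n := by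
  refine summable_of_sum_range_le (c := B) (fun n => mul_nonneg (hc n) (by positivity)) fun N => ?_
  have hcont : Continuous fun x : ℝ => ∑ n ∈ Finset.range N, c n * x ^ n := by fun_prop
  refine le_of_tendsto (hcont.continuousAt.mono_left (nhdsWithin_le_nhds (s := Set.Iio R))) ?_
  filter_upwards [Ioo_mem_nhdsLT hR] with x hx
  obtain ⟨s, hsB, hs⟩ := h x hx
  exact (sum_le_hasSum _ (fun n _ => mul_nonneg (hc n) (pow_nonneg hx.1.le n)) hs).trans hsB

theorem summable_sum_range_mul_pow {g : ℕ → ℝ} {x : ℝ} (hx0 : 0 ≤ x) (hx1 : x < 1)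
    (h : Summable fun n => g n * x ^ n) :
    Summable fun n => (∑ j ∈ Finset.range (n + 1), g j) * x ^ n := by
  have hcauchy := summable_norm_sum_mul_antidiagonal_of_summable_norm h.norm
    (summable_geometric_of_lt_one hx0 hx1).norm
  refine hcauchy.of_norm.congr fun n => ?_
  rw [Finset.sum_mul, ← Finset.Nat.sum_antidiagonal_eq_sum_range_succ_mk
    (f := fun kl => g kl.1 * x ^ n)]
  refine Finset.sum_congr rfl fun kl hkl => ?_
  rw [mul_assoc, ← pow_add, Finset.HasAntidiagonal.mem_antidiagonal.mp hkl]

namespace IsGrowthRate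

variable {C γ : ℝ} {U : ℕ → ℝ}

theorem not_summable (h : IsGrowthRate C U γ) : ¬ Summable fun n => U n * γ⁻¹ ^ n := by
  intro hsum
  have hle : ∀ n, 1 ≤ C * (U n * γ⁻¹ ^ n) := fun n => by
    have hγ := h.pos
    rw [inv_pow, ← div_eq_mul_inv, ← mul_div_assoc, one_le_div (by positivity)]
    exact h.pow_le n
  have hlim := hsum.tendsto_atTop_zero.const_mul C
  rw [mul_zero] at hlim
  exact one_pos.not_ge (ge_of_tendsto' hlim hle)

theorem eq_one_of_summable (h : IsGrowthRate C U γ) {g : ℕ → ℝ}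
    (hU : ∀ n, U n = ∑ j ∈ Finset.range (n + 1), g j) (hsum : Summable fun n => g n * γ⁻¹ ^ n) :
    γ = 1 := by
  refine h.one_le.antisymm' (not_lt.mp fun hγ => h.not_summable ?_)
  simp only [hU]
  exact summable_sum_range_mul_pow (inv_nonneg.mpr h.pos.le) (inv_lt_one_of_one_lt₀ hγ) hsum

end IsGrowthRate

namespace STG

section TickMatrix

variable {Q A : Type*} {H : STG Q A} {D : ℕ}

open Classical in
/-- The adjacency matrix in the variable `w = z ^ (1 / D)`. -/
noncomputable def tickMatrix {R : Type*} [CommSemiring R] (H : STG Q A) (D : ℕ) (w : R) :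
    Matrix Q Q R := fun i j =>
  ∑ t ∈ H.trans with t.1 = i ∧ t.2.2.2 = j, w ^ tickCount D t.2.1

/-- The equations of the numbers `c i n` of words of `n` ticks read from `i` in a deterministic
graph, decomposed according to the first transition. -/
def IsWordCount (H : STG Q A) (D : ℕ) (c : Q → ℕ → ℕ) : Prop := open Classical in
  ∀ i n, c i n = (if n = 0 then 1 else 0) +
    ∑ t ∈ H.trans with t.1 = i, if tickCount D t.2.1 ≤ n then
      c t.2.2.2 (n - tickCount D t.2.1) else 0

open Classical in
theorem tickMatrix_mulVec [Fintype Q] {R : Type*} [CommSemiring R] (w : R) (f : Q → R) (i : Q) :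
    (H.tickMatrix D w).mulVec f i =
      ∑ t ∈ H.trans with t.1 = i, w ^ tickCount D t.2.1 * f t.2.2.2 := by
  simp only [Matrix.mulVec, dotProduct, tickMatrix, Finset.sum_mul]
  rw [← Finset.sum_fiberwise _ (fun t : Q × ℚ≥0 × A × Q => t.2.2.2)]
  refine Finset.sum_congr rfl fun j _ => ?_
  rw [Finset.filter_filter]
  refine Finset.sum_congr rfl fun t ht => ?_
  rw [(Finset.mem_filter.mp ht).2.2]

theorem norm_tickMatrix_le {x : ℝ} {w : ℂ} (hw : ‖w‖ ≤ x) (i j : Q) :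
    ‖H.tickMatrix D w i j‖ ≤ H.tickMatrix D x i j := by
  refine norm_sum_le_of_le _ fun t _ => ?_
  rw [norm_pow]
  gcongr

theorem continuous_tickMatrix : Continuous fun x : ℝ => H.tickMatrix D x := by
  refine continuous_matrix fun i j => ?_
  unfold tickMatrix
  fun_prop

theorem ofReal_det_one_sub_tickMatrix [Fintype Q] [DecidableEq Q] (x : ℝ) :
    (((1 - H.tickMatrix D x).det : ℝ) : ℂ) = (1 - H.tickMatrix D (x : ℂ)).det := by
  have hmap : Complex.ofRealHom.mapMatrix (H.tickMatrix D x) = H.tickMatrix D (x : ℂ) := by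
    ext i j
    simp [tickMatrix]
  rw [← Complex.ofRealHom_eq_coe, RingHom.map_det, map_sub, map_one, hmap]

theorem IsDenom.adjMatrix_eq (hH : H.IsDenom D) (z : ℂ) :
    H.adjMatrix z = H.tickMatrix D (z ^ ((D : ℂ)⁻¹)) := by
  classical
  ext i j
  refine Finset.sum_congr rfl fun t ht => ?_
  have hD : (D : ℂ) ≠ 0 := Nat.cast_ne_zero.mpr hH.pos.ne'
  have hticks := hH.natCast_tickCount t (Finset.mem_filter.mp ht).1
  rw [← Complex.cpow_nat_mul, ← div_eq_mul_inv]
  congr 1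
  rw [eq_div_iff hD]
  exact_mod_cast congrArg (fun r : ℚ≥0 => (r : ℂ)) hticks.symm

theorem IsDenom.charQuasiPoly_eq [Fintype Q] [DecidableEq Q] (hH : H.IsDenom D) (z : ℂ) :
    H.charQuasiPoly z = (1 - H.tickMatrix D (z ^ ((D : ℂ)⁻¹))).det := by
  rw [charQuasiPoly, hH.adjMatrix_eq]
  congr!

theorem IsDenom.charQuasiPoly_ofReal_pow [Fintype Q] [DecidableEq Q] (hH : H.IsDenom D) {x : ℝ}
    (hx : 0 ≤ x) :
    H.charQuasiPoly ((x ^ D : ℝ) : ℂ) = ((1 - H.tickMatrix D x).det : ℝ) := by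
  have hroot : ((x ^ D : ℝ) : ℂ) ^ ((D : ℂ)⁻¹) = x := by
    rw [← Complex.ofReal_natCast, ← Complex.ofReal_inv, ← Complex.ofReal_cpow (by positivity),
      Real.pow_rpow_inv_natCast hx hH.pos.ne']
  rw [hH.charQuasiPoly_eq, hroot, ofReal_det_one_sub_tickMatrix]

namespace IsWordCount

variable {c : Q → ℕ → ℕ}

theorem hasSum_eq_one_add [Fintype Q] (hc : H.IsWordCount D c) {x : ℝ} {f : Q → ℝ}
    (hf : ∀ i, HasSum (fun n => (c i n : ℝ) * x ^ n) (f i)) :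
    f = 1 + (H.tickMatrix D x).mulVec f := by
  classical
  funext i
  rw [Pi.add_apply, tickMatrix_mulVec]
  have hone : HasSum (fun n => (if n = 0 then 1 else 0) * x ^ n) 1 := by
    have hzero := hasSum_ite_eq (0 : ℕ) (1 : ℝ)
    refine hzero.congr_fun fun n => ?_
    rcases eq_or_ne n 0 with rfl | hn <;> simp [*]
  refine (hf i).unique ((hone.add (hasSum_sum fun t _ => hasSum_shift_mul_pow (tickCount D t.2.1)
    (hf t.2.2.2))).congr_fun fun n => ?_)
  rw [hc i n]
  push_cast
  rw [add_mul, Finset.sum_mul]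

theorem one_le_of_hasSum (hc : H.IsWordCount D c) {x s : ℝ} (hx : 0 ≤ x) {i : Q}
    (hs : HasSum (fun n => (c i n : ℝ) * x ^ n) s) : 1 ≤ s := by
  have hcount : 1 ≤ c i 0 := by rw [hc i 0]; simp
  calc (1 : ℝ) ≤ c i 0 * x ^ 0 := by simpa using hcount
    _ ≤ s := le_hasSum hs 0 fun n _ => by positivity

theorem det_one_sub_tickMatrix_ne_zero [Fintype Q] [DecidableEq Q] (hc : H.IsWordCount D c)
    {x : ℝ} (hsum : ∀ i, Summable fun n => (c i n : ℝ) * x ^ n) {w : ℂ} (hw : ‖w‖ ≤ x) :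
    (1 - H.tickMatrix D w).det ≠ 0 := by
  have hx : 0 ≤ x := (norm_nonneg w).trans hw
  have hf := fun i => (hsum i).hasSum
  refine det_one_sub_ne_zero (norm_tickMatrix_le hw)
    (fun i => one_pos.trans_le (hc.one_le_of_hasSum hx (hf i))) fun i => ?_
  have hi := congrFun (hc.hasSum_eq_one_add hf) i
  rw [Pi.add_apply, Pi.one_apply] at hi
  linarith

theorem hasSum_eq_div [Fintype Q] [DecidableEq Q] (hc : H.IsWordCount D c) {x : ℝ} {f : Q → ℝ}
    (hf : ∀ i, HasSum (fun n => (c i n : ℝ) * x ^ n) (f i))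
    (hdet : (1 - H.tickMatrix D x).det ≠ 0) (i : Q) :
    f i = (1 - H.tickMatrix D x).adjugate.mulVec 1 i / (1 - H.tickMatrix D x).det := by
  rw [eq_div_iff hdet, mul_comm]
  exact congrFun (det_one_sub_smul_eq_adjugate_mulVec (hc.hasSum_eq_one_add hf)) i

/-- By Cramer's rule the generating functions are rational, hence bounded up to `R`. -/
theorem summable_of_det_ne_zero [Fintype Q] [DecidableEq Q] (hc : H.IsWordCount D c) {R : ℝ}
    (hR : 0 < R)
    (hsum : ∀ x, 0 ≤ x → x < R → ∀ i, Summable fun n => (c i n : ℝ) * x ^ n)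
    (hdet : (1 - H.tickMatrix D R).det ≠ 0) (i : Q) : Summable fun n => (c i n : ℝ) * R ^ n := by
  have hdet' : ∀ x ∈ Set.Icc 0 R, (1 - H.tickMatrix D x).det ≠ 0 := by
    rintro x ⟨hx0, hxR⟩
    rcases hxR.eq_or_lt with rfl | hxR
    · exact hdet
    have hne := hc.det_one_sub_tickMatrix_ne_zero (hsum x hx0 hxR)
      (w := x) (by simp [abs_of_nonneg hx0])
    rw [← ofReal_det_one_sub_tickMatrix] at hne
    exact Complex.ofReal_ne_zero.mp hne
  have hcont : Continuous fun x : ℝ => 1 - H.tickMatrix D x :=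
    continuous_const.sub continuous_tickMatrix
  have hcont' : ContinuousOn (fun x : ℝ => (1 - H.tickMatrix D x).adjugate.mulVec 1 i /
      (1 - H.tickMatrix D x).det) (Set.Icc 0 R) :=
    ((continuous_apply i).comp (hcont.matrix_adjugate.matrix_mulVec continuous_const)).continuousOn
      |>.div hcont.matrix_det.continuousOn hdet'
  obtain ⟨B, hB⟩ := isCompact_Icc.bddAbove_image hcont'
  refine summable_mul_pow_of_hasSum_le (B := B) (fun n => Nat.cast_nonneg _) hR fun x hx => ?_
  have hx' := Set.Ioo_subset_Icc_self hx
  have hf := fun i => (hsum x hx.1.le hx.2 i).hasSum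
  refine ⟨_, ?_, hf i⟩
  rw [hc.hasSum_eq_div hf (hdet' x hx') i]
  exact hB (Set.mem_image_of_mem _ hx')

end IsWordCount

end TickMatrix

end STG

theorem eventually_eq_zero_of_summable_natCast {g : ℕ → ℕ} (h : Summable fun n => (g n : ℝ)) :
    ∀ᶠ n in Filter.atTop, g n = 0 := by
  filter_upwards [h.tendsto_atTop_zero.eventually_lt_const one_pos] with n hn
  exact Nat.cast_lt_one.mp hn

namespace STG

section SmallestRoot

variable {Q A : Type*} [Fintype Q] [Fintype A]

theorem isWordCount_wordCount {H : STG Q A} {D : ℕ} (hH : H.PosTicks D) :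
    H.determinize.IsWordCount D fun S n => H.wordCount D S n :=
  fun S n => by convert wordCount_eq hH S n

theorem IsDenom.determinize {H : STG Q A} {D : ℕ} (hH : H.IsDenom D) :
    H.determinize.IsDenom D where
  pos := hH.pos
  natCast_tickCount := by
    rintro ⟨S, d, a, S'⟩ ht
    obtain ⟨q, hq⟩ := S'.2
    obtain ⟨p, -, hp⟩ := (mem_determinize_trans.mp ht q).mp hq
    exact hH.natCast_tickCount _ hp

variable {G : STG Q A} {D : ℕ} {C γ : ℝ}

theorem wordCount_le_ncard_exactEventSets (hG : G.IsDenom D) (S : Finset Q) (n : ℕ) :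
    G.zeroElim.wordCount D S n ≤ (exactEventSets (G.ticks D) n).ncard :=
  (Set.ncard_le_ncard (wordsFrom_mono (Finset.subset_univ S) n)
    (finite_wordsFrom hG.posTicks_zeroElim n _)).trans
    (wordCount_univ_le_ncard_exactEventSets hG n)

theorem summable_wordCount_of_lt (hG : G.IsDenom D)
    (hγ : IsGrowthRate C (fun n => ((eventSets (G.ticks D) n).ncard : ℝ)) γ) {x : ℝ} (hx0 : 0 ≤ x)
    (hx : x < γ⁻¹) (S : Finset Q) : Summable fun n => (G.zeroElim.wordCount D S n : ℝ) * x ^ n := by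
  have hxγ : x * γ < 1 := (lt_inv_mul_iff₀' hγ.pos).mp (by rwa [mul_one])
  refine Summable.of_nonneg_of_le (fun n => by positivity) (fun n => ?_) (hγ.summable hx0 hxγ)
  have hle := (wordCount_le_ncard_exactEventSets hG S n).trans
    (Set.ncard_le_ncard (exactEventSets_subset_eventSets le_rfl) (finite_eventSets n))
  gcongr

theorem inv_pow_le_norm_of_charQuasiPoly_eq_zero (hG : G.IsDenom D)
    (hγ : IsGrowthRate C (fun n => ((eventSets (G.ticks D) n).ncard : ℝ)) γ) {z : ℂ}
    (hz : G.zeroElim.determinize.charQuasiPoly z = 0) : (γ ^ D)⁻¹ ≤ ‖z‖ := by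
  classical
  rw [hG.zeroElim.determinize.charQuasiPoly_eq] at hz
  by_contra! hlt
  have hw : ‖z ^ ((D : ℂ)⁻¹)‖ < γ⁻¹ := by
    refine lt_of_pow_lt_pow_left₀ D (inv_nonneg.mpr hγ.pos.le) ?_
    rwa [← norm_pow, Complex.cpow_nat_inv_pow z hG.pos.ne', inv_pow]
  exact (isWordCount_wordCount hG.posTicks_zeroElim).det_one_sub_tickMatrix_ne_zero
    (fun S => summable_wordCount_of_lt hG hγ (norm_nonneg _) hw S) le_rfl hz

theorem eq_one_of_summable_wordCount (hG : G.IsDenom D)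
    (hγ : IsGrowthRate C (fun n => ((eventSets (G.ticks D) n).ncard : ℝ)) γ)
    (hsum : Summable fun n => (G.zeroElim.wordCount D Finset.univ n : ℝ) * γ⁻¹ ^ n) :
    γ = 1 ∧ ∀ᶠ n in Filter.atTop, (exactEventSets (G.ticks D) n).ncard = 0 := by
  have hγ0 := hγ.pos
  have hexact : Summable fun n => ((exactEventSets (G.ticks D) n).ncard : ℝ) * γ⁻¹ ^ n := by
    refine Summable.of_nonneg_of_le (fun n => by positivity) (fun n => ?_)
      (hsum.mul_left (Fintype.card (Finset A) : ℝ))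
    rw [← mul_assoc]
    gcongr
    exact_mod_cast ncard_exactEventSets_le_mul_wordCount hG n
  obtain rfl : γ = 1 := hγ.eq_one_of_summable
    (fun n => by rw [ncard_eventSets_eq_sum, Nat.cast_sum]) hexact
  simp only [inv_one, one_pow, mul_one] at hexact
  exact ⟨rfl, eventually_eq_zero_of_summable_natCast hexact⟩

/-- If the generating functions converge at `γ⁻¹`, then there are only finitely many words, so that
they converge everywhere. -/
theorem charQuasiPoly_ne_zero_of_det_ne_zero [Nonempty Q] [DecidableEq Q] (hG : G.IsDenom D)
    (hγ : IsGrowthRate C (fun n => ((eventSets (G.ticks D) n).ncard : ℝ)) γ)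
    (hdet : (1 - G.zeroElim.determinize.tickMatrix D γ⁻¹).det ≠ 0) :
    γ = 1 ∧ ∀ z : ℂ, G.zeroElim.determinize.charQuasiPoly z ≠ 0 := by
  classical
  have hcount := isWordCount_wordCount hG.posTicks_zeroElim
  have hsum := hcount.summable_of_det_ne_zero (inv_pos.mpr hγ.pos)
    (fun x hx0 hx S => summable_wordCount_of_lt hG hγ hx0 hx S) hdet
  obtain ⟨hγ1, hzero⟩ :=
    eq_one_of_summable_wordCount hG hγ (hsum ⟨Finset.univ, Finset.univ_nonempty⟩)
  obtain ⟨N, hN⟩ := Filter.eventually_atTop.mp hzero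
  refine ⟨hγ1, fun z => ?_⟩
  rw [hG.zeroElim.determinize.charQuasiPoly_eq]
  refine hcount.det_one_sub_tickMatrix_ne_zero (fun S => ?_) le_rfl
  refine summable_of_ne_finset_zero (s := Finset.range N) fun n hn => ?_
  have hn : G.zeroElim.wordCount D S n = 0 := Nat.eq_zero_of_le_zero <|
    (wordCount_le_ncard_exactEventSets hG S n).trans_eq (hN n (by simpa using hn))
  rw [hn, Nat.cast_zero, zero_mul]

theorem exists_smallest_root_or_forall_ne_zero [Nonempty Q] (hG : G.IsDenom D)
    (hγ : IsGrowthRate C (fun n => ((eventSets (G.ticks D) n).ncard : ℝ)) γ) :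
    (∃ z₀ : ℝ, 0 < z₀ ∧ G.zeroElim.determinize.charQuasiPoly (z₀ : ℂ) = 0 ∧
      (∀ z : ℂ, G.zeroElim.determinize.charQuasiPoly z = 0 → z₀ ≤ ‖z‖) ∧
      Real.logb 2 (γ ^ D) = -Real.logb 2 z₀) ∨
    ((∀ z : ℂ, G.zeroElim.determinize.charQuasiPoly z ≠ 0) ∧ Real.logb 2 (γ ^ D) = 0) := by
  classical
  by_cases hdet : (1 - G.zeroElim.determinize.tickMatrix D γ⁻¹).det = 0
  · refine Or.inl ⟨(γ ^ D)⁻¹, inv_pos.mpr (pow_pos hγ.pos D), ?_,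
      fun z => inv_pow_le_norm_of_charQuasiPoly_eq_zero hG hγ, by rw [Real.logb_inv, neg_neg]⟩
    rw [← inv_pow, hG.zeroElim.determinize.charQuasiPoly_ofReal_pow (inv_nonneg.mpr hγ.pos.le),
      hdet, Complex.ofReal_zero]
  · obtain ⟨hγ1, hroot⟩ := charQuasiPoly_ne_zero_of_det_ne_zero hG hγ hdet
    exact Or.inr ⟨hroot, by rw [hγ1, one_pow, Real.logb_one]⟩

end SmallestRoot

end STG

section Recurrence

open Polynomial

/-- The shift operator `y ↦ (n ↦ y (n + 1))` on sequences; polynomials in it encode linear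
recurrences with constant coefficients. -/
def seqShift (R : Type*) [CommSemiring R] : Module.End R (ℕ → R) := LinearMap.funLeft R R Nat.succ

section Shift

variable {R : Type*} [CommSemiring R]

theorem seqShift_apply (y : ℕ → R) (n : ℕ) : seqShift R y n = y (n + 1) := rfl

theorem seqShift_pow_apply (i : ℕ) (y : ℕ → R) (n : ℕ) : (seqShift R ^ i) y n = y (n + i) := by
  induction i generalizing n with
  | zero => simp
  | succ i ih => rw [pow_succ', Module.End.mul_apply, seqShift_apply, ih, add_right_comm, add_assoc]

theorem aeval_seqShift_apply {S : Type*} [CommSemiring S] [Algebra S R] (p : S[X]) (y : ℕ → R)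
    (n : ℕ) : aeval (seqShift R) p y n = p.sum fun i a => a • y (n + i) := by
  rw [aeval_eq_sum_range, sum_over_range (f := fun i a => a • y (n + i)) p fun i => zero_smul S _]
  simp only [LinearMap.sum_apply, Finset.sum_apply, LinearMap.smul_apply, Pi.smul_apply,
    seqShift_pow_apply]

theorem aeval_seqShift_algebraMap {S T : Type*} [CommSemiring S] [CommSemiring T] [Algebra S R]
    [Algebra S T] [Algebra R T] [IsScalarTower S R T] (p : S[X]) (y : ℕ → R) (n : ℕ) :
    aeval (seqShift T) p (fun k => algebraMap R T (y k)) n =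
      algebraMap R T (aeval (seqShift R) p y n) := by
  simp only [aeval_seqShift_apply, sum_def, map_sum, algebraMap.smul]

theorem eq_zero_of_aeval_seqShift_eq_zero {R : Type*} [CommRing R] {p : R[X]} (hp : p.Monic)
    {y : ℕ → R} (hy : aeval (seqShift R) p y = 0) (h0 : ∀ n < p.natDegree, y n = 0) : y = 0 := by
  funext n
  induction n using Nat.strong_induction_on with
  | _ n ih =>
    rcases lt_or_ge n p.natDegree with hn | hn
    · exact h0 n hn
    have hrec := congrFun hy (n - p.natDegree)
    rwa [aeval_seqShift_apply,
      sum_over_range (f := fun i a => a • y (n - p.natDegree + i)) p fun i => zero_smul R _,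
      Finset.sum_range_succ, Finset.sum_eq_zero, zero_add, hp.coeff_natDegree, one_smul,
      Nat.sub_add_cancel hn] at hrec
    intro i hi
    have hi' := Finset.mem_range.mp hi
    rw [ih _ (by omega), Pi.zero_apply, smul_zero]

theorem coe_aeval_restrict {R M : Type*} [CommSemiring R] [AddCommMonoid M] [Module R M]
    {f : Module.End R M} {V : Submodule R M} (hV : ∀ x ∈ V, f x ∈ V) (p : R[X]) (x : V) :
    (aeval (f.restrict hV) p x : M) = aeval f p x := by
  simp only [aeval_eq_sum_range, LinearMap.sum_apply, LinearMap.smul_apply, Submodule.coe_sum,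
    Submodule.coe_smul, Module.End.pow_restrict _ hV, LinearMap.coe_restrict_apply]

end Shift

variable {𝕜 : Type*} [Field 𝕜]

/-- `y` satisfies a linear recurrence of order at most `K`, in the form that is easiest to
establish: it lies in a shift-invariant space of dimension at most `K`. -/
def IsRecurrent (K : ℕ) (y : ℕ → 𝕜) : Prop :=
  ∃ V ∈ (seqShift 𝕜).invtSubmodule, FiniteDimensional 𝕜 V ∧ Module.finrank 𝕜 V ≤ K ∧ y ∈ V

theorem isRecurrent_of_seqShift_mem_span {ι : Type*} [Fintype ι] (b : ι → ℕ → 𝕜)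
    (hb : ∀ i, seqShift 𝕜 (b i) ∈ Submodule.span 𝕜 (Set.range b)) (i : ι) :
    IsRecurrent (Fintype.card ι) (b i) := by
  refine ⟨Submodule.span 𝕜 (Set.range b), ?_, FiniteDimensional.span_of_finite 𝕜
    (Set.finite_range b), finrank_range_le_card b, Submodule.subset_span ⟨i, rfl⟩⟩
  rw [Module.End.mem_invtSubmodule, Submodule.span_le, Set.range_subset_iff]
  exact hb

namespace IsRecurrent

variable {K : ℕ} {y : ℕ → 𝕜}

theorem mono {K' : ℕ} (h : IsRecurrent K y) (hK : K ≤ K') : IsRecurrent K' y :=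
  let ⟨V, hV, hfin, hdim, hy⟩ := h
  ⟨V, hV, hfin, hdim.trans hK, hy⟩

theorem exists_monic (h : IsRecurrent K y) :
    ∃ p : 𝕜[X], p.Monic ∧ p.natDegree ≤ K ∧ aeval (seqShift 𝕜) p y = 0 := by
  obtain ⟨V, hV, _, hdim, hy⟩ := h
  rw [Module.End.mem_invtSubmodule_iff_forall_mem_of_mem] at hV
  set f := (seqShift 𝕜).restrict hV
  refine ⟨f.charpoly, f.charpoly_monic, f.charpoly_natDegree.trans_le hdim, ?_⟩
  rw [← coe_aeval_restrict hV _ ⟨y, hy⟩, f.aeval_self_charpoly, LinearMap.zero_apply,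
    ZeroMemClass.coe_zero]

theorem aeval_seqShift_eq_zero (h : IsRecurrent K y) {S : Type*} [CommSemiring S] [Algebra S 𝕜]
    {q : S[X]} (hq : ∀ n < K, aeval (seqShift 𝕜) q y n = 0) : aeval (seqShift 𝕜) q y = 0 := by
  obtain ⟨p, hp, hdeg, hpy⟩ := h.exists_monic
  simp only [← aeval_map_algebraMap 𝕜 _ q] at hq ⊢
  refine eq_zero_of_aeval_seqShift_eq_zero hp ?_ fun n hn => hq n (hn.trans_le hdeg)
  rw [← Module.End.mul_apply, ← map_mul, mul_comm, map_mul, Module.End.mul_apply, hpy, map_zero]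

theorem comp_mul (h : IsRecurrent K y) (D : ℕ) : IsRecurrent K fun n => y (D * n) := by
  obtain ⟨V, hV, hfin, hdim, hy⟩ := h
  refine ⟨V.map (LinearMap.funLeft 𝕜 𝕜 fun n => D * n), ?_, inferInstance,
    (Submodule.finrank_map_le _ V).trans hdim, ⟨y, hy, rfl⟩⟩
  rw [Module.End.mem_invtSubmodule_iff_forall_mem_of_mem] at hV ⊢
  rintro _ ⟨z, hz, rfl⟩
  refine ⟨(seqShift 𝕜 ^ D) z, Module.End.pow_apply_mem_of_forall_mem D hV z hz, ?_⟩
  funext n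
  rw [LinearMap.funLeft_apply, seqShift_pow_apply, seqShift_apply, LinearMap.funLeft_apply, mul_add,
    mul_one]

end IsRecurrent

/-- The sequence `y` delayed by `j` steps, padded with zeros. -/
def delaySeq (j : ℕ) (y : ℕ → 𝕜) (n : ℕ) : 𝕜 := if j ≤ n then y (n - j) else 0

theorem delaySeq_zero (y : ℕ → 𝕜) : delaySeq 0 y = y := by
  funext n
  simp [delaySeq]

theorem seqShift_delaySeq_succ (j : ℕ) (y : ℕ → 𝕜) :
    seqShift 𝕜 (delaySeq (j + 1) y) = delaySeq j y := by
  funext n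
  simp [seqShift_apply, delaySeq]

namespace STG

variable {Q A : Type*}

theorem IsWordCount.seqShift_eq [DecidableEq Q] {H : STG Q A} {D : ℕ} {f : Q → ℕ → ℕ}
    (hf : H.IsWordCount D f) (hH : H.PosTicks D) (q : Q) : seqShift 𝕜 (fun n => (f q n : 𝕜)) =
      ∑ t ∈ H.trans with t.1 = q,
        delaySeq (tickCount D t.2.1 - 1) fun n => (f t.2.2.2 n : 𝕜) := by
  funext n
  rw [seqShift_apply, hf, Finset.sum_apply, if_neg n.succ_ne_zero, zero_add, Nat.cast_sum]
  refine Finset.sum_congr (by congr) fun t ht => ?_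
  obtain ⟨k, hk⟩ := Nat.exists_eq_succ_of_ne_zero (hH t (Finset.mem_filter.mp ht).1).ne'
  simp [delaySeq, hk]

section EventSets

variable [Fintype Q] {G : STG Q A} {D M : ℕ}

theorem tickCount_le_of_mem_determinize_zeroElim [Fintype A]
    (hM : ∀ t ∈ G.trans, tickCount D t.2.1 ≤ M) :
    ∀ t ∈ G.zeroElim.determinize.trans, tickCount D t.2.1 ≤ M := by
  rintro ⟨S, d, B, S'⟩ ht
  obtain ⟨q, hq⟩ := S'.2
  obtain ⟨p, -, hp⟩ := (mem_determinize_trans.mp ht q).mp hq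
  obtain ⟨-, a, q₀, l, hd, -⟩ := mem_zeroElim_trans.mp hp
  exact hM _ hd

theorem seqShift_ncard_eventSets [Fintype A] (hG : G.IsDenom D) :
    seqShift 𝕜 (fun n => ((eventSets (G.ticks D) n).ncard : 𝕜)) =
      (fun n => ((eventSets (G.ticks D) n).ncard : 𝕜)) +
        ∑ B : Finset A, seqShift 𝕜 fun n => (G.zeroElim.wordCount D (G.zeroReach B) n : 𝕜) := by
  funext n
  rw [seqShift_apply, ncard_eventSets_eq_sum, Finset.sum_range_succ, ← ncard_eventSets_eq_sum,
    ncard_exactEventSets_ticks hG, Pi.add_apply, Finset.sum_apply]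
  push_cast
  rfl

/-- The delayed word counts span a shift-invariant space together with the number of event sets. -/
theorem isRecurrent_ncard_eventSets [Finite A] (hG : G.IsDenom D)
    (hM : ∀ t ∈ G.trans, tickCount D t.2.1 ≤ M) :
    IsRecurrent (1 + 2 ^ Fintype.card Q * M)
      fun n => ((eventSets (G.ticks D) n).ncard : 𝕜) := by
  classical
  cases nonempty_fintype A
  have hpos := hG.posTicks_zeroElim
  let count (S : {S : Finset Q // S.Nonempty}) : ℕ → 𝕜 := fun n => G.zeroElim.wordCount D S n
  let b : Option ({S : Finset Q // S.Nonempty} × Fin M) → ℕ → 𝕜 := fun o =>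
    o.elim (fun n => ((eventSets (G.ticks D) n).ncard : 𝕜)) fun x => delaySeq x.2 (count x.1)
  let V := Submodule.span 𝕜 (Set.range b)
  have hdelay : ∀ S j, j < M → delaySeq j (count S) ∈ V := fun S j hj =>
    Submodule.subset_span ⟨some (S, ⟨j, hj⟩), rfl⟩
  have hcount : ∀ S, seqShift 𝕜 (count S) ∈ V := by
    intro S
    rw [(isWordCount_wordCount hpos).seqShift_eq hpos.determinize]
    refine V.sum_mem fun t ht => hdelay _ _ ?_
    have ht' := (Finset.mem_filter.mp ht).1
    have := hpos.determinize t ht'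
    have := tickCount_le_of_mem_determinize_zeroElim hM t ht'
    omega
  refine (isRecurrent_of_seqShift_mem_span b ?_ none).mono ?_
  · rintro (_ | ⟨S, ⟨_ | j, hj⟩⟩)
    · change seqShift 𝕜 (fun n => ((eventSets (G.ticks D) n).ncard : 𝕜)) ∈ V
      rw [seqShift_ncard_eventSets hG]
      refine V.add_mem (Submodule.subset_span ⟨none, rfl⟩) (V.sum_mem fun B _ => ?_)
      rcases (G.zeroReach B).eq_empty_or_nonempty with h | h
      · convert V.zero_mem
        funext n
        simp [seqShift_apply, h, wordCount, wordsFrom]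
      · exact hcount ⟨_, h⟩
    · change seqShift 𝕜 (delaySeq 0 (count S)) ∈ V
      exact delaySeq_zero (count S) ▸ hcount S
    · change seqShift 𝕜 (delaySeq (j + 1) (count S)) ∈ V
      exact seqShift_delaySeq_succ j (count S) ▸ hdelay S j (Nat.lt_of_succ_lt hj)
  · rw [Fintype.card_option, Fintype.card_prod, Fintype.card_fin, add_comm]
    gcongr
    exact (Fintype.card_subtype_le _).trans_eq Fintype.card_finset

end EventSets

end STG

end Recurrence

section GeneratingFunction

open Polynomial

/-- `x ^ N` times the `N`-th partial sum of `∑ u k * x⁻¹ ^ k`, written without inverses. -/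
def partialSum {R : Type*} [CommSemiring R] (u : ℕ → R) (N : ℕ) (x : R) : R :=
  ∑ k ∈ Finset.range N, u k * x ^ (N - k)

/-- If `P` annihilates `u`, this is the numerator of `∑ u k * x⁻¹ ^ k`, the denominator being
`P x`. -/
def genNumerator {S R : Type*} [CommSemiring S] [CommSemiring R] [Algebra S R] (P : S[X])
    (u : ℕ → R) (x : R) : R :=
  P.sum fun i a => a • partialSum u i x

theorem partialSum_eq {𝕜 : Type*} [Field 𝕜] (u : ℕ → 𝕜) (N : ℕ) {x : 𝕜} (hx : x ≠ 0) :
    partialSum u N x = x ^ N * ∑ k ∈ Finset.range N, u k * x⁻¹ ^ k := by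
  rw [partialSum, Finset.mul_sum]
  refine Finset.sum_congr rfl fun k hk => ?_
  rw [pow_sub₀ x hx (Finset.mem_range.mp hk).le, inv_pow, mul_left_comm]

section Tower

variable {S R T : Type*} [CommSemiring S] [CommSemiring R] [CommSemiring T] [Algebra R T]

theorem partialSum_algebraMap (u : ℕ → R) (N : ℕ) (x : R) :
    partialSum (fun k => algebraMap R T (u k)) N (algebraMap R T x) =
      algebraMap R T (partialSum u N x) := by
  simp only [partialSum, map_sum, map_mul, map_pow]

theorem genNumerator_algebraMap [Algebra S R] [Algebra S T] [IsScalarTower S R T] (P : S[X])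
    (u : ℕ → R) (x : R) :
    genNumerator P (fun k => algebraMap R T (u k)) (algebraMap R T x) =
      algebraMap R T (genNumerator P u x) := by
  simp only [genNumerator, sum_def, map_sum, partialSum_algebraMap, algebraMap.smul]

end Tower

section Real

variable {S : Type*} [CommSemiring S] [Algebra S ℝ] {P : S[X]} {u : ℕ → ℝ} {x f : ℝ}

theorem continuous_genNumerator : Continuous (genNumerator P u) := by
  unfold genNumerator partialSum
  simp only [sum_def]
  fun_prop

theorem hasSum_shift_mul_inv_pow (hx : x ≠ 0) (hf : HasSum (fun k => u k * x⁻¹ ^ k) f) (i : ℕ) :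
    HasSum (fun k => u (k + i) * x⁻¹ ^ k) (x ^ i * f - partialSum u i x) := by
  rw [partialSum_eq u i hx, ← mul_sub]
  refine (((hasSum_nat_add_iff' i).mpr hf).mul_left (x ^ i)).congr_fun fun k => ?_
  rw [pow_add, mul_left_comm, mul_left_comm (x ^ i), ← mul_pow, mul_inv_cancel₀ hx, one_pow,
    mul_one]

theorem aeval_mul_eq_genNumerator (hP : aeval (seqShift ℝ) P u = 0) (hx : x ≠ 0)
    (hf : HasSum (fun k => u k * x⁻¹ ^ k) f) : aeval x P * f = genNumerator P u x := by
  have hshift : HasSum (fun k => aeval (seqShift ℝ) P u k * x⁻¹ ^ k)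
      (P.sum fun i a => a • (x ^ i * f - partialSum u i x)) := by
    simp only [aeval_seqShift_apply, sum_def, Finset.sum_mul, smul_mul_assoc]
    exact hasSum_sum fun i _ => (hasSum_shift_mul_inv_pow hx hf i).const_smul _
  simp only [hP, Pi.zero_apply, zero_mul] at hshift
  have hzero := hshift.unique hasSum_zero
  rw [← sub_eq_zero, ← hzero, genNumerator, aeval_def, eval₂_eq_sum]
  simp only [sum_def, Finset.sum_mul, ← Finset.sum_sub_distrib, Algebra.smul_def, mul_sub,
    mul_assoc]

end Real

namespace IsGrowthRate

variable {S : Type*} [CommSemiring S] [Algebra S ℝ] {P : S[X]} {C γ x : ℝ} {U : ℕ → ℝ}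

theorem const_pos (h : IsGrowthRate C U γ) : 0 < C :=
  pos_of_mul_pos_left (one_pos.trans_le ((pow_zero γ).ge.trans (h.pow_le 0))) (h.apply_pos 0).le

theorem hasSum (h : IsGrowthRate C U γ) (hx : γ < x) :
    HasSum (fun k => U k * x⁻¹ ^ k) (∑' k, U k * x⁻¹ ^ k) := by
  have hx0 : 0 < x := h.pos.trans hx
  refine (h.summable (inv_nonneg.mpr hx0.le) ?_).hasSum
  rwa [inv_mul_lt_iff₀ hx0, mul_one]

/-- Comparison with the geometric series `∑ (γ / x) ^ k = x / (x - γ)`. -/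
theorem le_mul_tsum (h : IsGrowthRate C U γ) (hx : γ < x) :
    x ≤ C * (x - γ) * ∑' k, U k * x⁻¹ ^ k := by
  have hx0 : 0 < x := h.pos.trans hx
  have hratio : γ / x < 1 := (div_lt_one hx0).mpr hx
  have hgeom := hasSum_geometric_of_lt_one (div_nonneg h.pos.le hx0.le) hratio
  have hle := hasSum_le (fun k => ?_) hgeom ((h.hasSum hx).mul_left C)
  · have hsub : 0 < x - γ := sub_pos.mpr hx
    rw [one_sub_div hx0.ne', inv_div, div_le_iff₀ hsub] at hle
    linarith
  rw [div_eq_mul_inv, mul_pow, ← mul_assoc]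
  gcongr
  exact h.pow_le k

theorem aeval_eq_zero (h : IsGrowthRate C U γ) (hP : aeval (seqShift ℝ) P U = 0) :
    aeval γ P = 0 := by
  have hbound : ∀ x ∈ Set.Ioi γ, x * |aeval x P| ≤ C * (x - γ) * |genNumerator P U x| := by
    intro x hx
    rw [← aeval_mul_eq_genNumerator hP (h.pos.trans hx).ne' (h.hasSum hx), abs_mul, mul_comm x,
      mul_left_comm]
    gcongr
    exact (h.le_mul_tsum hx).trans
      (mul_le_mul_of_nonneg_left (le_abs_self _)
        (mul_nonneg h.const_pos.le (sub_nonneg.mpr (Set.mem_Ioi.mp hx).le)))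
  have hlimit := ContinuousWithinAt.closure_le (s := Set.Ioi γ) (x := γ) (by simp)
    (f := fun x => x * |aeval x P|) (g := fun x => C * (x - γ) * |genNumerator P U x|)
    (by fun_prop) (by have := continuous_genNumerator (P := P) (u := U); fun_prop) hbound
  rw [sub_self, mul_zero, zero_mul] at hlimit
  exact abs_nonpos_iff.mp (nonpos_of_mul_nonpos_right hlimit h.pos)

theorem le_of_mul_genNumerator_le (h : IsGrowthRate C U γ) (hP : aeval (seqShift ℝ) P U = 0)
    (hx0 : 0 < x) (hPx : aeval x P ≠ 0) {N : ℕ}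
    (hN : aeval x P * genNumerator P U x * x ^ N ≤ aeval x P ^ 2 * partialSum U N x) : x ≤ γ := by
  by_contra! hx
  have hsum := h.hasSum hx
  have hterm : ∀ k, 0 < U k * x⁻¹ ^ k := fun k => mul_pos (h.apply_pos k) (by positivity)
  have hlt : ∑ k ∈ Finset.range N, U k * x⁻¹ ^ k < ∑' k, U k * x⁻¹ ^ k :=
    (Finset.sum_range_succ (fun k => U k * x⁻¹ ^ k) N ▸ lt_add_of_pos_right _ (hterm N)).trans_le
      (Summable.sum_le_tsum (Finset.range (N + 1)) (fun k _ => (hterm k).le) hsum.summable)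
  rw [← aeval_mul_eq_genNumerator hP hx0.ne' hsum, partialSum_eq U N hx0.ne'] at hN
  have hpos : 0 < aeval x P ^ 2 * x ^ N := by positivity
  nlinarith [mul_lt_mul_of_pos_left hlt hpos]

theorem mul_pow_le_mul_partialSum (h : IsGrowthRate C U γ) (hx0 : 0 < x) (hx : x ≤ γ) (N : ℕ) :
    N * x ^ N ≤ C * partialSum U N x := by
  rw [partialSum_eq U N hx0.ne', mul_left_comm, mul_comm, Finset.mul_sum]
  gcongr
  have hterm : ∀ k ∈ Finset.range N, 1 ≤ C * (U k * x⁻¹ ^ k) := fun k _ => by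
    rw [inv_pow, ← mul_assoc, ← div_eq_mul_inv, one_le_div (by positivity)]
    exact (pow_le_pow_left₀ hx0.le hx k).trans (h.pow_le k)
  simpa using Finset.card_nsmul_le_sum _ _ 1 hterm

theorem exists_mul_genNumerator_le (h : IsGrowthRate C U γ) (hx0 : 0 < x) (hx : x ≤ γ)
    (hPx : aeval x P ≠ 0) :
    ∃ N, aeval x P * genNumerator P U x * x ^ N ≤ aeval x P ^ 2 * partialSum U N x := by
  have hC := h.const_pos
  obtain ⟨N, hN⟩ := exists_nat_ge (C * (aeval x P * genNumerator P U x) / aeval x P ^ 2)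
  rw [div_le_iff₀ (by positivity)] at hN
  refine ⟨N, le_of_mul_le_mul_left ?_ hC⟩
  calc C * (aeval x P * genNumerator P U x * x ^ N)
      = C * (aeval x P * genNumerator P U x) * x ^ N := by ring
    _ ≤ N * aeval x P ^ 2 * x ^ N := by gcongr
    _ = aeval x P ^ 2 * (N * x ^ N) := by ring
    _ ≤ aeval x P ^ 2 * (C * partialSum U N x) := by
        exact mul_le_mul_of_nonneg_left (h.mul_pow_le_mul_partialSum hx0 hx N) (sq_nonneg _)
    _ = C * (aeval x P ^ 2 * partialSum U N x) := by ring

end IsGrowthRate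

end GeneratingFunction

section Codes

open Polynomial

theorem coeff_polyOfCode (l : List (ℕ × ℕ)) (i : ℕ) :
    (polyOfCode l).coeff i = ((l.getD i (0, 0)).1 : ℤ) - (l.getD i (0, 0)).2 := by
  induction l generalizing i with
  | nil => simp [polyOfCode]
  | cons a l ih => cases i <;> simp [polyOfCode, coeff_X_mul, ih]

theorem degree_polyOfCode_lt (l : List (ℕ × ℕ)) : (polyOfCode l).degree < l.length := by
  refine (degree_lt_iff_coeff_zero _ _).mpr fun i hi => ?_
  rw [coeff_polyOfCode, List.getD_eq_default _ _ hi, sub_self]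

theorem natDegree_polyOfCode_le (l : List (ℕ × ℕ)) : (polyOfCode l).natDegree ≤ l.length :=
  natDegree_le_of_degree_le (degree_polyOfCode_lt l).le

theorem sum_polyOfCode {M : Type*} [AddCommMonoid M] (l : List (ℕ × ℕ)) {f : ℕ → ℤ → M}
    (hf : ∀ i, f i 0 = 0) : (polyOfCode l).sum f =
      ∑ i ∈ Finset.range l.length, f i ((l.getD i (0, 0)).1 - (l.getD i (0, 0)).2) := by
  rcases eq_or_ne (polyOfCode l) 0 with h0 | h0
  · have hcoeff := coeff_polyOfCode l
    simp only [h0, coeff_zero] at hcoeff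
    simp only [h0, sum_zero_index, ← hcoeff, hf, Finset.sum_const_zero]
  · have hdeg := (natDegree_lt_iff_degree_lt h0).mpr (degree_polyOfCode_lt l)
    simp only [sum_over_range' _ hf _ hdeg, coeff_polyOfCode]

theorem exists_polyOfCode_eq (p : ℤ[X]) : ∃ l, polyOfCode l = p := by
  refine ⟨(List.range (p.natDegree + 1)).map fun i =>
    ((p.coeff i).toNat, (-p.coeff i).toNat), ?_⟩
  ext i
  rw [coeff_polyOfCode]
  by_cases hi : i < p.natDegree + 1
  · simp [List.getD_eq_getElem?_getD, hi]
  · rw [List.getD_eq_default _ _ (by simpa using hi), coeff_eq_zero_of_natDegree_lt (by omega),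
      sub_self]

/-- The polynomial of the minuends in `polyOfCode l`; its coefficients are non-negative. -/
noncomputable def posPoly (l : List (ℕ × ℕ)) : ℤ[X] := polyOfCode (l.map fun a => (a.1, 0))

/-- The polynomial of the subtrahends in `polyOfCode l`; its coefficients are non-negative. -/
noncomputable def negPoly (l : List (ℕ × ℕ)) : ℤ[X] := polyOfCode (l.map fun a => (a.2, 0))

theorem posPoly_sub_negPoly (l : List (ℕ × ℕ)) : posPoly l - negPoly l = polyOfCode l := by
  induction l with
  | nil => simp [posPoly, negPoly, polyOfCode]
  | cons a l ih =>
    simp only [polyOfCode, ← ih, posPoly, negPoly, List.map_cons, map_sub, map_natCast,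
      Nat.cast_zero, sub_zero]
    ring

theorem coeff_polyOfCode_map_nonneg (l : List (ℕ × ℕ)) (f : ℕ × ℕ → ℕ) (i : ℕ) :
    0 ≤ (polyOfCode (l.map fun a => (f a, 0))).coeff i := by
  induction l generalizing i with
  | nil => simp [polyOfCode]
  | cons a l ih => cases i <;> simp [polyOfCode, coeff_X_mul, ih]

theorem coeff_posPoly_nonneg (l : List (ℕ × ℕ)) (i : ℕ) : 0 ≤ (posPoly l).coeff i :=
  coeff_polyOfCode_map_nonneg l Prod.fst i

theorem coeff_negPoly_nonneg (l : List (ℕ × ℕ)) (i : ℕ) : 0 ≤ (negPoly l).coeff i :=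
  coeff_polyOfCode_map_nonneg l Prod.snd i

theorem exists_ratOfCode_eq (q : ℚ≥0) : ∃ a, ratOfCode a = q := by
  refine ⟨(q.num, q.den - 1), ?_⟩
  rw [ratOfCode, ← Nat.cast_succ, Nat.succ_eq_add_one, Nat.sub_add_cancel q.den_pos, q.num_div_den]

theorem exists_ratOfCode_mem_Ioo {x y : ℝ} (hx : 0 ≤ x) (hxy : x < y) :
    ∃ a, (ratOfCode a : ℝ) ∈ Set.Ioo x y := by
  obtain ⟨q, hxq, hqy⟩ := exists_rat_btwn hxy
  lift q to ℚ≥0 using by exact_mod_cast (hx.trans_lt hxq).le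
  obtain ⟨a, rfl⟩ := exists_ratOfCode_eq q
  exact ⟨a, by exact_mod_cast hxq, by exact_mod_cast hqy⟩

end Codes

section Isolation

open Polynomial

theorem aeval_mono_of_coeff_nonneg {p : ℤ[X]} (hp : ∀ i, 0 ≤ p.coeff i) {x y : ℝ} (hx : 0 ≤ x)
    (hxy : x ≤ y) : aeval x p ≤ aeval y p := by
  simp only [aeval_eq_sum_range, zsmul_eq_mul]
  have hcoeff : ∀ i, (0 : ℝ) ≤ p.coeff i := fun i => Int.cast_nonneg (hp i)
  gcongr with i
  exact hcoeff i

theorem coeff_derivative_nonneg {p : ℤ[X]} (hp : ∀ i, 0 ≤ p.coeff i) (i : ℕ) :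
    0 ≤ p.derivative.coeff i := by
  rw [coeff_derivative]
  exact mul_nonneg (hp _) (by positivity)

/-- Both derivatives are monotone, so that their values at the endpoints suffice. -/
theorem strictMonoOn_aeval_sub {p n : ℤ[X]} (hp : ∀ i, 0 ≤ p.coeff i) (hn : ∀ i, 0 ≤ n.coeff i)
    {x y : ℝ} (hx : 0 ≤ x) (h : aeval y n.derivative < aeval x p.derivative) :
    StrictMonoOn (fun z => aeval z (p - n)) (Set.Icc x y) := by
  refine strictMonoOn_of_deriv_pos (convex_Icc x y) (p - n).continuousOn_aeval fun z hz => ?_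
  rw [interior_Icc] at hz
  rw [((p - n).hasDerivAt_aeval z).deriv, derivative_sub, map_sub, sub_pos]
  calc aeval z n.derivative
      ≤ aeval y n.derivative :=
        aeval_mono_of_coeff_nonneg (coeff_derivative_nonneg hn) (hx.trans hz.1.le) hz.2.le
    _ < aeval x p.derivative := h
    _ ≤ aeval z p.derivative := aeval_mono_of_coeff_nonneg (coeff_derivative_nonneg hp) hx hz.1.le

theorem exists_separable_map_dvd_pow {A K : Type*} [CommRing A] [IsDomain A] [Field K]
    [PerfectField K] [Algebra A K] [IsFractionRing A K] {p : K[X]} (hp : p ≠ 0) :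
    ∃ (q : A[X]) (m : ℕ), (q.map (algebraMap A K)).Separable ∧ p ∣ q.map (algebraMap A K) ^ m := by
  classical
  obtain ⟨m, hm⟩ := UniqueFactorizationMonoid.exists_dvd_radical_self_pow hp
  set r := UniqueFactorizationMonoid.radical p
  have hsep : r.Separable :=
    PerfectField.separable_iff_squarefree.mpr UniqueFactorizationMonoid.squarefree_radical
  obtain ⟨b, hb, hq⟩ := IsLocalization.integerNormalization_spec (nonZeroDivisors A) r
  have hassoc : Associated r (b • r) := by
    rw [← IsScalarTower.algebraMap_smul K b r, smul_eq_C_mul]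
    exact associated_unit_mul_right r _
      (isUnit_C.mpr (IsLocalization.map_units K (⟨b, hb⟩ : nonZeroDivisors A)))
  refine ⟨IsLocalization.integerNormalization (nonZeroDivisors A) r, m, ?_, ?_⟩
  · rw [hq]
    exact hsep.of_dvd hassoc.dvd'
  · rw [hq]
    exact hm.trans (pow_dvd_pow_of_dvd hassoc.dvd m)

end Isolation

section Certificates

open Polynomial

/-- `x ≤ γ ≤ y` is forced for the growth rate `γ` of `u`, and `γ` is forced to be the only root of
`polyOfCode q` in this interval, provided that `γ ^ n ≤ C * u n` and that `u` is recurrent of order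
at most `K`. The polynomial of `P`, the `m`-th power of that of `q`, annihilates `u` and hence
vanishes at `γ`, and the polynomial of `q` increases strictly on the interval. The `k`-th term of
`u` shows `γ ≤ y`. If `γ < x`, then the `N`-th partial sum of the generating function at `x⁻¹` would
be smaller than the closed form of the series, contrary to the last condition. The field `𝕜` is `ℝ`
in proofs and `ℚ` in computations. -/
def IsRootCert {𝕜 : Type*} [Field 𝕜] [LinearOrder 𝕜] (q P : List (ℕ × ℕ)) (m N k : ℕ)
    (u : ℕ → ℕ) (C K : ℕ) (x y : 𝕜) : Prop :=
  polyOfCode P = polyOfCode q ^ m ∧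
    (∀ n < K, aeval (seqShift 𝕜) (polyOfCode P) (fun i => (u i : 𝕜)) n = 0) ∧
    aeval y (negPoly q).derivative < aeval x (posPoly q).derivative ∧
    0 < x ∧ 0 < y ∧ 0 < k ∧ (C * u k : 𝕜) ≤ y ^ k ∧
    aeval x (polyOfCode P) ≠ 0 ∧
    aeval x (polyOfCode P) * genNumerator (polyOfCode P) (fun i => (u i : 𝕜)) x * x ^ N ≤
      aeval x (polyOfCode P) ^ 2 * partialSum (fun i => (u i : 𝕜)) N x

variable {q P : List (ℕ × ℕ)} {m N k : ℕ} {u : ℕ → ℕ} {C K : ℕ}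

theorem isRootCert_ratCast_iff {x y : ℚ} :
    IsRootCert q P m N k u C K (x : ℝ) y ↔ IsRootCert q P m N k u C K x y := by
  have hseq : (fun i => (u i : ℝ)) = fun i => algebraMap ℚ ℝ (u i) := by simp
  simp only [IsRootCert, hseq, ← eq_ratCast (algebraMap ℚ ℝ), aeval_seqShift_algebraMap,
    genNumerator_algebraMap, partialSum_algebraMap, aeval_algebraMap_apply]
  simp only [eq_ratCast]
  norm_cast

theorem IsRootCert.aeval_eq_zero {γ x y : ℝ} (h : IsRootCert q P m N k u C K x y)
    (hγ : IsGrowthRate C (fun n => (u n : ℝ)) γ) (hK : IsRecurrent K fun n => (u n : ℝ)) :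
    aeval γ (polyOfCode q) = 0 := by
  refine eq_zero_of_pow_eq_zero (n := m) ?_
  rw [← map_pow, ← h.1]
  exact hγ.aeval_eq_zero (hK.aeval_seqShift_eq_zero h.2.1)

theorem IsRootCert.mem_Icc {γ x y : ℝ} (h : IsRootCert q P m N k u C K x y)
    (hγ : IsGrowthRate C (fun n => (u n : ℝ)) γ) (hK : IsRecurrent K fun n => (u n : ℝ)) :
    γ ∈ Set.Icc x y := by
  obtain ⟨-, hann, -, hx, hy, hk, hupper, hne, hlower⟩ := h
  exact ⟨hγ.le_of_mul_genNumerator_le (hK.aeval_seqShift_eq_zero hann) hx hne hlower,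
    le_of_pow_le_pow_left₀ hk.ne' hy.le ((hγ.pow_le k).trans hupper)⟩

theorem IsRootCert.strictMonoOn {x y : ℝ} (h : IsRootCert q P m N k u C K x y) :
    StrictMonoOn (fun z => aeval z (polyOfCode q)) (Set.Icc x y) := by
  obtain ⟨-, -, hderiv, hx, -⟩ := h
  rw [← posPoly_sub_negPoly]
  exact strictMonoOn_aeval_sub (coeff_posPoly_nonneg q) (coeff_negPoly_nonneg q) hx.le hderiv

theorem IsRootCert.polyOfCode_ne_zero {x y : ℝ} (h : IsRootCert q P m N k u C K x y) (hxy : x ≤ y) :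
    polyOfCode q ≠ 0 := by
  obtain ⟨-, -, hderiv, hx, -⟩ := h
  rw [← posPoly_sub_negPoly, sub_ne_zero]
  intro hq
  rw [← hq] at hderiv
  exact hderiv.not_ge
    (aeval_mono_of_coeff_nonneg (coeff_derivative_nonneg (coeff_posPoly_nonneg q)) hx.le hxy)

theorem IsRootCert.describes {γ : ℝ} {a b : ℕ × ℕ}
    (h : IsRootCert q P m N k u C K (ratOfCode a : ℝ) (ratOfCode b))
    (hγ : IsGrowthRate C (fun n => (u n : ℝ)) γ) (hK : IsRecurrent K fun n => (u n : ℝ)) :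
    AlgCode.Describes (q, a, b) γ := by
  have hroot := h.aeval_eq_zero hγ hK
  have hmem := h.mem_Icc hγ hK
  refine ⟨h.polyOfCode_ne_zero (hmem.1.trans hmem.2), Set.eq_singleton_iff_unique_mem.mpr
    ⟨⟨hmem.1, hmem.2, hroot⟩, fun z ⟨hxz, hzy, hz⟩ => ?_⟩⟩
  exact h.strictMonoOn.injOn ⟨hxz, hzy⟩ hmem (hz.trans hroot.symm)

theorem IsGrowthRate.exists_simple_root {γ : ℝ} {C : ℝ}
    (hγ : IsGrowthRate C (fun n => (u n : ℝ)) γ) {p : ℚ[X]} (hp0 : p ≠ 0)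
    (hp : aeval (seqShift ℝ) p (fun n => (u n : ℝ)) = 0) :
    ∃ (q : ℤ[X]) (m : ℕ), aeval γ q = 0 ∧ 0 < aeval γ q.derivative ∧
      aeval (seqShift ℝ) (q ^ m) (fun n => (u n : ℝ)) = 0 := by
  obtain ⟨q, m, hsep, s, hs⟩ := exists_separable_map_dvd_pow (A := ℤ) hp0
  have hann : aeval (seqShift ℝ) (q ^ m) (fun n => (u n : ℝ)) = 0 := by
    rw [← aeval_map_algebraMap ℚ, Polynomial.map_pow, hs, mul_comm, map_mul, Module.End.mul_apply,
      hp, map_zero]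
  have hroot : aeval γ q = 0 :=
    eq_zero_of_pow_eq_zero (n := m) (by rw [← map_pow]; exact hγ.aeval_eq_zero hann)
  have hderiv : aeval γ q.derivative ≠ 0 := by
    rw [← aeval_map_algebraMap ℚ, ← derivative_map]
    exact hsep.aeval_derivative_ne_zero (by rwa [aeval_map_algebraMap])
  rcases hderiv.lt_or_gt with hneg | hpos
  · refine ⟨-q, m, by rw [map_neg, hroot, neg_zero], ?_, ?_⟩
    · rwa [derivative_neg, map_neg, neg_pos]
    · rw [neg_pow, map_mul, Module.End.mul_apply, hann, map_zero]
  · exact ⟨q, m, hroot, hpos, hann⟩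

theorem exists_Ioo_ratOfCode {γ : ℝ} (hγ : 0 < γ) {f g : ℝ → ℝ} (hf : Continuous f)
    (hg : Continuous g) (hgf : g γ < f γ) :
    ∃ a b, γ ∈ Set.Ioo (ratOfCode a : ℝ) (ratOfCode b) ∧ 0 < (ratOfCode a : ℝ) ∧
      g (ratOfCode b) < f (ratOfCode a) := by
  obtain ⟨c, hgc, hcf⟩ := exists_between hgf
  obtain ⟨x, ⟨hx0, hxγ⟩, hx⟩ := (mem_nhdsLT_iff_exists_mem_Ico_Ioo_subset hγ).mp
    (nhdsWithin_le_nhds (hf.continuousAt.eventually_const_lt hcf))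
  obtain ⟨y, hyγ, hy⟩ := mem_nhdsGT_iff_exists_Ioo_subset.mp
    (nhdsWithin_le_nhds (hg.continuousAt.eventually_lt_const hgc))
  obtain ⟨a, ha⟩ := exists_ratOfCode_mem_Ioo hx0 hxγ
  obtain ⟨b, hb⟩ := exists_ratOfCode_mem_Ioo hγ.le hyγ
  exact ⟨a, b, ⟨ha.2, hb.1⟩, hx0.trans_lt ha.1, (hy hb).trans (hx ha)⟩

theorem IsGrowthRate.exists_index_le_pow {C γ y : ℝ} {U : ℕ → ℝ} (hγ : IsGrowthRate C U γ)
    (hy : γ < y) : ∃ k, 0 < k ∧ C * U k ≤ y ^ k := by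
  have hy0 : 0 < y := hγ.pos.trans hy
  have hlim := (hγ.hasSum hy).summable.tendsto_atTop_zero.const_mul C
  rw [mul_zero] at hlim
  obtain ⟨k, hk, hk0⟩ := ((hlim.eventually_lt_const one_pos).and
    (Filter.eventually_gt_atTop 0)).exists
  refine ⟨k, hk0, ?_⟩
  rw [← mul_assoc, inv_pow, ← div_eq_mul_inv, div_lt_one (by positivity)] at hk
  exact hk.le

theorem IsGrowthRate.exists_isRootCert {γ : ℝ} (hγ : IsGrowthRate C (fun n => (u n : ℝ)) γ)
    {p : ℚ[X]} (hp0 : p ≠ 0) (hp : aeval (seqShift ℝ) p (fun n => (u n : ℝ)) = 0) (K : ℕ) :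
    ∃ q P a b m N k, IsRootCert q P m N k u C K (ratOfCode a : ℝ) (ratOfCode b) := by
  obtain ⟨q', m, hroot, hderiv, hann⟩ := hγ.exists_simple_root hp0 hp
  obtain ⟨q, rfl⟩ := exists_polyOfCode_eq q'
  obtain ⟨P, hP⟩ := exists_polyOfCode_eq (polyOfCode q ^ m)
  rw [← hP] at hann
  rw [← posPoly_sub_negPoly, derivative_sub, map_sub, sub_pos] at hderiv
  obtain ⟨a, b, hab, ha, hlt⟩ := exists_Ioo_ratOfCode hγ.pos
    (posPoly q).derivative.continuous_aeval (negPoly q).derivative.continuous_aeval hderiv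
  have hmono := strictMonoOn_aeval_sub (coeff_posPoly_nonneg q) (coeff_negPoly_nonneg q) ha.le hlt
  rw [posPoly_sub_negPoly] at hmono
  have hneg := hmono ⟨le_rfl, (hab.1.trans hab.2).le⟩ (Set.Ioo_subset_Icc_self hab) hab.1
  have hne : aeval (ratOfCode a : ℝ) (polyOfCode P) ≠ 0 := by
    rw [hP, map_pow]
    exact pow_ne_zero m (hneg.trans_eq hroot).ne
  obtain ⟨k, hk, hupper⟩ := hγ.exists_index_le_pow hab.2
  obtain ⟨N, hlower⟩ := hγ.exists_mul_genNumerator_le (P := polyOfCode P) ha hab.1.le hne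
  exact ⟨q, P, a, b, m, N, k, hP, fun n _ => congrFun hann n, hlt, ha, hγ.pos.trans hab.2, hk,
    hupper, hne, hlower⟩

end Certificates

section PrimitiveRecursion

open Polynomial Primrec

variable {α β : Type*} [Primcodable α] [Primcodable β]

theorem primrec₂_nat_pow : Primrec₂ ((· ^ ·) : ℕ → ℕ → ℕ) :=
  Primrec₂.unpaired'.mp Nat.Primrec.pow

/-- The rational number `(p - n) / (d + 1)` coded by the triple `(p, n, d)`. -/
def ratOfTriple (x : ℕ × ℕ × ℕ) : ℚ := ((x.1 : ℚ) - x.2.1) / (x.2.2 + 1)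

/-- The rational-valued function `f` is primitive recursive, in the sense that a primitive recursive
function computes triples that code its values. -/
def PrimrecRat (f : α → ℚ) : Prop :=
  ∃ g : α → ℕ × ℕ × ℕ, Primrec g ∧ ∀ x, ratOfTriple (g x) = f x

theorem exists_primrec₂_ratOfTriple_add : ∃ s : ℕ × ℕ × ℕ → ℕ × ℕ × ℕ → ℕ × ℕ × ℕ, Primrec₂ s ∧
    ∀ x y, ratOfTriple (s x y) = ratOfTriple x + ratOfTriple y := by
  refine ⟨fun x y => (x.1 * (y.2.2 + 1) + y.1 * (x.2.2 + 1),
    x.2.1 * (y.2.2 + 1) + y.2.1 * (x.2.2 + 1), x.2.2 * y.2.2 + x.2.2 + y.2.2), ?_, fun x y => ?_⟩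
  · have hp : Primrec fun z : (ℕ × ℕ × ℕ) × (ℕ × ℕ × ℕ) => z.1.2.2 := snd.comp (snd.comp fst)
    have hq : Primrec fun z : (ℕ × ℕ × ℕ) × (ℕ × ℕ × ℕ) => z.2.2.2 := snd.comp (snd.comp snd)
    refine Primrec.pair (nat_add.comp (nat_mul.comp (fst.comp fst) (succ.comp hq))
      (nat_mul.comp (fst.comp snd) (succ.comp hp))) (Primrec.pair ?_
        (nat_add.comp (nat_add.comp (nat_mul.comp hp hq) hp) hq))
    exact nat_add.comp (nat_mul.comp (fst.comp (snd.comp fst)) (succ.comp hq))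
      (nat_mul.comp (fst.comp (snd.comp snd)) (succ.comp hp))
  · have hden : (x.2.2 * y.2.2 + x.2.2 + y.2.2 + 1 : ℚ) = (x.2.2 + 1) * (y.2.2 + 1) := by ring
    simp only [ratOfTriple]
    push_cast
    rw [hden]
    field_simp
    ring

theorem exists_primrec₂_ratOfTriple_mul : ∃ s : ℕ × ℕ × ℕ → ℕ × ℕ × ℕ → ℕ × ℕ × ℕ, Primrec₂ s ∧
    ∀ x y, ratOfTriple (s x y) = ratOfTriple x * ratOfTriple y := by
  refine ⟨fun x y => (x.1 * y.1 + x.2.1 * y.2.1, x.1 * y.2.1 + x.2.1 * y.1,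
    x.2.2 * y.2.2 + x.2.2 + y.2.2), ?_, fun x y => ?_⟩
  · have hp : Primrec fun z : (ℕ × ℕ × ℕ) × (ℕ × ℕ × ℕ) => z.1.2 := snd.comp fst
    have hq : Primrec fun z : (ℕ × ℕ × ℕ) × (ℕ × ℕ × ℕ) => z.2.2 := snd.comp snd
    refine Primrec.pair (nat_add.comp (nat_mul.comp (fst.comp fst) (fst.comp snd))
      (nat_mul.comp (fst.comp hp) (fst.comp hq))) (Primrec.pair ?_ (nat_add.comp (nat_add.comp
        (nat_mul.comp (snd.comp hp) (snd.comp hq)) (snd.comp hp)) (snd.comp hq)))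
    exact nat_add.comp (nat_mul.comp (fst.comp fst) (fst.comp hq))
      (nat_mul.comp (fst.comp hp) (fst.comp snd))
  · have hden : (x.2.2 * y.2.2 + x.2.2 + y.2.2 + 1 : ℚ) = (x.2.2 + 1) * (y.2.2 + 1) := by ring
    simp only [ratOfTriple]
    push_cast
    rw [hden]
    field_simp
    ring

namespace PrimrecRat

variable {f g : α → ℚ} {n : α → ℕ}

theorem of_eq (hf : PrimrecRat f) (h : ∀ x, f x = g x) : PrimrecRat g :=
  funext h ▸ hf

theorem comp (hf : PrimrecRat f) {h : β → α} (hh : Primrec h) : PrimrecRat fun y => f (h y) := by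
  obtain ⟨s, hs, hsf⟩ := hf
  exact ⟨fun y => s (h y), hs.comp hh, fun y => hsf _⟩

theorem natCast (hn : Primrec n) : PrimrecRat fun x => (n x : ℚ) :=
  ⟨fun x => (n x, 0, 0), hn.pair (const (0, 0)), fun x => by simp [ratOfTriple]⟩

theorem ratCast_ratOfCode {a : α → ℕ × ℕ} (ha : Primrec a) :
    PrimrecRat fun x => (ratOfCode (a x) : ℚ) :=
  ⟨fun x => ((a x).1, 0, (a x).2), (fst.comp ha).pair ((const 0).pair (snd.comp ha)),
    fun x => by simp [ratOfTriple, ratOfCode]⟩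

theorem neg (hf : PrimrecRat f) : PrimrecRat fun x => -f x := by
  obtain ⟨s, hs, hsf⟩ := hf
  refine ⟨fun x => ((s x).2.1, (s x).1, (s x).2.2), (fst.comp (snd.comp hs)).pair
    ((fst.comp hs).pair (snd.comp (snd.comp hs))), fun x => ?_⟩
  simp only [← hsf, ratOfTriple, ← neg_div, neg_sub]

theorem add (hf : PrimrecRat f) (hg : PrimrecRat g) : PrimrecRat fun x => f x + g x := by
  obtain ⟨s, hs, hsf⟩ := hf
  obtain ⟨t, ht, htg⟩ := hg
  obtain ⟨a, ha, hadd⟩ := exists_primrec₂_ratOfTriple_add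
  exact ⟨fun x => a (s x) (t x), ha.comp hs ht, fun x => by rw [hadd, hsf, htg]⟩

theorem sub (hf : PrimrecRat f) (hg : PrimrecRat g) : PrimrecRat fun x => f x - g x :=
  (hf.add hg.neg).of_eq fun _ => (sub_eq_add_neg _ _).symm

theorem mul (hf : PrimrecRat f) (hg : PrimrecRat g) : PrimrecRat fun x => f x * g x := by
  obtain ⟨s, hs, hsf⟩ := hf
  obtain ⟨t, ht, htg⟩ := hg
  obtain ⟨a, ha, hmul⟩ := exists_primrec₂_ratOfTriple_mul
  exact ⟨fun x => a (s x) (t x), ha.comp hs ht, fun x => by rw [hmul, hsf, htg]⟩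

theorem sum_range (hn : Primrec n) {f : α × ℕ → ℚ} (hf : PrimrecRat f) :
    PrimrecRat fun x => ∑ i ∈ Finset.range (n x), f (x, i) := by
  obtain ⟨s, hs, hsf⟩ := hf
  obtain ⟨a, ha, hadd⟩ := exists_primrec₂_ratOfTriple_add
  refine ⟨fun x => Nat.rec (0, 0, 0) (fun i r => a r (s (x, i))) (n x), nat_rec' hn (const _)
    (ha.comp (snd.comp snd) (hs.comp (fst.pair (fst.comp snd)))).to₂, fun x => ?_⟩
  beta_reduce
  induction n x with
  | zero => simp [ratOfTriple]
  | succ k ih => rw [Finset.sum_range_succ, ← ih, ← hsf (x, k), ← hadd]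

theorem pow (hf : PrimrecRat f) (hn : Primrec n) : PrimrecRat fun x => f x ^ n x := by
  obtain ⟨s, hs, hsf⟩ := hf
  obtain ⟨a, ha, hmul⟩ := exists_primrec₂_ratOfTriple_mul
  refine ⟨fun x => Nat.rec (1, 0, 0) (fun _ r => a r (s x)) (n x), nat_rec' hn (const _)
    (ha.comp (snd.comp snd) (hs.comp fst)).to₂, fun x => ?_⟩
  beta_reduce
  induction n x with
  | zero => simp [ratOfTriple]
  | succ k ih => rw [pow_succ, ← ih, ← hsf x, ← hmul]

theorem le (hf : PrimrecRat f) (hg : PrimrecRat g) : PrimrecPred fun x => f x ≤ g x := by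
  obtain ⟨s, hs, hsfg⟩ := hg.sub hf
  refine (nat_le.comp (fst.comp (snd.comp hs)) (fst.comp hs)).of_eq fun x => ?_
  have hden : (0 : ℚ) < (s x).2.2 + 1 := by positivity
  have hdiff : ratOfTriple (s x) = g x - f x := hsfg x
  rw [← sub_nonneg (a := g x), ← hdiff, ratOfTriple, le_div_iff₀ hden, zero_mul, sub_nonneg,
    Nat.cast_le]

theorem lt (hf : PrimrecRat f) (hg : PrimrecRat g) : PrimrecPred fun x => f x < g x :=
  (hg.le hf).not.of_eq fun _ => not_le

theorem eq (hf : PrimrecRat f) (hg : PrimrecRat g) : PrimrecPred fun x => f x = g x :=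
  ((hf.le hg).and (hg.le hf)).of_eq fun _ => le_antisymm_iff.symm

theorem polyOfCode_sum {q : α → List (ℕ × ℕ)} (hq : Primrec q) {f : α × ℕ → ℚ}
    (hf : PrimrecRat f) : PrimrecRat fun x => (polyOfCode (q x)).sum fun i a => a * f (x, i) := by
  have hcoeff : Primrec fun y : α × ℕ => (q y.1).getD y.2 (0, 0) :=
    (list_getD (0, 0)).comp (hq.comp fst) snd
  refine (sum_range (list_length.comp hq) (((natCast (fst.comp hcoeff)).sub
    (natCast (snd.comp hcoeff))).mul hf)).of_eq fun x => ?_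
  rw [sum_polyOfCode _ (by simp)]
  push_cast
  rfl

theorem aeval_polyOfCode {q : α → List (ℕ × ℕ)} (hq : Primrec q) (hf : PrimrecRat f) :
    PrimrecRat fun x => aeval (f x) (polyOfCode (q x)) :=
  (polyOfCode_sum hq ((hf.comp fst).pow snd)).of_eq fun x => by
    rw [aeval_def, eval₂_eq_sum]
    rfl

theorem aeval_derivative_polyOfCode {q : α → List (ℕ × ℕ)} (hq : Primrec q) (hf : PrimrecRat f) :
    PrimrecRat fun x => aeval (f x) (derivative (polyOfCode (q x))) :=
  (polyOfCode_sum hq ((natCast snd).mul ((hf.comp fst).pow (pred.comp snd)))).of_eq fun x => by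
    simp [derivative_apply, Polynomial.sum, mul_assoc]

theorem aeval_seqShift_polyOfCode {q : α → List (ℕ × ℕ)} (hq : Primrec q) {u : α → ℕ → ℕ}
    (hu : Primrec₂ u) (hn : Primrec n) : PrimrecRat fun x =>
      aeval (seqShift ℚ) (polyOfCode (q x)) (fun i => (u x i : ℚ)) (n x) :=
  (polyOfCode_sum hq (natCast (hu.comp fst (nat_add.comp (hn.comp fst) snd)))).of_eq fun x => by
    simp only [aeval_seqShift_apply, zsmul_eq_mul]

theorem partialSum_natCast {u : α → ℕ → ℕ} (hu : Primrec₂ u) (hn : Primrec n) (hf : PrimrecRat f) :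
    PrimrecRat fun x => partialSum (fun i => (u x i : ℚ)) (n x) (f x) :=
  sum_range hn ((natCast hu).mul ((hf.comp fst).pow (nat_sub.comp (hn.comp fst) snd)))

theorem genNumerator_polyOfCode {q : α → List (ℕ × ℕ)} (hq : Primrec q) {u : α → ℕ → ℕ}
    (hu : Primrec₂ u) (hf : PrimrecRat f) :
    PrimrecRat fun x => genNumerator (polyOfCode (q x)) (fun i => (u x i : ℚ)) (f x) :=
  (polyOfCode_sum hq (partialSum_natCast (hu.comp (fst.comp fst) snd).to₂ snd
    (hf.comp fst))).of_eq fun x => by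
    simp only [genNumerator, zsmul_eq_mul]

end PrimrecRat

theorem eq_of_forall_aeval_natCast_eq {p q : ℤ[X]} {n : ℕ} (hp : p.natDegree < n)
    (hq : q.natDegree < n) (h : ∀ j < n, aeval (j : ℚ) p = aeval (j : ℚ) q) : p = q := by
  refine eq_of_natDegree_lt_card_of_eval_eq (f := fun j : Fin n => ((j : ℕ) : ℤ)) p q
    (Nat.cast_injective.comp Fin.val_injective) (fun j => ?_) ?_
  · have hj := h j j.2
    rw [← Int.cast_natCast, ← eq_intCast (algebraMap ℤ ℚ), aeval_algebraMap_apply,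
      aeval_algebraMap_apply] at hj
    simpa using hj
  · rw [Fintype.card_fin]
    exact max_lt hp hq

theorem polyOfCode_eq_pow_iff {P q : List (ℕ × ℕ)} {m : ℕ} :
    polyOfCode P = polyOfCode q ^ m ↔ ∀ j < P.length + m * q.length + 1,
      aeval (j : ℚ) (polyOfCode P) = aeval (j : ℚ) (polyOfCode q) ^ m := by
  refine ⟨fun h j _ => by rw [h, map_pow], fun h => eq_of_forall_aeval_natCast_eq
    (n := P.length + m * q.length + 1) ?_ ?_ fun j hj => (h j hj).trans (map_pow _ _ _).symm⟩
  · have hP := natDegree_polyOfCode_le P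
    omega
  · have hq := natDegree_pow_le_of_le m (natDegree_polyOfCode_le q)
    omega

theorem primrecPred_forall_lt {R : ℕ → α → Prop} {n : α → ℕ} (hn : Primrec n)
    (hR : PrimrecRel R) : PrimrecPred fun z => ∀ j < n z, R j z :=
  (hR.forall_mem_list.comp (list_range.comp hn) .id).of_eq fun z => by
    simp only [List.mem_range, id_eq]

theorem primrecPred_polyOfCode_eq_pow {P q : α → List (ℕ × ℕ)} {m : α → ℕ} (hP : Primrec P)
    (hq : Primrec q) (hm : Primrec m) :
    PrimrecPred fun z => polyOfCode (P z) = polyOfCode (q z) ^ m z := by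
  have heval : PrimrecRel fun (j : ℕ) (z : α) =>
      aeval (j : ℚ) (polyOfCode (P z)) = aeval (j : ℚ) (polyOfCode (q z)) ^ m z :=
    (PrimrecRat.aeval_polyOfCode (hP.comp snd) (.natCast fst)).eq
      ((PrimrecRat.aeval_polyOfCode (hq.comp snd) (.natCast fst)).pow (hm.comp snd))
  have hbound : Primrec fun z => (P z).length + m z * (q z).length + 1 :=
    succ.comp (nat_add.comp (list_length.comp hP) (nat_mul.comp hm (list_length.comp hq)))
  have hall : PrimrecPred fun z => ∀ j < (P z).length + m z * (q z).length + 1,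
      aeval (j : ℚ) (polyOfCode (P z)) = aeval (j : ℚ) (polyOfCode (q z)) ^ m z :=
    primrecPred_forall_lt hbound heval
  exact hall.of_eq fun z => polyOfCode_eq_pow_iff.symm

theorem primrecPred_isRootCert {q P : α → List (ℕ × ℕ)} {m N k C K : α → ℕ} {u : α → ℕ → ℕ}
    {x y : α → ℚ} (hq : Primrec q) (hP : Primrec P) (hm : Primrec m) (hN : Primrec N)
    (hk : Primrec k) (hu : Primrec₂ u) (hC : Primrec C) (hK : Primrec K) (hx : PrimrecRat x)
    (hy : PrimrecRat y) : PrimrecPred fun z =>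
      IsRootCert (q z) (P z) (m z) (N z) (k z) (u z) (C z) (K z) (x z) (y z) := by
  have hzero : PrimrecRat fun _ : α => (0 : ℚ) :=
    (PrimrecRat.natCast (const 0)).of_eq fun _ => Nat.cast_zero
  have hPx := PrimrecRat.aeval_polyOfCode hP hx
  have hann : PrimrecRel fun (n : ℕ) (z : α) =>
      aeval (seqShift ℚ) (polyOfCode (P z)) (fun i => (u z i : ℚ)) n = 0 :=
    (PrimrecRat.aeval_seqShift_polyOfCode (hP.comp snd)
      (hu.comp (snd.comp fst) snd).to₂ fst).eq (hzero.comp snd)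
  have hrec : PrimrecPred fun z =>
      ∀ n < K z, aeval (seqShift ℚ) (polyOfCode (P z)) (fun i => (u z i : ℚ)) n = 0 :=
    primrecPred_forall_lt hK hann
  have hneg : PrimrecRat fun z => aeval (y z) (derivative (negPoly (q z))) :=
    .aeval_derivative_polyOfCode (list_map hq ((snd.comp snd).pair (const 0)).to₂) hy
  have hpos : PrimrecRat fun z => aeval (x z) (derivative (posPoly (q z))) :=
    .aeval_derivative_polyOfCode (list_map hq ((fst.comp snd).pair (const 0)).to₂) hx
  have hupper := ((PrimrecRat.natCast hC).mul (.natCast (hu.comp .id hk))).le (hy.pow hk)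
  have hlower := ((hPx.mul (.genNumerator_polyOfCode hP hu hx)).mul (hx.pow hN)).le
    ((hPx.pow (const 2)).mul (.partialSum_natCast hu hN hx))
  exact (primrecPred_polyOfCode_eq_pow hP hq hm).and (hrec.and
    ((hneg.lt hpos).and ((hzero.lt hx).and ((hzero.lt hy).and ((nat_lt.comp (const 0) hk).and
      (hupper.and ((hPx.eq hzero).not.and hlower)))))))

end PrimitiveRecursion

section RunEnumeration

variable {Q A : Type*}

theorem EventRun.fst_mem_of_mem {Δ : Set (Q × ℕ × A × Q)} {B : Set A} {q : Q} {m : ℕ}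
    {E : Set (A × ℕ)} (h : EventRun Δ q m E) (hB : ∀ t ∈ Δ, t.2.2.1 ∈ B) :
    ∀ x ∈ E, x.1 ∈ B := by
  induction h with
  | nil => simp
  | cons ht _ ih =>
    rintro _ ⟨y, rfl | hy, rfl⟩
    · exact hB _ ht
    · exact ih y hy

theorem list_toFinset_map {α β : Type*} [DecidableEq α] [DecidableEq β] (f : α → β)
    (l : List α) : (l.map f).toFinset = l.toFinset.image f := by
  ext
  simp

theorem iterate_subset_iterate_card {α : Type*} {f : Finset α → Finset α} (hf : ∀ X, X ⊆ f X)
    {X B : Finset α} (hB : ∀ j, f^[j] X ⊆ B) (j : ℕ) : f^[j] X ⊆ f^[B.card] X := by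
  have hmono : Monotone fun j => f^[j] X := monotone_nat_of_le_succ fun j => by
    rw [Function.iterate_succ_apply']
    exact hf _
  have heq {i j : ℕ} (hij : i ≤ j) (h : (f^[i] X).card = (f^[j] X).card) : f^[i] X = f^[j] X :=
    Finset.eq_of_subset_of_card_le (hmono hij) h.ge
  rcases le_total j B.card with hj | hj
  · exact hmono hj
  · refine (heq hj ?_).ge
    refine (Nat.stabilises_of_monotone (f := fun i => (f^[i] X).card)
      (fun _ _ hij => Finset.card_le_card (hmono hij)) (fun i => Finset.card_le_card (hB i))
      (fun i hi => ?_) hj).symm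
    have hfix := heq i.le_succ hi
    simp only [Function.iterate_succ_apply'] at hfix ⊢
    rw [← hfix, ← hfix]

variable [DecidableEq Q] [DecidableEq A]

/-- One round of the search for runs of duration at most `n`: prepend a transition of `Δ` to a run
in `X`. Runs are represented by origin, duration and events. -/
def extendRuns (Δ : Finset (Q × ℕ × A × Q)) (n : ℕ) (X : Finset (Q × ℕ × Finset (A × ℕ))) :
    Finset (Q × ℕ × Finset (A × ℕ)) :=
  X ∪ ((Δ ×ˢ X).filter fun p => p.1.2.2.2 = p.2.1 ∧ p.2.2.1 + p.1.2.1 ≤ n).image fun p =>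
    (p.1.1, p.2.2.1 + p.1.2.1, (insert (p.1.2.2.1, 0) p.2.2.2).image
      fun z => (z.1, z.2 + p.1.2.1))

/-- The empty runs at the states in `S`. -/
def emptyRuns (S : Finset Q) : Finset (Q × ℕ × Finset (A × ℕ)) :=
  S.image fun q => (q, 0, ∅)

variable {Δ : Finset (Q × ℕ × A × Q)} {S : Finset Q} {B : Finset A} {n : ℕ}

theorem mem_extendRuns {X : Finset (Q × ℕ × Finset (A × ℕ))} {y : Q × ℕ × Finset (A × ℕ)} :
    y ∈ extendRuns Δ n X ↔ y ∈ X ∨ ∃ q k a q' m F, (q, k, a, q') ∈ Δ ∧ (q', m, F) ∈ X ∧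
      m + k ≤ n ∧ (q, m + k, (insert (a, 0) F).image fun z => (z.1, z.2 + k)) = y := by
  simp only [extendRuns, Finset.mem_union, Finset.mem_image, Finset.mem_filter,
    Finset.mem_product]
  refine or_congr_right ⟨?_, ?_⟩
  · rintro ⟨⟨⟨q, k, a, q'⟩, p, m, F⟩, ⟨⟨ht, hX⟩, hq, hn⟩, rfl⟩
    obtain rfl : q' = p := hq
    exact ⟨q, k, a, q', m, F, ht, hX, hn, rfl⟩
  · rintro ⟨q, k, a, q', m, F, ht, hX, hn, rfl⟩
    exact ⟨((q, k, a, q'), q', m, F), ⟨⟨ht, hX⟩, rfl, hn⟩, rfl⟩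

theorem coe_image_insert (k : ℕ) (a : A) (F : Finset (A × ℕ)) :
    (((insert (a, 0) F).image fun z => (z.1, z.2 + k) : Finset (A × ℕ)) : Set (A × ℕ)) =
      shiftBy k (insert (a, 0) (F : Set (A × ℕ))) := by
  rw [Finset.coe_image, Finset.coe_insert, shiftBy]

theorem eventRun_of_mem_iterate_extendRuns {j m : ℕ} {q : Q} {F : Finset (A × ℕ)}
    (h : (q, m, F) ∈ (extendRuns Δ n)^[j] (emptyRuns S)) :
    m ≤ n ∧ EventRun (Δ : Set (Q × ℕ × A × Q)) q m F := by
  induction j generalizing q m F with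
  | zero =>
    simp only [Function.iterate_zero, id_eq, emptyRuns, Finset.mem_image, Prod.mk.injEq] at h
    obtain ⟨_, _, rfl, rfl, rfl⟩ := h
    simpa using EventRun.nil (Δ := (Δ : Set (Q × ℕ × A × Q))) _
  | succ j ih =>
    rw [Function.iterate_succ_apply'] at h
    rcases mem_extendRuns.mp h with h | ⟨p, k, a, p', l, F', ht, hX, hn, heq⟩
    · exact ih h
    · obtain ⟨rfl, rfl, rfl⟩ := Prod.mk.injEq .. ▸ heq
      rw [coe_image_insert]
      exact ⟨hn, .cons ht (ih hX).2⟩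

theorem EventRun.exists_mem_iterate_extendRuns (hΔ : ∀ t ∈ Δ, t.2.2.2 ∈ S) {q : Q} {m : ℕ}
    {E : Set (A × ℕ)} (h : EventRun (Δ : Set (Q × ℕ × A × Q)) q m E) (hm : m ≤ n) (hq : q ∈ S) :
    ∃ j, ∃ F : Finset (A × ℕ), (q, m, F) ∈ (extendRuns Δ n)^[j] (emptyRuns S) ∧ ↑F = E := by
  induction h with
  | nil q => exact ⟨0, ∅, Finset.mem_image_of_mem _ hq, Finset.coe_empty⟩
  | @cons q k a q' m E ht _ ih =>
    obtain ⟨j, F, hF, rfl⟩ := ih (by omega) (hΔ _ ht)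
    refine ⟨j + 1, _, ?_, coe_image_insert k a F⟩
    rw [Function.iterate_succ_apply']
    exact mem_extendRuns.mpr (.inr ⟨q, k, a, q', m, F, ht, hF, hm, rfl⟩)

theorem origin_mem_of_mem_iterate_extendRuns (hΔ : ∀ t ∈ Δ, t.1 ∈ S) {j : ℕ}
    {y : Q × ℕ × Finset (A × ℕ)} (h : y ∈ (extendRuns Δ n)^[j] (emptyRuns S)) : y.1 ∈ S := by
  induction j with
  | zero =>
    obtain ⟨q, hq, rfl⟩ := Finset.mem_image.mp h
    exact hq
  | succ j ih =>
    rw [Function.iterate_succ_apply'] at h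
    rcases mem_extendRuns.mp h with h | ⟨q, k, a, q', m, F, ht, -, -, rfl⟩
    · exact ih h
    · exact hΔ _ ht

/-- A number of rounds after which `extendRuns` has found all the runs of duration at most `n` in
a graph with `s` states and `b` letters. -/
def runBound (s b n : ℕ) : ℕ := s * ((n + 1) * 2 ^ (b * (n + 1)))

theorem iterate_extendRuns_subset (hS : ∀ t ∈ Δ, t.1 ∈ S) (hB : ∀ t ∈ Δ, t.2.2.1 ∈ B) (j : ℕ) :
    (extendRuns Δ n)^[j] (emptyRuns S) ⊆
      (extendRuns Δ n)^[runBound S.card B.card n] (emptyRuns S) := by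
  have hcard : (S ×ˢ Finset.range (n + 1) ×ˢ (B ×ˢ Finset.range (n + 1)).powerset).card =
      runBound S.card B.card n := by
    simp [runBound]
  rw [← hcard]
  refine iterate_subset_iterate_card (fun _ => Finset.subset_union_left) (fun i y hy => ?_) j
  obtain ⟨hn, hrun⟩ := eventRun_of_mem_iterate_extendRuns (q := y.1) (m := y.2.1) (F := y.2.2) hy
  refine Finset.mk_mem_product (origin_mem_of_mem_iterate_extendRuns hS hy)
    (Finset.mk_mem_product (Finset.mem_range_succ_iff.mpr hn)
      (Finset.mem_powerset.mpr fun x hx => ?_))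
  exact Finset.mk_mem_product (hrun.fst_mem_of_mem hB x hx)
    (Finset.mem_range_succ_iff.mpr ((hrun.le_of_mem x hx).trans hn))

theorem ncard_eventSets_eq_card_image (hS : ∀ t ∈ Δ, t.1 ∈ S ∧ t.2.2.2 ∈ S)
    (hB : ∀ t ∈ Δ, t.2.2.1 ∈ B) (hne : S.Nonempty) :
    (eventSets (Δ : Set (Q × ℕ × A × Q)) n).ncard = (((extendRuns Δ n)^[runBound S.card B.card n]
      (emptyRuns S)).image fun y => y.2.2).card := by
  suffices h : eventSets (Δ : Set (Q × ℕ × A × Q)) n =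
      (fun F : Finset (A × ℕ) => (F : Set (A × ℕ))) ''
      (((extendRuns Δ n)^[runBound S.card B.card n] (emptyRuns S)).image fun y => y.2.2) by
    rw [h, Set.ncard_image_of_injective _ Finset.coe_injective, Set.ncard_coe_finset]
  ext E
  simp only [Set.mem_image, Finset.mem_coe, Finset.mem_image]
  constructor
  · rintro ⟨m, hm, q, hE⟩
    obtain ⟨q, hq, hE⟩ : ∃ q ∈ S, EventRun (Δ : Set (Q × ℕ × A × Q)) q m E := by
      cases hE with
      | nil => exact ⟨_, hne.choose_spec, .nil _⟩
      | cons ht hE => exact ⟨_, (hS _ ht).1, .cons ht hE⟩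
    obtain ⟨j, F, hF, rfl⟩ := hE.exists_mem_iterate_extendRuns (fun t ht => (hS t ht).2) hm hq
    exact ⟨F, ⟨_, iterate_extendRuns_subset (fun t ht => (hS t ht).1) hB j hF, rfl⟩, rfl⟩
  · rintro ⟨_, ⟨y, hy, rfl⟩, rfl⟩
    obtain ⟨hn, hrun⟩ := eventRun_of_mem_iterate_extendRuns (q := y.1) hy
    exact ⟨_, hn, _, hrun⟩

end RunEnumeration

section RunLists

/-- `extendRuns` on lists, for graphs whose states and letters are natural numbers. -/
def runStep (Δ : List (ℕ × ℕ × ℕ × ℕ)) (n : ℕ) (L : List (ℕ × ℕ × List (ℕ × ℕ))) :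
    List (ℕ × ℕ × List (ℕ × ℕ)) :=
  L ++ Δ.flatMap fun t => L.filterMap fun x =>
    if t.2.2.2 = x.1 ∧ x.2.1 + t.2.1 ≤ n then
      some (t.1, x.2.1 + t.2.1, ((t.2.2.1, 0) :: x.2.2).map fun y => (y.1, y.2 + t.2.1))
    else none

/-- `emptyRuns` on lists. -/
def runStart (s : ℕ) : List (ℕ × ℕ × List (ℕ × ℕ)) :=
  (List.range s).map fun q => (q, 0, [])

/-- The finite set of runs represented by a list. -/
def runFinset (L : List (ℕ × ℕ × List (ℕ × ℕ))) : Finset (ℕ × ℕ × Finset (ℕ × ℕ)) :=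
  L.toFinset.image fun x => (x.1, x.2.1, x.2.2.toFinset)

/-- The number of distinct sets of elements among the given lists. -/
def distinctCount : List (List (ℕ × ℕ)) → ℕ
  | [] => 0
  | x :: l => if ∃ y ∈ l, (∀ z ∈ y, z ∈ x) ∧ ∀ z ∈ x, z ∈ y then distinctCount l
      else distinctCount l + 1

theorem distinctCount_eq_card (L : List (List (ℕ × ℕ))) :
    distinctCount L = (L.toFinset.image List.toFinset).card := by
  induction L with
  | nil => rfl
  | cons x l ih =>
    have hmem : (∃ y ∈ l, (∀ z ∈ y, z ∈ x) ∧ ∀ z ∈ x, z ∈ y) ↔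
        x.toFinset ∈ l.toFinset.image List.toFinset := by
      simp only [Finset.mem_image, List.mem_toFinset, Finset.ext_iff, iff_iff_implies_and_implies,
        forall_and]
    rw [distinctCount, List.toFinset_cons, Finset.image_insert]
    split_ifs with hx
    · rw [Finset.insert_eq_of_mem (hmem.mp hx), ih]
    · rw [Finset.card_insert_of_notMem (hmem.not.mp hx), ih]

theorem runFinset_runStart (s : ℕ) : runFinset (runStart s) = emptyRuns (Finset.range s) := by
  ext y
  simp [runFinset, runStart, emptyRuns]

theorem runFinset_runStep (Δ : List (ℕ × ℕ × ℕ × ℕ)) (n : ℕ)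
    (L : List (ℕ × ℕ × List (ℕ × ℕ))) :
    runFinset (runStep Δ n L) = extendRuns Δ.toFinset n (runFinset L) := by
  rw [runFinset, runStep, List.toFinset_append, Finset.image_union, extendRuns, runFinset]
  congr 1
  ext y
  simp only [Finset.mem_image, List.mem_toFinset, List.mem_flatMap, List.mem_filterMap,
    Finset.mem_filter, Finset.mem_product]
  constructor
  · rintro ⟨_, ⟨t, ht, x, hx, hxt⟩, rfl⟩
    split_ifs at hxt with hc
    obtain rfl := Option.some.inj hxt
    refine ⟨(t, x.1, x.2.1, x.2.2.toFinset), ⟨⟨ht, x, hx, rfl⟩, hc⟩, ?_⟩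
    simp [list_toFinset_map]
  · rintro ⟨⟨t, _⟩, ⟨⟨ht, x, hx, rfl⟩, hc⟩, rfl⟩
    refine ⟨_, ⟨t, ht, x, hx, if_pos hc⟩, ?_⟩
    simp [list_toFinset_map]

theorem runFinset_iterate_runStep (Δ : List (ℕ × ℕ × ℕ × ℕ)) (n j s : ℕ) :
    runFinset ((runStep Δ n)^[j] (runStart s)) =
      (extendRuns Δ.toFinset n)^[j] (emptyRuns (Finset.range s)) := by
  rw [← runFinset_runStart]
  exact Function.Semiconj.iterate_right (runFinset_runStep Δ n) j _

/-- The number of event sets up to date `n` in a graph with states `0, …, s - 1` and letters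
`0, …, b - 1`. -/
def eventCount (Δ : List (ℕ × ℕ × ℕ × ℕ)) (s b n : ℕ) : ℕ :=
  distinctCount (((runStep Δ n)^[runBound s b n] (runStart s)).map fun x => x.2.2)

theorem eventCount_eq_ncard {Δ : List (ℕ × ℕ × ℕ × ℕ)} {s b : ℕ} (hs : 0 < s)
    (hΔ : ∀ t ∈ Δ, t.1 < s ∧ t.2.2.1 < b ∧ t.2.2.2 < s) (n : ℕ) :
    eventCount Δ s b n = (eventSets {t | t ∈ Δ} n).ncard := by
  have hcount := ncard_eventSets_eq_card_image (Δ := Δ.toFinset) (S := Finset.range s)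
    (B := Finset.range b) (n := n) (by simpa using fun _ _ _ _ ht => ⟨(hΔ _ ht).1, (hΔ _ ht).2.2⟩)
    (by simpa using fun _ _ _ _ ht => (hΔ _ ht).2.1) (by simpa using hs.ne')
  rw [List.coe_toFinset, Finset.card_range, Finset.card_range, ← runFinset_iterate_runStep,
    runFinset, Finset.image_image] at hcount
  rw [hcount, eventCount, distinctCount_eq_card, list_toFinset_map, Finset.image_image]
  rfl

end RunLists

section RunPrimrec

open Primrec

theorem primrec_runStep : Primrec fun y : (List (ℕ × ℕ × ℕ × ℕ) × ℕ) ×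
    List (ℕ × ℕ × List (ℕ × ℕ)) => runStep y.1.1 y.1.2 y.2 := by
  have hextend : Primrec₂ fun (t : ℕ × ℕ × ℕ × ℕ) (x : ℕ × ℕ × List (ℕ × ℕ)) =>
      (t.1, x.2.1 + t.2.1, ((t.2.2.1, 0) :: x.2.2).map fun y => (y.1, y.2 + t.2.1)) := by
    have hk : Primrec fun y : (ℕ × ℕ × ℕ × ℕ) × (ℕ × ℕ × List (ℕ × ℕ)) => y.1.2.1 :=
      fst.comp (snd.comp fst)
    refine (fst.comp fst).pair ((nat_add.comp (fst.comp (snd.comp snd)) hk).pair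
      (list_map (list_cons.comp (.pair (fst.comp (snd.comp (snd.comp fst))) (const 0))
        (snd.comp (snd.comp snd))) ?_))
    exact ((fst.comp snd).pair (nat_add.comp (snd.comp snd) (hk.comp fst))).to₂
  refine list_append.comp snd (list_flatMap (fst.comp fst) (listFilterMap (snd.comp fst) ?_))
  refine .ite (.and ?_ ?_) (option_some.comp (hextend.comp (snd.comp fst) snd)) (const none)
  · exact Primrec.eq.comp (snd.comp (snd.comp (snd.comp (snd.comp fst)))) (fst.comp snd)
  · exact nat_le.comp (nat_add.comp (fst.comp (snd.comp snd))
      (fst.comp (snd.comp (snd.comp fst)))) (snd.comp (fst.comp (fst.comp fst)))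

theorem primrec_runStart : Primrec runStart :=
  list_map list_range (snd.pair (const (0, []))).to₂

theorem primrec_distinctCount : Primrec distinctCount := by
  have hmem : PrimrecRel fun (z : ℕ × ℕ) (y : List (ℕ × ℕ)) => z ∈ y :=
    (PrimrecRel.exists_mem_list (R := fun a b : ℕ × ℕ => a = b) Primrec.eq).swap.of_eq
      fun a b => by simp
  have hsub : PrimrecRel fun x y : List (ℕ × ℕ) => ∀ z ∈ x, z ∈ y := hmem.forall_mem_list
  have hsame : PrimrecRel fun y x : List (ℕ × ℕ) => (∀ z ∈ y, z ∈ x) ∧ ∀ z ∈ x, z ∈ y :=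
    PrimrecPred.and hsub hsub.swap
  have hrec : Primrec fun L : List (List (ℕ × ℕ)) =>
      List.rec (motive := fun _ => ℕ) 0 (fun x l c =>
        if ∃ y ∈ l, (∀ z ∈ y, z ∈ x) ∧ ∀ z ∈ x, z ∈ y then c else c + 1) L := by
    refine list_rec .id (const 0) (h := fun _ y => if ∃ z ∈ y.2.1, (∀ w ∈ z, w ∈ y.1) ∧
      ∀ w ∈ y.1, w ∈ z then y.2.2 else y.2.2 + 1) ?_
    exact .ite (hsame.exists_mem_list.comp (fst.comp (snd.comp snd)) (fst.comp snd))
      (snd.comp (snd.comp snd)) (succ.comp (snd.comp (snd.comp snd)))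
  refine hrec.of_eq fun L => ?_
  induction L with
  | nil => rfl
  | cons x l ih => rw [distinctCount, ← ih]

theorem primrec_eventCount {α : Type*} [Primcodable α] {Δ : α → List (ℕ × ℕ × ℕ × ℕ)}
    {s b n : α → ℕ} (hΔ : Primrec Δ) (hs : Primrec s) (hb : Primrec b) (hn : Primrec n) :
    Primrec fun x => eventCount (Δ x) (s x) (b x) (n x) := by
  have hbound : Primrec fun x => runBound (s x) (b x) (n x) :=
    nat_mul.comp hs (nat_mul.comp (succ.comp hn)
      (primrec₂_nat_pow.comp (const 2) (nat_mul.comp hb (succ.comp hn))))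
  have hruns : Primrec fun x => (runStep (Δ x) (n x))^[runBound (s x) (b x) (n x)]
      (runStart (s x)) :=
    nat_iterate hbound (primrec_runStart.comp hs)
      (primrec_runStep.comp (((hΔ.comp fst).pair (hn.comp fst)).pair snd)).to₂
  exact primrec_distinctCount.comp (list_map hruns (snd.comp (snd.comp snd)).to₂)

end RunPrimrec

section Relabel

variable {Q Q' A A' : Type*} {f : Q → Q'} {g : A → A'} {Δ : Set (Q × ℕ × A × Q)}

/-- Rename the states and the letter of a transition. -/
def relabelTrans (f : Q → Q') (g : A → A') (t : Q × ℕ × A × Q) : Q' × ℕ × A' × Q' :=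
  (f t.1, t.2.1, g t.2.2.1, f t.2.2.2)

theorem relabelTrans_injective (hf : f.Injective) (hg : g.Injective) :
    (relabelTrans f g).Injective :=
  hf.prodMap (Function.injective_id.prodMap (hg.prodMap hf))

theorem image_shiftBy_insert (g : A → A') (k : ℕ) (a : A) (E : Set (A × ℕ)) :
    Prod.map g id '' shiftBy k (insert (a, 0) E) =
      shiftBy k (insert (g a, 0) (Prod.map g id '' E)) := by
  simp only [shiftBy, Set.image_insert_eq, Set.image_image]
  rfl

theorem EventRun.relabel {q : Q} {n : ℕ} {E : Set (A × ℕ)} (h : EventRun Δ q n E) :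
    EventRun (relabelTrans f g '' Δ) (f q) n (Prod.map g id '' E) := by
  induction h with
  | nil q =>
    rw [Set.image_empty]
    exact .nil _
  | cons ht _ ih =>
    rw [image_shiftBy_insert]
    exact .cons ⟨_, ht, rfl⟩ ih

theorem EventRun.exists_of_relabel (hf : f.Injective) {q' : Q'} {n : ℕ} {E' : Set (A' × ℕ)}
    (h : EventRun (relabelTrans f g '' Δ) q' n E') :
    ∀ q, f q = q' → ∃ E, EventRun Δ q n E ∧ Prod.map g id '' E = E' := by
  induction h with
  | nil q' => exact fun q _ => ⟨∅, .nil q, Set.image_empty _⟩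
  | cons ht _ ih =>
    rintro q rfl
    obtain ⟨⟨p, k, a, p'⟩, ht, heq⟩ := ht
    simp only [relabelTrans, Prod.mk.injEq] at heq
    obtain ⟨hpq, rfl, rfl, hp'⟩ := heq
    obtain rfl := hf hpq
    obtain ⟨E, hE, rfl⟩ := ih p' hp'
    exact ⟨_, .cons ht hE, image_shiftBy_insert _ _ _ _⟩

theorem eventSets_relabel [Nonempty Q] (hf : f.Injective) (n : ℕ) :
    eventSets (relabelTrans f g '' Δ) n = (fun E => Prod.map g id '' E) '' eventSets Δ n := by
  ext E'
  constructor
  · rintro ⟨m, hm, q', h⟩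
    have horigin : E' = ∅ ∨ ∃ q, f q = q' := by
      cases h with
      | nil => exact .inl rfl
      | cons ht _ =>
        obtain ⟨t, -, heq⟩ := ht
        exact .inr ⟨t.1, congrArg Prod.fst heq⟩
    rcases horigin with rfl | ⟨q, rfl⟩
    · exact ⟨∅, ⟨0, n.zero_le, Classical.arbitrary Q, .nil _⟩, Set.image_empty _⟩
    · obtain ⟨E, hE, rfl⟩ := h.exists_of_relabel hf q rfl
      exact ⟨E, ⟨m, hm, q, hE⟩, rfl⟩
  · rintro ⟨E, ⟨m, hm, q, hE⟩, rfl⟩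
    exact ⟨m, hm, f q, hE.relabel⟩

theorem ncard_eventSets_relabel [Nonempty Q] (hf : f.Injective) (hg : g.Injective) (n : ℕ) :
    (eventSets (relabelTrans f g '' Δ) n).ncard = (eventSets Δ n).ncard := by
  rw [eventSets_relabel hf]
  exact Set.ncard_image_of_injective _ (hg.prodMap Function.injective_id).image_injective

end Relabel

theorem den_ratOfCode_dvd (p : ℕ × ℕ) : (ratOfCode p).den ∣ p.2 + 1 := by
  have hden := Rat.den_dvd (p.1 : ℤ) ((p.2 : ℤ) + 1)
  rw [Rat.divInt_eq_div] at hden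
  have hcoe : ((ratOfCode p : ℚ≥0) : ℚ) = ((p.1 : ℤ) : ℚ) / (((p.2 : ℤ) + 1 : ℤ) : ℚ) := by
    simp [ratOfCode]
  rw [← hcoe] at hden
  exact_mod_cast hden

theorem tickCount_ratOfCode (D : ℕ) (p : ℕ × ℕ) :
    tickCount D (ratOfCode p) = p.1 * D / (p.2 + 1) := by
  rw [tickCount, ratOfCode, div_mul_eq_mul_div, ← Nat.floor_div_eq_div (K := ℚ≥0)]
  push_cast
  rfl

namespace STGCode

/-- A common denominator of the delays of the coded graph. -/
def denom (c : STGCode) : ℕ := (c.2.2.map fun x => x.2.1.2 + 1).prod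

/-- The transitions of the coded graph, with delays counted in multiples of `1 / c.denom`. -/
def ticks (c : STGCode) : List (ℕ × ℕ × ℕ × ℕ) :=
  c.2.2.map fun x => (x.1, x.2.1.1 * c.denom / (x.2.1.2 + 1), x.2.2)

/-- The code describes a graph: it has a state and its transitions only mention existing states
and letters. -/
def IsValid (c : STGCode) : Prop :=
  0 < c.1 ∧ ∀ x ∈ c.2.2, x.1 < c.1 ∧ x.2.2.1 < c.2.1 ∧ x.2.2.2 < c.1

/-- The number of event sets of the coded graph up to date `n`, in time units: this samples the
count in ticks at the multiples of `c.denom`, hence does not depend on the denominator. -/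
def count (c : STGCode) (n : ℕ) : ℕ := eventCount c.ticks c.1 c.2.1 (c.denom * n)

/-- A bound on the order of a linear recurrence satisfied by `c.count`; the sum is an upper bound
for the delays in ticks. -/
def order (c : STGCode) : ℕ := 1 + 2 ^ c.1 * (c.ticks.map fun t => t.2.1).sum

section Primrec

open Primrec

theorem primrec_denom : Primrec denom := by
  refine (list_foldr (snd.comp snd) (const 1) (nat_mul.comp (succ.comp (snd.comp (fst.comp
    (snd.comp (fst.comp snd))))) (snd.comp snd)).to₂).of_eq fun c => ?_
  rw [denom, List.prod_eq_foldr, List.foldr_map]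

theorem primrec_ticks : Primrec ticks := by
  have hdelay : Primrec fun y : STGCode × (ℕ × (ℕ × ℕ) × ℕ × ℕ) => y.2.2.1 :=
    fst.comp (snd.comp snd)
  exact list_map (snd.comp snd) (Primrec.pair (fst.comp snd) (Primrec.pair
    (nat_div.comp (nat_mul.comp (fst.comp hdelay) (primrec_denom.comp fst))
      (succ.comp (snd.comp hdelay))) (snd.comp (snd.comp snd))))

theorem primrec_count : Primrec₂ count :=
  primrec_eventCount (primrec_ticks.comp fst) (fst.comp fst) (fst.comp (snd.comp fst))
    (nat_mul.comp (primrec_denom.comp fst) snd)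

theorem primrec_order : Primrec order := by
  refine (nat_add.comp (const 1) (nat_mul.comp (primrec₂_nat_pow.comp (const 2) fst)
    (list_foldr primrec_ticks (const 0) (nat_add.comp (fst.comp (snd.comp (fst.comp snd)))
      (snd.comp snd)).to₂))).of_eq fun c => ?_
  rw [order, List.sum_eq_foldr, List.foldr_map]

theorem primrecPred_isValid : PrimrecPred IsValid := by
  have hrange : PrimrecRel fun (x : ℕ × (ℕ × ℕ) × ℕ × ℕ) (c : STGCode) =>
      x.1 < c.1 ∧ x.2.2.1 < c.2.1 ∧ x.2.2.2 < c.1 := by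
    refine PrimrecPred.and ?_ (PrimrecPred.and ?_ ?_)
    · exact nat_lt.comp (fst.comp fst) (fst.comp snd)
    · exact nat_lt.comp (fst.comp (snd.comp (snd.comp fst))) (fst.comp (snd.comp snd))
    · exact nat_lt.comp (snd.comp (snd.comp (snd.comp fst))) (fst.comp snd)
  exact (nat_lt.comp (const 0) fst).and (hrange.forall_mem_list.comp (snd.comp snd) .id)

end Primrec

theorem denom_pos (c : STGCode) : 0 < c.denom :=
  List.prod_pos (List.forall_mem_map.mpr fun _ _ => Nat.succ_pos _)

theorem dvd_denom {c : STGCode} {x : ℕ × (ℕ × ℕ) × ℕ × ℕ} (hx : x ∈ c.2.2) :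
    x.2.1.2 + 1 ∣ c.denom :=
  List.dvd_prod (List.mem_map_of_mem hx)

theorem IsValid.exists_describes {c : STGCode} (h : c.IsValid) :
    ∃ G : STG (Fin c.1) (Fin c.2.1), c.Describes G := by
  classical
  let toTrans : {x // x ∈ c.2.2} → Fin c.1 × ℚ≥0 × Fin c.2.1 × Fin c.1 := fun x =>
    (⟨x.1.1, (h.2 x x.2).1⟩, ratOfCode x.1.2.1, ⟨x.1.2.2.1, (h.2 x x.2).2.1⟩,
      ⟨x.1.2.2.2, (h.2 x x.2).2.2⟩)
  refine ⟨⟨(c.2.2.attach.map toTrans).toFinset⟩, Equiv.refl _, Equiv.refl _, fun t ht => ?_,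
    fun x hx => ?_⟩
  · obtain ⟨x, -, rfl⟩ := List.mem_map.mp (List.mem_toFinset.mp ht)
    exact ⟨x.1, x.2, rfl, rfl, rfl, rfl⟩
  · exact ⟨toTrans ⟨x, hx⟩, List.mem_toFinset.mpr (List.mem_map_of_mem (List.mem_attach _ _)),
      rfl, rfl, rfl, rfl⟩

namespace Describes

variable {Q A : Type*} {G : STG Q A} {c : STGCode} {D : ℕ} {C γ : ℝ}

theorem isValid [Nonempty Q] (h : c.Describes G) : c.IsValid := by
  obtain ⟨eQ, eA, -, htrans⟩ := h
  refine ⟨(eQ (Classical.arbitrary Q)).pos, fun x hx => ?_⟩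
  obtain ⟨t, -, hp, -, ha, hq⟩ := htrans x hx
  rw [hp, ha, hq]
  exact ⟨(eQ _).2, (eA _).2, (eQ _).2⟩

theorem isDenom (h : c.Describes G) : G.IsDenom c.denom := by
  obtain ⟨eQ, eA, hcode, -⟩ := h
  refine ⟨c.denom_pos, fun t ht => STG.natCast_tickCount_of_den_dvd ?_⟩
  obtain ⟨x, hx, -, hd, -⟩ := hcode t ht
  rw [← hd]
  exact (den_ratOfCode_dvd x.2.1).trans (dvd_denom hx)

theorem exists_relabel (h : c.Describes G) :
    ∃ (f : Q → ℕ) (g : A → ℕ), f.Injective ∧ g.Injective ∧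
      {t | t ∈ c.ticks} = relabelTrans f g '' G.ticks c.denom := by
  obtain ⟨eQ, eA, hcode, htrans⟩ := h
  refine ⟨fun q => eQ q, fun a => eA a, Fin.val_injective.comp eQ.injective,
    Fin.val_injective.comp eA.injective, Set.Subset.antisymm ?_ ?_⟩
  · intro y hy
    obtain ⟨x, hx, rfl⟩ := List.mem_map.mp hy
    obtain ⟨t, ht, hp, hd, ha, hq⟩ := htrans x hx
    refine ⟨_, ⟨t, ht, rfl⟩, ?_⟩
    simp only [relabelTrans, ← hp, ← hd, ← ha, ← hq, tickCount_ratOfCode]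
  · rintro _ ⟨_, ⟨t, ht, rfl⟩, rfl⟩
    obtain ⟨x, hx, hp, hd, ha, hq⟩ := hcode t ht
    refine List.mem_map.mpr ⟨x, hx, ?_⟩
    simp only [relabelTrans, ← hp, ← hd, ← ha, ← hq, tickCount_ratOfCode]

theorem count_eq [Nonempty Q] (h : c.Describes G) (n : ℕ) :
    c.count n = (eventSets (G.ticks c.denom) (c.denom * n)).ncard := by
  have hrange : ∀ t ∈ c.ticks, t.1 < c.1 ∧ t.2.2.1 < c.2.1 ∧ t.2.2.2 < c.1 :=
    List.forall_mem_map.mpr h.isValid.2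
  obtain ⟨f, g, hf, hg, hticks⟩ := h.exists_relabel
  rw [count, eventCount_eq_ncard h.isValid.1 hrange, hticks, ncard_eventSets_relabel hf hg]

theorem ncard_ticks_le (h : c.Describes G) : (G.ticks c.denom).ncard ≤ c.2.2.length := by
  classical
  obtain ⟨f, g, hf, hg, hticks⟩ := h.exists_relabel
  rw [← Set.ncard_image_of_injective _ (relabelTrans_injective hf hg), ← hticks,
    ← List.coe_toFinset, Set.ncard_coe_finset]
  exact (List.toFinset_card_le _).trans (List.length_map _).le

theorem tickCount_le (h : c.Describes G) {t : Q × ℚ≥0 × A × Q} (ht : t ∈ G.trans) :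
    tickCount c.denom t.2.1 ≤ (c.ticks.map fun t => t.2.1).sum := by
  obtain ⟨f, g, -, -, hticks⟩ := h.exists_relabel
  have hmem : relabelTrans f g (t.1, tickCount c.denom t.2.1, t.2.2) ∈ {t | t ∈ c.ticks} :=
    hticks ▸ ⟨_, ⟨t, ht, rfl⟩, rfl⟩
  exact List.single_le_sum (fun _ _ => Nat.zero_le _) _
    (List.mem_map_of_mem (f := fun t => t.2.1) hmem)

theorem isRecurrent [Nonempty Q] (h : c.Describes G) {𝕜 : Type*} [Field 𝕜] :
    IsRecurrent c.order fun n => (c.count n : 𝕜) := by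
  obtain ⟨eQ, eA, -⟩ := id h
  have := Fintype.ofEquiv _ eQ.symm
  have := Finite.of_equiv _ eA.symm
  have hrec := (STG.isRecurrent_ncard_eventSets (𝕜 := 𝕜) h.isDenom
    fun t ht => h.tickCount_le ht).comp_mul c.denom
  rw [Fintype.card_congr eQ, Fintype.card_fin] at hrec
  simpa only [h.count_eq, order] using hrec

theorem isGrowthRate [Finite A] [Nonempty Q] (h : c.Describes G) (hG : G.IsDenom D)
    (hγ : IsGrowthRate C (fun n => ((eventSets (G.ticks D) n).ncard : ℝ)) γ) :
    IsGrowthRate ((1 + c.2.2.length : ℕ) : ℝ) (fun n => (c.count n : ℝ)) (γ ^ D) := by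
  obtain ⟨δ, hδ⟩ := exists_isGrowthRate_eventSets (G.finite_ticks c.denom)
  have hδ' := hδ.comp_mul c.denom_pos
  have hγ' := hγ.comp_mul hG.pos
  simp only [STG.ncard_eventSets_ticks_mul hG h.isDenom] at hγ'
  rw [hγ'.unique hδ']
  simp only [h.count_eq]
  refine hδ'.mono ?_
  push_cast
  gcongr
  exact h.ncard_ticks_le

end Describes

end STGCode

section Search

open Primrec

theorem exists_computable_choice {α β : Type*} [Primcodable α] [Primcodable β] {R : α → β → Prop}
    (hR : PrimrecRel R) (h : ∀ a, ∃ b, R a b) : ∃ F : α → β, Computable F ∧ ∀ a, R a (F a) := by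
  classical
  let test : α → ℕ → Option β := fun a n =>
    (Encodable.decode (α := β) n).bind fun b => if R a b then some b else none
  have htest : Primrec₂ test := by
    refine option_bind (Primrec.decode.comp snd) ?_
    exact Primrec.ite (hR.comp (fst.comp fst) snd)
      (option_some.comp snd) (const none)
  have hdom : ∀ a, (Nat.rfindOpt (test a)).Dom := by
    intro a
    obtain ⟨b, hb⟩ := h a
    exact Nat.rfindOpt_dom.mpr ⟨Encodable.encode b, b, by simp [test, hb]⟩
  refine ⟨fun a => (Nat.rfindOpt (test a)).get (hdom a), ?_, fun a => ?_⟩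
  · exact (Partrec.rfindOpt htest.to_comp).of_eq fun a => (Part.some_get (hdom a)).symm
  · obtain ⟨n, hn⟩ := Nat.rfindOpt_spec (Part.get_mem (hdom a))
    simp only [test, Option.mem_def, Option.bind_eq_some_iff] at hn
    obtain ⟨b, -, hb⟩ := hn
    split_ifs at hb with hab
    exact (congrArg (R a) (Option.some.inj hb)).mp hab

open Polynomial in
theorem IsRecurrent.exists_rat_annihilator {K : ℕ} {u : ℕ → ℕ}
    (h : IsRecurrent K fun n => (u n : ℚ)) :
    ∃ p : ℚ[X], p ≠ 0 ∧ aeval (seqShift ℝ) p (fun n => (u n : ℝ)) = 0 := by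
  obtain ⟨p, hp, -, hpu⟩ := h.exists_monic
  refine ⟨p, hp.ne_zero, funext fun n => ?_⟩
  have hreal := aeval_seqShift_algebraMap (T := ℝ) p (fun k => (u k : ℚ)) n
  simpa only [map_natCast, hpu, Pi.zero_apply, map_zero] using hreal

theorem STG.isAlgebraic_of_isGrowthRate {Q A : Type*} [Finite Q] [Finite A] {G : STG Q A} {D : ℕ}
    {C γ : ℝ} (hG : G.IsDenom D)
    (hγ : IsGrowthRate C (fun n => ((eventSets (G.ticks D) n).ncard : ℝ)) γ) :
    IsAlgebraic ℚ γ := by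
  cases nonempty_fintype Q
  obtain ⟨p, hp, hpU⟩ := (STG.isRecurrent_ncard_eventSets (𝕜 := ℚ) hG fun t ht =>
    Finset.single_le_sum (f := fun t : Q × ℚ≥0 × A × Q => tickCount D t.2.1)
      (fun _ _ => Nat.zero_le _) ht).exists_rat_annihilator
  exact ⟨p, hp, hγ.aeval_eq_zero hpU⟩

theorem STGCode.IsValid.exists_isRootCert {c : STGCode} (hc : c.IsValid) :
    ∃ q P a b m N k, IsRootCert q P m N k c.count (1 + c.2.2.length) c.order
      (ratOfCode a : ℚ) (ratOfCode b) := by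
  obtain ⟨G, hG⟩ := hc.exists_describes
  have : Nonempty (Fin c.1) := ⟨⟨0, hc.1⟩⟩
  obtain ⟨γ, hγ⟩ := exists_isGrowthRate_eventSets (G.finite_ticks c.denom)
  obtain ⟨p, hp, hpu⟩ := hG.isRecurrent.exists_rat_annihilator
  obtain ⟨q, P, a, b, m, N, k, hcert⟩ :=
    (hG.isGrowthRate hG.isDenom hγ).exists_isRootCert hp hpu c.order
  exact ⟨q, P, a, b, m, N, k, isRootCert_ratCast_iff.mp (by exact_mod_cast hcert)⟩

theorem exists_computable_algCode : ∃ F : STGCode → AlgCode, Computable F ∧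
    ∀ c : STGCode, c.IsValid → ∃ P m N k, IsRootCert (F c).1 P m N k c.count (1 + c.2.2.length)
      c.order (ratOfCode (F c).2.1 : ℚ) (ratOfCode (F c).2.2) := by
  let Cert (c : STGCode) (z : AlgCode × List (ℕ × ℕ) × ℕ × ℕ × ℕ) : Prop :=
    IsRootCert z.1.1 z.2.1 z.2.2.1 z.2.2.2.1 z.2.2.2.2 c.count (1 + c.2.2.length) c.order
      (ratOfCode z.1.2.1 : ℚ) (ratOfCode z.1.2.2)
  have hcert : PrimrecRel Cert := by
    have halg : Primrec fun y : STGCode × AlgCode × List (ℕ × ℕ) × ℕ × ℕ × ℕ => y.2.1 :=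
      fst.comp snd
    have hwit : Primrec fun y : STGCode × AlgCode × List (ℕ × ℕ) × ℕ × ℕ × ℕ => y.2.2.2 :=
      snd.comp (snd.comp snd)
    exact primrecPred_isRootCert (fst.comp halg) (fst.comp (snd.comp snd)) (fst.comp hwit)
      (fst.comp (snd.comp hwit)) (snd.comp (snd.comp hwit))
      (STGCode.primrec_count.comp (fst.comp fst) snd).to₂
      (nat_add.comp (const 1) (list_length.comp (snd.comp (snd.comp fst))))
      (STGCode.primrec_order.comp fst) (.ratCast_ratOfCode (fst.comp (snd.comp halg)))
      (.ratCast_ratOfCode (snd.comp (snd.comp halg)))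
  have hrel : PrimrecRel fun (c : STGCode) z => c.IsValid → Cert c z :=
    (((STGCode.primrecPred_isValid.comp fst).not).or hcert).of_eq
      fun _ => imp_iff_not_or.symm
  obtain ⟨F, hF, hFcert⟩ := exists_computable_choice hrel fun c => by
    by_cases hc : c.IsValid
    · obtain ⟨q, P, a, b, m, N, k, h⟩ := hc.exists_isRootCert
      exact ⟨((q, a, b), P, m, N, k), fun _ => h⟩
    · exact ⟨default, fun h => absurd h hc⟩
  exact ⟨fun c => (F c).1, Computable.fst.comp hF, fun c hc => ⟨_, _, _, _, hFcert c hc⟩⟩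

theorem exists_computable_describes : ∃ F : STGCode → AlgCode, Computable F ∧
    ∀ {Q A : Type*} [Finite A] [Nonempty Q] {G : STG Q A} {D : ℕ} {C γ : ℝ} {c : STGCode},
      G.IsDenom D → IsGrowthRate C (fun n => ((eventSets (G.ticks D) n).ncard : ℝ)) γ →
        c.Describes G → (F c).Describes (γ ^ D) := by
  obtain ⟨F, hF, hFcert⟩ := exists_computable_algCode
  refine ⟨F, hF, fun hG hγ hc => ?_⟩
  obtain ⟨P, m, N, k, hcert⟩ := hFcert _ hc.isValid
  have hreal := isRootCert_ratCast_iff.mpr hcert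
  exact IsRootCert.describes (by exact_mod_cast hreal) (hc.isGrowthRate hG hγ) hc.isRecurrent

end Search

/-- One computable function `F` serves all simply-timed graphs. -/
theorem mainTheorem3 :
    ∃ F : STGCode → AlgCode, Computable F ∧
      ∀ (Q : Type*) (A : Type*) [Fintype Q] [Fintype A] (G : STG Q A), G.language.Nonempty →
        ∃ β : ℝ,
          -- the growth rate exists and is finite
          G.HasGrowthRate β ∧
          -- it coincides with both bandwidths for small precisions
          (∃ ε₀ : NNReal, 0 < ε₀ ∧ ∀ ε : NNReal, 0 < ε → ε < ε₀ →
            TimedWord.capacitiveBandwidth ε G.language = (β : EReal) ∧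
            TimedWord.entropicBandwidth ε G.language = (β : EReal)) ∧
          -- it is given by the smallest root of the characteristic equation of the determinized
          -- 0-elimination of `G` (and is `0` if there is no root)
          ((∃ z₀ : ℝ, 0 < z₀ ∧
              G.zeroElim.determinize.charQuasiPoly (z₀ : ℂ) = 0 ∧
              (∀ z : ℂ, G.zeroElim.determinize.charQuasiPoly z = 0 → z₀ ≤ ‖z‖) ∧
              β = -Real.logb 2 z₀) ∨
            ((∀ z : ℂ, G.zeroElim.determinize.charQuasiPoly z ≠ 0) ∧ β = 0)) ∧
          -- it is the logarithm of an algebraic number, computed exactly by `F`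
          (∃ α : ℝ, 0 < α ∧ IsAlgebraic ℚ α ∧ β = Real.logb 2 α ∧
            ∀ c : STGCode, c.Describes G → (F c).Describes α) := by
  obtain ⟨F, hF, hFdesc⟩ := exists_computable_describes
  refine ⟨F, hF, fun Q A _ _ G ⟨_, q, _⟩ => ?_⟩
  have : Nonempty Q := ⟨q⟩
  obtain ⟨D, hG⟩ := G.exists_isDenom
  obtain ⟨γ, hγ⟩ := exists_isGrowthRate_eventSets (G.finite_ticks D)
  have hD : (0 : ℝ≥0) < D := by exact_mod_cast hG.pos
  exact ⟨Real.logb 2 (γ ^ D), hG.hasGrowthRate hγ,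
    ⟨1 / (2 * D), by positivity, fun ε _ hε =>
      ⟨hG.capacitiveBandwidth_eq hγ hε, hG.entropicBandwidth_eq hγ hε⟩⟩,
    STG.exists_smallest_root_or_forall_ne_zero hG hγ,
    γ ^ D, pow_pos hγ.pos D, (STG.isAlgebraic_of_isGrowthRate hG hγ).pow D, rfl,
    fun c hc => hFdesc hG hγ hc⟩
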